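/- Let $\boldsymbol{k}$ be a field and let $A$ and $B$ be finite-dimensional Hopf algebras over $\boldsymbol{k}$. If the categories ${}_A\mathsf{M}$ and ${}_B\mathsf{M}$ of left modules are equivalent as $\boldsymbol{k}$-linear monoidal categories, then, for every $n$ and every braid $\boldsymbol{b}$ in the $n$-strand braid group $B_n$, $$\underline{\boldsymbol{b}\text{-}\dim}^{r}({}_{D(A)}A)=\underline{\boldsymbol{b}\text{-}\dim}^{r}({}_{D(B)}B)\quad\text{and}\quad \underline{\boldsymbol{b}\text{-}\dim}^{l}({}_{D(A)}A)=\underline{\boldsymbol{b}\text{-}\dim}^{l}({}_{D(B)}B).$$ Here the notation is as follows. * $D(A)$ is the Drinfel'd double: as a coalgebra $D(A)=A^{*\mathrm{cop}}\otimes A$, with elements $p\bowtie a$, unit $\varepsilon\bowtie 1$ and product $(p\bowtie a)(p'\bowtie a')=\sum \langle p'_{(1)},S^{-1}(a_{(3)})\rangle\langle p'_{(3)},a_{(1)}\rangle\; pp'_{(2)}\bowtie a_{(2)}a'$, where $A^*$ carries the convolution product and the coproduct determined by $\langle \Delta(p),a\otimes b\rangle=\langle p,ab\rangle$. It is a quasitriangular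 Hopf algebra with universal $R$-matrix $\mathcal R=\sum_i(\varepsilon\bowtie e_i)\otimes(e^i\bowtie 1)$ for dual bases $(e_i)$ of $A$ and $(e^i)$ of $A^*$. Its category of left modules is braided by $c_{X,Y}(x\otimes y)=T(\mathcal R\cdot(x\otimes y))$, where $T$ is the flip. * The Schrödinger module ${}_{D(A)}A$ is the vector space $A$ with the action $(p\bowtie a)\bullet b=(a\blacktriangleright b)\leftharpoonup S^{-1}(p)$, where $a\blacktriangleright b=\sum a_{(1)}bS(a_{(2)})$ and $b\leftharpoonup p=\sum\langle p,b_{(1)}\rangle b_{(2)}$; thus $(p\bowtie 1)\bullet b=\sum\langle p,S^{-1}(b_{(1)})\rangle b_{(2)}$. * A finite-dimensional $D(A)$-module $X$ has the left dual $X^*$, with action $(h\varphi)(x)=\varphi(S(h)x)$, evaluation $e_X:X^*\otimes X\to \boldsymbol{k}$ and coevaluation $n_X:\boldsymbol{k}\to X\otimes X^*$. Omitting associativity and unit isomorphisms, the left partial braided trace of $f:X\otimes Y\to X\otimes Z$ is $$(e_X\otimes \mathrm{id}_Z)\circ(\mathrm{id}_{X^*}\otimes f)\circ(c_{X^*,X}^{-1}\otimes\mathrm{id}_Y)\circ(n_X\otimes\mathrm{id}_Y):Y\to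 Z,$$ and the right partial braided trace of $f:Y\otimes X\to Z\otimes X$ is $$(\mathrm{id}_Z\otimes e_X)\circ(\mathrm{id}_Z\otimes c_{X,X^*})\circ(f\otimes\mathrm{id}_{X^*})\circ(\mathrm{id}_Y\otimes n_X):Y\to Z.$$ * For $M={}_{D(A)}A$, let $\rho_M:B_n\to \mathrm{GL}(M^{\otimes n})$ be the representation in which the generator $\sigma_i$ acts by $c_{M,M}$ on the $i$-th and $(i+1)$-st tensor factors. Then $\underline{\boldsymbol{b}\text{-}\dim}^{l}(M)$ (respectively $\underline{\boldsymbol{b}\text{-}\dim}^{r}(M)$) is the scalar by which the endomorphism of $\boldsymbol{k}$ acts that is obtained from $\rho_M(\boldsymbol{b})$ by applying the left (respectively right) partial braided trace over $M$ successively $n$ times, each time over the leftmost (respectively rightmost) tensor factor. -/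

import Mathlib

open scoped TensorProduct
open Coalgebra

universe u

set_option linter.unusedSectionVars false

attribute [fun_prop] IsLinearMap

namespace HopfMorita

section lin
variable {k : Type*} [CommRing k] {U V W X : Type*} [AddCommGroup U] [Module k U]
  [AddCommGroup V] [Module k V] [AddCommGroup W] [Module k W] [AddCommGroup X] [Module k X]

@[fun_prop] theorem lin_id : IsLinearMap k (fun x : U => x) := ⟨fun _ _ => rfl, fun _ _ => rfl⟩

@[fun_prop] theorem lin_zero : IsLinearMap k (fun _ : U => (0 : V)) := ⟨by simp, by simp⟩

@[fun_prop] theorem lin_comp {f : V → W} {g : U → V} (hf : IsLinearMap k f)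
    (hg : IsLinearMap k g) : IsLinearMap k (fun x => f (g x)) :=
  ⟨fun x y => by rw [hg.map_add, hf.map_add], fun c x => by rw [hg.map_smul, hf.map_smul]⟩

@[fun_prop] theorem lin_linearMap (f : V →ₗ[k] W) : IsLinearMap k (fun x : V => f x) := f.isLinear

@[fun_prop] theorem lin_linearMap_app {f : U → V →ₗ[k] W} (hf : IsLinearMap k f) (v : V) :
    IsLinearMap k (fun x : U => f x v) :=
  ⟨fun x y => by rw [hf.map_add]; rfl, fun c x => by rw [hf.map_smul]; rfl⟩

@[fun_prop] theorem lin_tmul_left {f : U → V} (hf : IsLinearMap k f) (w : W) :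
    IsLinearMap k (fun x : U => f x ⊗ₜ[k] w) :=
  ⟨fun x y => by rw [hf.map_add, TensorProduct.add_tmul],
   fun c x => by rw [hf.map_smul, TensorProduct.smul_tmul']⟩

@[fun_prop] theorem lin_tmul_right {f : U → W} (hf : IsLinearMap k f) (v : V) :
    IsLinearMap k (fun x : U => v ⊗ₜ[k] f x) :=
  ⟨fun x y => by rw [hf.map_add, TensorProduct.tmul_add],
   fun c x => by rw [hf.map_smul, TensorProduct.tmul_smul]⟩

@[fun_prop] theorem lin_sum {ι : Type*} (s : Finset ι) {f : ι → U → V}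
    (hf : ∀ i, IsLinearMap k (f i)) : IsLinearMap k (fun x => ∑ i ∈ s, f i x) :=
  ⟨fun x y => by simp [(hf _).map_add, Finset.sum_add_distrib],
   fun c x => by simp [(hf _).map_smul, Finset.smul_sum]⟩

variable {A : Type*} [Ring A] [Algebra k A] {B : Type*} [Ring B] [Algebra k B]

@[fun_prop] theorem lin_algHom (f : A →ₐ[k] B) : IsLinearMap k (fun x : A => f x) :=
  f.toLinearMap.isLinear

@[fun_prop] theorem lin_mul_left {f : U → A} (hf : IsLinearMap k f) (w : A) :
    IsLinearMap k (fun x : U => f x * w) :=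
  ⟨fun x y => by rw [hf.map_add, add_mul], fun c x => by rw [hf.map_smul, smul_mul_assoc]⟩

@[fun_prop] theorem lin_mul_right {f : U → A} (hf : IsLinearMap k f) (v : A) :
    IsLinearMap k (fun x : U => v * f x) :=
  ⟨fun x y => by rw [hf.map_add, mul_add], fun c x => by rw [hf.map_smul, mul_smul_comm]⟩

@[fun_prop] theorem lin_smul_left {f : U → k} (hf : IsLinearMap k f) (w : W) :
    IsLinearMap k (fun x : U => f x • w) :=
  ⟨fun x y => by rw [hf.map_add, add_smul], fun c x => by rw [hf.map_smul, smul_assoc]⟩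

@[fun_prop] theorem lin_smul_right {f : U → W} (hf : IsLinearMap k f) (c : k) :
    IsLinearMap k (fun x : U => c • f x) :=
  ⟨fun x y => by rw [hf.map_add, smul_add], fun d x => by rw [hf.map_smul, smul_comm]⟩

end lin

section coalg
variable {k : Type*} [CommRing k] {C : Type*} [AddCommGroup C] [Module k C] [Coalgebra k C]
  {U V M : Type*} [AddCommGroup U] [Module k U] [AddCommGroup V] [Module k V]
  [AddCommGroup M] [Module k M]

variable (k) in
/-- Sweedler notation: `sw k F a = ∑ F a₍₁₎ a₍₂₎` (for bilinear `F`). -/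
noncomputable def sw (F : C → C → M) (a : C) : M :=
  ∑ i ∈ (ℛ k a).index, F ((ℛ k a).left i) ((ℛ k a).right i)

/-- The linear map out of the tensor product given by a bilinear function. -/
noncomputable def lft {U V M : Type*} [AddCommGroup U] [Module k U] [AddCommGroup V] [Module k V]
    [AddCommGroup M] [Module k M] (F : U → V → M) (h₁ : ∀ y, IsLinearMap k (fun x => F x y))
    (h₂ : ∀ x, IsLinearMap k (fun y => F x y)) : U ⊗[k] V →ₗ[k] M :=
  TensorProduct.lift (LinearMap.mk₂ k F (fun x y z => (h₁ z).map_add x y)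
    (fun c x z => (h₁ z).map_smul c x) (fun x y z => (h₂ x).map_add y z)
    (fun c x z => (h₂ x).map_smul c z))

@[simp] theorem lft_tmul (F : U → V → M) (h₁ : ∀ y, IsLinearMap k (fun x => F x y))
    (h₂ : ∀ x, IsLinearMap k (fun y => F x y)) (x : U) (y : V) :
    lft F h₁ h₂ (x ⊗ₜ y) = F x y := rfl

theorem sw_eq {F : C → C → M} (h₁ : ∀ y, IsLinearMap k (fun x => F x y))
    (h₂ : ∀ x, IsLinearMap k (fun y => F x y)) (a : C) :
    sw k F a = lft F h₁ h₂ (comul a) := by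
  conv_rhs => rw [← (ℛ k a).eq]
  simp [sw]

@[fun_prop] theorem lin_sw {F : C → C → M} (h₁ : ∀ y, IsLinearMap k (fun x => F x y))
    (h₂ : ∀ x, IsLinearMap k (fun y => F x y)) : IsLinearMap k (fun a => sw k F a) := by
  have : (fun a => sw k F a) = fun a => (lft F h₁ h₂ ∘ₗ comul) a := by
    funext a; exact sw_eq h₁ h₂ a
  rw [this]; exact LinearMap.isLinear _

@[fun_prop] theorem lin_sw' {F : U → C → C → M} (h : ∀ x y, IsLinearMap k (fun t => F t x y))
    (a : C) : IsLinearMap k (fun t => sw k (F t) a) :=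
  ⟨fun s t => by simp [sw, (h _ _).map_add, Finset.sum_add_distrib],
   fun s t => by simp [sw, (h _ _).map_smul, Finset.smul_sum]⟩

theorem map_sw {f : M → V} (hf : IsLinearMap k f) (F : C → C → M) (a : C) :
    f (sw k F a) = sw k (fun x y => f (F x y)) a := by
  have := map_sum hf.mk' (fun i => F ((ℛ k a).left i) ((ℛ k a).right i)) (ℛ k a).index
  exact this

theorem sw_coassoc {F : C → C → C → M} (h₁ : ∀ y z, IsLinearMap k (fun x => F x y z))
    (h₂ : ∀ x z, IsLinearMap k (fun y => F x y z)) (h₃ : ∀ x y, IsLinearMap k (fun z => F x y z))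
    (a : C) :
    sw k (fun x z => sw k (fun u v => F u v z) x) a = sw k (fun x y => sw k (fun u v => F x u v) y) a := by
  let G : C ⊗[k] (C ⊗[k] C) →ₗ[k] M := lft (fun x t => lft (F x) (h₂ x) (h₃ x) t)
    (fun t => by
      induction t with
      | zero => simp; fun_prop
      | tmul u v => simp; fun_prop
      | add s t hs ht =>
        simp only [map_add]
        exact ⟨fun x y => by rw [hs.map_add, ht.map_add]; abel, fun c x => by rw [hs.map_smul, ht.map_smul, smul_add]⟩)
    (fun x => by fun_prop)
  have h := congrArg G (coassoc_apply (R := k) a)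
  have e₁ : ∀ t : C ⊗[k] C, G (TensorProduct.assoc k C C C (comul.rTensor C t)) =
      lft (fun x z => sw k (fun u v => F u v z) x) (fun z => by fun_prop)
        (fun x => by fun_prop) t := by
    intro t
    induction t with
    | zero => simp
    | tmul x z =>
      simp only [LinearMap.rTensor_tmul, lft_tmul]
      rw [sw_eq (by fun_prop) (by fun_prop)]
      generalize comul (R := k) x = s
      induction s with
      | zero => simp
      | tmul u v => simp [G]
      | add s t hs ht => simp only [TensorProduct.add_tmul, map_add, hs, ht]
    | add s t hs ht => simp only [map_add, hs, ht]
  have e₂ : ∀ t : C ⊗[k] C, G (comul.lTensor C t) =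
      lft (fun x y => sw k (fun u v => F x u v) y) (fun z => by fun_prop)
        (fun x => by fun_prop) t := by
    intro t
    induction t with
    | zero => simp
    | tmul x z =>
      simp only [LinearMap.lTensor_tmul, lft_tmul]
      rw [sw_eq (by fun_prop) (by fun_prop)]
      generalize comul (R := k) z = s
      induction s with
      | zero => simp
      | tmul u v => simp [G]
      | add s t hs ht => simp only [TensorProduct.tmul_add, map_add, hs, ht]
    | add s t hs ht => simp only [map_add, hs, ht]
  rw [e₁, e₂] at h
  rw [sw_eq (by fun_prop) (by fun_prop), sw_eq (by fun_prop) (by fun_prop), h]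

theorem sw_counit_left {f : C → M} (hf : IsLinearMap k f) (a : C) :
    sw k (fun x y => counit (R := k) x • f y) a = f a := by
  have h := congrArg (fun t => (TensorProduct.lid k M) (hf.mk'.lTensor k t))
    (rTensor_counit_comul (R := k) a)
  rw [sw_eq (by fun_prop) (by fun_prop)]
  simp only [LinearMap.lTensor_tmul, TensorProduct.lid_tmul, one_smul] at h
  refine Eq.trans ?_ h
  generalize comul (R := k) a = s
  induction s with
  | zero => simp
  | tmul u v => simp
  | add s t hs ht => simp only [map_add, hs, ht]

theorem sw_counit_right {f : C → M} (hf : IsLinearMap k f) (a : C) :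
    sw k (fun x y => counit (R := k) y • f x) a = f a := by
  have h := congrArg (fun t => (TensorProduct.rid k M) (hf.mk'.rTensor k t))
    (lTensor_counit_comul (R := k) a)
  rw [sw_eq (by fun_prop) (by fun_prop)]
  simp only [LinearMap.rTensor_tmul, TensorProduct.rid_tmul, one_smul] at h
  refine Eq.trans ?_ h
  generalize comul (R := k) a = s
  induction s with
  | zero => simp
  | tmul u v => simp
  | add s t hs ht => simp only [map_add, hs, ht]

theorem sw_comm {C' : Type*} [AddCommGroup C'] [Module k C'] [Coalgebra k C']
    (F : C → C → C' → C' → M) (a : C) (b : C') :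
    sw k (fun x y => sw k (fun u v => F x y u v) b) a =
      sw k (fun u v => sw k (fun x y => F x y u v) a) b :=
  Finset.sum_comm

end coalg

section bialg
variable {k : Type*} [CommRing k] {A : Type*} [Ring A] [Bialgebra k A]
  {M : Type*} [AddCommGroup M] [Module k M]

theorem sw_mul {F : A → A → M} (h₁ : ∀ y, IsLinearMap k (fun x => F x y))
    (h₂ : ∀ x, IsLinearMap k (fun y => F x y)) (a b : A) :
    sw k F (a * b) =
      sw k (fun x y => sw k (fun u v => F (x * u) (y * v)) b) a := by
  rw [sw_eq h₁ h₂, Bialgebra.comul_mul, sw_eq (by fun_prop) (by fun_prop)]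
  generalize comul (R := k) a = s
  induction s with
  | zero => simp
  | add s t hs ht => simp only [add_mul, map_add, hs, ht]
  | tmul x y =>
    simp only [lft_tmul]
    rw [sw_eq (by fun_prop) (by fun_prop)]
    generalize comul (R := k) b = s
    induction s with
    | zero => simp
    | add s t hs ht => simp only [mul_add, map_add, hs, ht]
    | tmul u v => simp

theorem sw_one {F : A → A → M} (h₁ : ∀ y, IsLinearMap k (fun x => F x y))
    (h₂ : ∀ x, IsLinearMap k (fun y => F x y)) : sw k F (1 : A) = F 1 1 := by
  rw [sw_eq h₁ h₂, Bialgebra.comul_one, Algebra.TensorProduct.one_def, lft_tmul]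

end bialg

section hopf
variable {k : Type*} [CommRing k] {A : Type*} [Ring A] [HopfAlgebra k A]
  {M : Type*} [AddCommGroup M] [Module k M]

theorem sw_S_mul {f : A → M} (hf : IsLinearMap k f) (a : A) :
    sw k (fun x y => f (HopfAlgebra.antipode k x * y)) a = counit (R := k) a • f 1 := by
  rw [← map_sw hf, sw, HopfAlgebra.sum_antipode_mul_eq_smul, hf.map_smul]

theorem sw_mul_S {f : A → M} (hf : IsLinearMap k f) (a : A) :
    sw k (fun x y => f (x * HopfAlgebra.antipode k y)) a = counit (R := k) a • f 1 := by
  rw [← map_sw hf, sw, HopfAlgebra.sum_mul_antipode_eq_smul, hf.map_smul]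

theorem sw_S_mul' {F : A → A → M} (h₁ : ∀ y, IsLinearMap k (fun x => F x y))
    (h₂ : ∀ x, IsLinearMap k (fun y => F x y)) (a : A) :
    sw k (fun x y => sw k (fun u v => F (HopfAlgebra.antipode k x * u) v) y) a = F 1 a := by
  rw [← sw_coassoc (by fun_prop) (by fun_prop) (by fun_prop)]
  simp only [sw_S_mul (h₁ _), sw_counit_left (h₂ 1)]

theorem sw_mul_S' {F : A → A → M} (h₁ : ∀ y, IsLinearMap k (fun x => F x y))
    (h₂ : ∀ x, IsLinearMap k (fun y => F x y)) (a : A) :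
    sw k (fun x y => sw k (fun u v => F (x * HopfAlgebra.antipode k u) v) y) a = F 1 a := by
  rw [← sw_coassoc (by fun_prop) (by fun_prop) (by fun_prop)]
  simp only [sw_mul_S (h₁ _), sw_counit_left (h₂ 1)]

end hopf
end HopfMorita

namespace HopfMorita
open HopfAlgebra

section hopf
variable {k : Type*} [CommRing k] {A : Type*} [Ring A] [HopfAlgebra k A]
  {M : Type*} [AddCommGroup M] [Module k M]

theorem sw_tmul_comul (a : A) : sw k (fun x y => x ⊗ₜ[k] y) a = comul (R := k) a := by
  rw [sw, (ℛ k a).eq]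

theorem comul_antipode (a : A) :
    comul (R := k) (antipode k a) = sw k (fun x y => antipode k y ⊗ₜ[k] antipode k x) a := by
  have e₁ : sw k (fun x y => sw k (fun u v => sw k (fun p q =>
      antipode k q ⊗ₜ[k] antipode k p) x * comul (R := k) u * comul (R := k) (antipode k v)) y) a
      = sw k (fun x y => antipode k y ⊗ₜ[k] antipode k x) a := by
    have h : ∀ x y : A, sw k (fun u v => sw k (fun p q =>
      antipode k q ⊗ₜ[k] antipode k p) x * comul (R := k) u * comul (R := k) (antipode k v)) y
      = counit (R := k) y • sw k (fun p q => antipode k q ⊗ₜ[k] antipode k p) x := by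
      intro x y
      simp only [mul_assoc, ← Bialgebra.comul_mul]
      rw [sw_mul_S (f := fun z => sw k (fun p q =>
        antipode k q ⊗ₜ[k] antipode k p) x * comul (R := k) z) (by fun_prop)]
      simp
    simp only [h]
    exact sw_counit_right (f := fun x => sw k (fun p q => antipode k q ⊗ₜ[k] antipode k p) x)
      (by fun_prop) a
  have e₂ : ∀ a : A, sw k (fun x y => sw k (fun p q =>
      antipode k q ⊗ₜ[k] antipode k p) x * comul (R := k) y) a = counit (R := k) a • 1 := by
    intro a
    have : ∀ x y : A, sw k (fun p q =>
        antipode k q ⊗ₜ[k] antipode k p) x * comul (R := k) y =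
        sw k (fun p q => sw k (fun r s => (antipode k q * r) ⊗ₜ[k] (antipode k p * s)) y) x := by
      intro x y
      rw [map_sw (f := fun z => z * comul (R := k) y) (by fun_prop), ← sw_tmul_comul]
      congr 1; funext p q
      rw [map_sw (f := fun z => (antipode k q ⊗ₜ[k] antipode k p : A ⊗[k] A) * z) (by fun_prop)]
      simp
    simp only [this]
    rw [sw_coassoc (by fun_prop) (by fun_prop) (by fun_prop)]
    have h : ∀ p y : A, sw k (fun q z => sw k (fun r s =>
        (antipode k q * r) ⊗ₜ[k] (antipode k p * s)) z) y =
        (1 : A) ⊗ₜ[k] (antipode k p * y) := fun p y =>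
      sw_S_mul' (F := fun r s => r ⊗ₜ[k] (antipode k p * s)) (by fun_prop) (by fun_prop) y
    simp only [h]
    rw [sw_S_mul (f := fun z => (1 : A) ⊗ₜ[k] z) (by fun_prop), Algebra.TensorProduct.one_def]
  rw [← e₁, ← sw_coassoc (by fun_prop) (by fun_prop) (by fun_prop)]
  have h : ∀ x z : A, sw k (fun u v => sw k (fun p q =>
      antipode k q ⊗ₜ[k] antipode k p) u * comul (R := k) v * comul (R := k) (antipode k z)) x
      = counit (R := k) x • comul (R := k) (antipode k z) := by
    intro x z
    rw [← map_sw (f := fun t => t * comul (R := k) (antipode k z)) (by fun_prop), e₂]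
    simp
  simp only [h]
  exact (sw_counit_left (f := fun z => comul (R := k) (antipode k z)) (by fun_prop) a).symm

theorem sw_antipode {F : A → A → M} (h₁ : ∀ y, IsLinearMap k (fun x => F x y))
    (h₂ : ∀ x, IsLinearMap k (fun y => F x y)) (a : A) :
    sw k F (antipode k a) = sw k (fun x y => F (antipode k y) (antipode k x)) a := by
  rw [sw_eq h₁ h₂, comul_antipode, map_sw (f := lft F h₁ h₂) (by fun_prop)]
  simp

/-- `∑ F(x₁, x₂ S(b)) = ∑ F((x S(b₁))₁ b₂, (x S(b₁))₂)`. -/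
theorem sw_strong {F : A → A → M} (h₁ : ∀ y, IsLinearMap k (fun x => F x y))
    (h₂ : ∀ x, IsLinearMap k (fun y => F x y)) (x b : A) :
    sw k (fun u v => F u (v * antipode k b)) x =
      sw k (fun c d => sw k (fun u v => F (u * d) v) (x * antipode k c)) b := by
  have e : ∀ c d : A, sw k (fun u v => F (u * d) v) (x * antipode k c) =
      sw k (fun p q => sw k (fun u v => F (u * (antipode k q * d)) (v * antipode k p)) x) c := by
    intro c d
    rw [sw_mul (by fun_prop) (by fun_prop), sw_comm,
      sw_antipode (by fun_prop) (by fun_prop)]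
    simp only [mul_assoc]
  simp only [e]
  rw [sw_coassoc (by fun_prop) (by fun_prop) (by fun_prop)]
  have h : ∀ p y : A, sw k (fun q d => sw k (fun u v =>
      F (u * (antipode k q * d)) (v * antipode k p)) x) y =
      counit (R := k) y • sw k (fun u v => F u (v * antipode k p)) x := by
    intro p y
    rw [sw_S_mul (f := fun z => sw k (fun u v => F (u * z) (v * antipode k p)) x) (by fun_prop)]
    simp
  simp only [h]
  rw [sw_counit_right (f := fun p => sw k (fun u v => F u (v * antipode k p)) x) (by fun_prop)]

end hopf

section fd
variable {k : Type*} [Field k] {A : Type*} [Ring A] [HopfAlgebra k A]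
  {M : Type*} [AddCommGroup M] [Module k M]

/-- The underlying algebra of the Hopf algebra `A*ᶜᵒᵖ`: the dual space of `A` with the convolution
product `⟨p q, a⟩ = ∑ ⟨p, a₁⟩ ⟨q, a₂⟩` and the unit `ε`. Its coalgebra structure (opposite to
the one given by `⟨Δ p, a ⊗ b⟩ = ⟨p, a b⟩`) is `DualCop.instCoalgebra`. -/
def DualCop (k : Type*) [Field k] (A : Type*) [Ring A] [HopfAlgebra k A] : Type _ :=
  WithConv (A →ₗ[k] k)

noncomputable instance : Ring (DualCop k A) := inferInstanceAs (Ring (WithConv (A →ₗ[k] k)))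

noncomputable instance : Algebra k (DualCop k A) :=
  inferInstanceAs (Algebra k (WithConv (A →ₗ[k] k)))

/-- A linear form, as an element of `DualCop k A`. -/
def form (f : A →ₗ[k] k) : DualCop k A := WithConv.toConv f

/-- The natural pairing `⟨p, a⟩`. -/
def pr (p : DualCop k A) (a : A) : k := WithConv.ofConv p a

theorem pr_ext {p q : DualCop k A} (h : ∀ a, pr p a = pr q a) : p = q :=
  WithConv.ofConv_injective (LinearMap.ext h)

@[simp] theorem pr_form (f : A →ₗ[k] k) (a : A) : pr (form f) a = f a := rfl

@[simp] theorem pr_add (p q : DualCop k A) (a : A) : pr (p + q) a = pr p a + pr q a := rfl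

@[simp] theorem pr_smul (c : k) (p : DualCop k A) (a : A) : pr (c • p) a = c * pr p a := rfl

@[fun_prop] theorem lin_pr (p : DualCop k A) : IsLinearMap k (fun x : A => pr p x) :=
  (WithConv.ofConv p).isLinear

@[fun_prop] theorem lin_pr_app {U : Type*} [AddCommGroup U] [Module k U]
    {f : U → DualCop k A} (hf : IsLinearMap k f) (a : A) :
    IsLinearMap k (fun x : U => pr (f x) a) :=
  ⟨fun x y => by rw [hf.map_add]; rfl, fun c x => by rw [hf.map_smul]; rfl⟩

theorem pr_mul (p q : DualCop k A) (a : A) :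
    pr (p * q) a = sw k (fun x y => pr p x * pr q y) a :=
  (ℛ k a).convMul_apply (A := k) p q

@[simp] theorem pr_one (a : A) : pr (1 : DualCop k A) a = counit (R := k) a := rfl

variable [FiniteDimensional k A]

variable (k A) in
/-- A basis of the underlying vector space. -/
noncomputable abbrev bas : Module.Basis (Fin (Module.finrank k A)) k A := Module.finBasis k A

variable (k A) in
/-- The dual basis, in the dual algebra. -/
noncomputable def dbas (i : Fin (Module.finrank k A)) : DualCop k A :=
  form ((bas k A).coord i)

theorem dbas_sum {f : A → M} (hf : IsLinearMap k f) (a : A) :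
    ∑ i, pr (dbas k A i) a • f (bas k A i) = f a := by
  have := congrArg hf.mk' ((bas k A).sum_repr a)
  rw [map_sum] at this
  simpa [dbas] using this

theorem dbas_sum' {f : DualCop k A → M} (hf : IsLinearMap k f)
    (p : DualCop k A) : ∑ i, pr p (bas k A i) • f (dbas k A i) = f p := by
  have h : p = ∑ i, pr p (bas k A i) • dbas k A i := by
    refine pr_ext fun a => ?_
    have e : IsLinearMap k (fun p : DualCop k A => pr p a) := by fun_prop
    refine Eq.trans ?_ (map_sum e.mk' _ _).symm
    rw [← dbas_sum (lin_pr p) a]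
    simp only [map_smul, smul_eq_mul, IsLinearMap.mk'_apply, mul_comm]
  conv_rhs => rw [h]
  rw [← hf.mk'_apply, map_sum]
  simp

theorem dbas_sw {Ψ : A → A → DualCop k A → M}
    (h₁ : ∀ y p, IsLinearMap k (fun x => Ψ x y p)) (h₂ : ∀ x p, IsLinearMap k (fun y => Ψ x y p))
    (h₃ : ∀ x y, IsLinearMap k (fun p => Ψ x y p)) :
    ∑ j, sw k (fun x y => Ψ x y (dbas k A j)) (bas k A j) =
      ∑ i, ∑ l, Ψ (bas k A i) (bas k A l) (dbas k A i * dbas k A l) := by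
  have e : ∀ j, sw k (fun x y => Ψ x y (dbas k A j)) (bas k A j) = ∑ i, ∑ l,
      pr (dbas k A i * dbas k A l) (bas k A j) • Ψ (bas k A i) (bas k A l) (dbas k A j) := by
    intro j
    have : ∀ x y, Ψ x y (dbas k A j) = ∑ i, ∑ l, (pr (dbas k A i) x * pr (dbas k A l) y) •
        Ψ (bas k A i) (bas k A l) (dbas k A j) := by
      intro x y
      rw [← dbas_sum (h₁ y _) x]
      refine Finset.sum_congr rfl fun i _ => ?_
      rw [← dbas_sum (h₂ _ _) y, Finset.smul_sum]
      simp only [mul_smul]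
    rw [show (fun x y => Ψ x y (dbas k A j)) = _ from funext₂ this, sw, Finset.sum_comm]
    refine Finset.sum_congr rfl fun i _ => ?_
    rw [Finset.sum_comm]
    refine Finset.sum_congr rfl fun l _ => ?_
    rw [pr_mul, sw, Finset.sum_smul]
  simp only [e]
  rw [Finset.sum_comm]
  refine Finset.sum_congr rfl fun i _ => ?_
  rw [Finset.sum_comm]
  refine Finset.sum_congr rfl fun l _ => ?_
  exact dbas_sum' (h₃ _ _) _

/-- A projection onto the space of integrals in the dual. -/
noncomputable def integ (q : DualCop k A) (x : A) : k :=
  ∑ j, pr (dbas k A j * q) (x * antipode k (antipode k (bas k A j)))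

@[fun_prop] theorem lin_integ (q : DualCop k A) : IsLinearMap k (fun x : A => integ q x) :=
  by unfold integ; fun_prop

theorem integ_invariant (q : DualCop k A) (x : A) :
    sw k (fun u v => integ q v • u) x = integ q x • (1 : A) := by
  have e₁ : sw k (fun u v => integ q v • u) x = ∑ j, sw k (fun c d =>
      sw k (fun u v => pr (dbas k A j * q) v • (u * antipode k c))
        (x * antipode k (antipode k d))) (bas k A j) := by
    have : ∀ j, sw k (fun c d =>
        sw k (fun u v => pr (dbas k A j * q) v • (u * antipode k c))
          (x * antipode k (antipode k d))) (bas k A j) =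
        sw k (fun u v => pr (dbas k A j * q) (v * antipode k (antipode k (bas k A j))) • u) x := by
      intro j
      rw [sw_strong (F := fun u v => pr (dbas k A j * q) v • u) (by fun_prop) (by fun_prop),
        sw_antipode (by fun_prop) (by fun_prop)]
    simp only [this, integ, Finset.sum_smul]
    exact Finset.sum_comm
  rw [e₁, dbas_sw (Ψ := fun c d p => sw k (fun u v => pr (p * q) v • (u * antipode k c))
        (x * antipode k (antipode k d))) (by fun_prop) (by fun_prop) (by fun_prop),
    Finset.sum_comm, integ, Finset.sum_smul]
  refine Finset.sum_congr rfl fun l _ => ?_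
  generalize x * antipode k (antipode k (bas k A l)) = y
  have e₂ : ∀ i, sw k (fun u v => pr (dbas k A i * dbas k A l * q) v • (u * antipode k (bas k A i))) y
      = sw k (fun u v => sw k (fun p r => pr (dbas k A i) p • pr (dbas k A l * q) r •
        (u * antipode k (bas k A i))) v) y := by
    intro i
    congr 1; funext u v
    rw [mul_assoc, pr_mul, map_sw (k := k) (f := fun c : k => c • (u * antipode k (bas k A i)))
      (by fun_prop)]
    simp only [mul_smul]
  simp only [e₂]
  have e₃ : ∑ i, sw k (fun u v => sw k (fun p r => pr (dbas k A i) p • pr (dbas k A l * q) r •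
        (u * antipode k (bas k A i))) v) y = sw k (fun u v => sw k (fun p r =>
        pr (dbas k A l * q) r • (u * antipode k p)) v) y := by
    simp only [sw]
    rw [Finset.sum_comm]
    refine Finset.sum_congr rfl fun a _ => ?_
    rw [Finset.sum_comm]
    refine Finset.sum_congr rfl fun b _ => ?_
    exact dbas_sum (f := fun p => pr (dbas k A l * q) _ • (_ * antipode k p)) (by fun_prop) _
  rw [e₃, sw_mul_S' (F := fun u v => pr (dbas k A l * q) v • u) (by fun_prop) (by fun_prop)]

theorem sum_integ (q : DualCop k A) (x : A) :
    ∑ i, integ (dbas k A i * q) (x * antipode k (bas k A i)) = pr q x := by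
  have h := dbas_sw (k := k) (A := A) (Ψ := fun c d p =>
    pr (p * q) (x * antipode k (antipode k c * d))) (by fun_prop) (by fun_prop) (by fun_prop)
  have e : ∀ j, sw k (fun c d => pr (dbas k A j * q) (x * antipode k (antipode k c * d)))
      (bas k A j) = counit (R := k) (bas k A j) • pr (dbas k A j * q) x := by
    intro j
    rw [sw_S_mul (f := fun z => pr (dbas k A j * q) (x * antipode k z)) (by fun_prop)]
    simp
  simp only [e] at h
  have e' : ∑ j, counit (R := k) (bas k A j) • pr (dbas k A j * q) x = pr q x := by
    have := dbas_sum' (k := k) (A := A) (f := fun p => pr (p * q) x) (by fun_prop) 1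
    simpa only [pr_one, one_mul] using this
  rw [← e', h, Finset.sum_comm]
  refine Finset.sum_congr rfl fun i _ => ?_
  refine Finset.sum_congr rfl fun j _ => ?_
  simp only [antipode_mul_antidistrib, mul_assoc]

variable (k A) in
theorem exists_integral : ∃ l : A →ₗ[k] k, l ≠ 0 ∧
    ∀ x, sw k (fun u v => l v • u) x = l x • (1 : A) := by
  by_contra! h
  have h₀ : ∀ (q : DualCop k A) (x : A), integ q x = 0 := by
    intro q x
    by_contra hx
    obtain ⟨y, hy⟩ := h (lin_integ q).mk' (fun h0 => hx (congrArg (fun f => f x) h0))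
    exact hy (integ_invariant q y)
  have := sum_integ (1 : DualCop k A) 1
  simp [h₀] at this

variable (k A) in
theorem antipode_injective : Function.Injective (antipode k (A := A)) := by
  obtain ⟨l, hl, hinv⟩ := exists_integral k A
  rw [← LinearMap.ker_eq_bot, LinearMap.ker_eq_bot']
  intro a ha
  have h₁ : ∀ x, sw k (fun c d => l (x * antipode k c) • d) a = 0 := by
    intro x
    have := sw_strong (k := k) (F := fun u v => l v • u) (by fun_prop) (by fun_prop) x a
    rw [ha] at this
    have e : ∀ c d : A, sw k (fun u v => l v • (u * d)) (x * antipode k c) =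
        l (x * antipode k c) • d := by
      intro c d
      have := congrArg (fun t => t * d) (hinv (x * antipode k c))
      simp only [smul_mul_assoc, one_mul] at this
      rw [← this, map_sw (f := fun t => t * d) (by fun_prop)]
      simp only [smul_mul_assoc]
    simp only [e] at this
    rw [← this]
    simp [sw]
  have h₂ : ∀ y, l y • a = 0 := by
    intro y
    have e₁ : sw k (fun c z => sw k (fun d e => l (y * antipode k (c * antipode k d)) • e) z) a
        = l y • a := by
      rw [sw_mul_S' (F := fun u v => l (y * antipode k u) • v) (by fun_prop) (by fun_prop)]
      simp
    rw [← e₁]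
    have e₂ : ∀ c d e : A, l (y * antipode k (c * antipode k d)) • e = ∑ j,
        pr (dbas k A j) (antipode k (antipode k d)) • l (y * bas k A j * antipode k c) • e := by
      intro c d e
      rw [dbas_sum (f := fun t => l (y * t * antipode k c) • e) (by fun_prop),
        antipode_mul_antidistrib, mul_assoc]
    have e₃ : sw k (fun c z => sw k (fun d e => l (y * antipode k (c * antipode k d)) • e) z) a
        = ∑ j, sw k (fun c z => l (y * bas k A j * antipode k c) •
          sw k (fun d e => pr (dbas k A j) (antipode k (antipode k d)) • e) z) a := by
      simp only [e₂]
      simp only [sw, Finset.smul_sum]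
      symm
      rw [Finset.sum_comm]
      refine Finset.sum_congr rfl fun i _ => ?_
      rw [Finset.sum_comm]
      refine Finset.sum_congr rfl fun i _ => ?_
      refine Finset.sum_congr rfl fun j _ => ?_
      rw [smul_comm]
    rw [e₃]
    refine Finset.sum_eq_zero fun j _ => ?_
    have := congrArg (fun t => sw k (fun d e => pr (dbas k A j) (antipode k (antipode k d)) • e) t)
      (h₁ (y * bas k A j))
    rw [map_sw (f := fun t => sw k (fun d e => pr (dbas k A j) (antipode k (antipode k d)) • e) t)
      (by fun_prop)] at this
    have z : sw k (fun d e => pr (dbas k A j) (antipode k (antipode k d)) • e) (0 : A) = 0 :=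
      (lin_sw (k := k) (C := A) (F := fun d e : A => pr (dbas k A j) (antipode k (antipode k d)) • e)
        (by fun_prop) (by fun_prop)).map_zero
    rw [z] at this
    rw [← this]
    congr 1; funext c z
    have l' : IsLinearMap k (fun t : A =>
      sw k (fun d e => pr (dbas k A j) (antipode k (antipode k d)) • e) t) := by fun_prop
    exact (l'.map_smul _ _).symm
  by_contra hne
  apply hl
  ext y
  simpa [hne] using h₂ y

variable (k A) in
/-- The antipode of a finite-dimensional Hopf algebra, as a linear automorphism. -/
noncomputable def antipodeEquiv : A ≃ₗ[k] A :=
  LinearEquiv.ofBijective (antipode k)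
    ⟨antipode_injective k A, LinearMap.injective_iff_surjective.1 (antipode_injective k A)⟩

end fd
end HopfMorita

namespace HopfMorita
open HopfAlgebra

section fd
variable {k : Type*} [Field k] {A : Type*} [Ring A] [HopfAlgebra k A]
  {M : Type*} [AddCommGroup M] [Module k M]

theorem map_comul {C : Type*} [AddCommGroup C] [Module k C] [Coalgebra k C]
    (f : C ⊗[k] C →ₗ[k] M) (a : C) : f (comul a) = sw k (fun x y => f (x ⊗ₜ y)) a := by
  rw [← map_sw f.isLinear, sw, (ℛ k a).eq]

/-- Right translation: `⟨rt c p, x⟩ = ⟨p, x c⟩`. -/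
noncomputable def rt : A →ₗ[k] DualCop k A →ₗ[k] DualCop k A :=
  LinearMap.mk₂ k (fun c p => form ((lin_pr p).mk' ∘ₗ LinearMap.mulRight k c))
    (fun x y p => pr_ext fun a => by simp [mul_add, (lin_pr p).map_add])
    (fun c x p => pr_ext fun a => by simp)
    (fun x p q => rfl) (fun c x p => rfl)

/-- Left translation: `⟨lt c p, x⟩ = ⟨p, c x⟩`. -/
noncomputable def lt : A →ₗ[k] DualCop k A →ₗ[k] DualCop k A :=
  LinearMap.mk₂ k (fun c p => form ((lin_pr p).mk' ∘ₗ LinearMap.mulLeft k c))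
    (fun x y p => pr_ext fun a => by simp [add_mul, (lin_pr p).map_add])
    (fun c x p => pr_ext fun a => by simp)
    (fun x p q => rfl) (fun c x p => rfl)

@[simp] theorem pr_rt (c : A) (p : DualCop k A) (x : A) :
    pr (rt c p) x = pr p (x * c) := rfl

@[simp] theorem pr_lt (c : A) (p : DualCop k A) (x : A) :
    pr (lt c p) x = pr p (c * x) := rfl

theorem rt_mul (c : A) (p q : DualCop k A) :
    rt c (p * q) = sw k (fun x y => rt x p * rt y q) c := by
  refine pr_ext fun a => ?_
  rw [map_sw (f := fun p => pr p a) (by fun_prop), pr_rt, pr_mul,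
    sw_mul (by fun_prop) (by fun_prop), sw_comm]
  simp only [pr_mul, pr_rt]

theorem lt_mul (c : A) (p q : DualCop k A) :
    lt c (p * q) = sw k (fun x y => lt x p * lt y q) c := by
  refine pr_ext fun a => ?_
  rw [map_sw (f := fun p => pr p a) (by fun_prop), pr_lt, pr_mul,
    sw_mul (by fun_prop) (by fun_prop)]
  simp only [pr_mul, pr_lt]

theorem rt_one (c : A) : rt c (1 : DualCop k A) = counit (R := k) c • 1 := by
  refine pr_ext fun a => ?_
  simp only [pr_rt, pr_one, Bialgebra.counit_mul]
  rw [mul_comm]; rfl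

theorem lt_one (c : A) : lt c (1 : DualCop k A) = counit (R := k) c • 1 := by
  refine pr_ext fun a => ?_
  simp only [pr_lt, pr_one, Bialgebra.counit_mul]
  rfl

variable [FiniteDimensional k A]

theorem dbas_rt {Φ : DualCop k A → A → M} (h₁ : ∀ x, IsLinearMap k (fun p => Φ p x))
    (h₂ : ∀ p, IsLinearMap k (fun x => Φ p x)) (c : A) :
    ∑ i, Φ (rt c (dbas k A i)) (bas k A i) = ∑ i, Φ (dbas k A i) (bas k A i * c) := by
  have e : ∀ i, Φ (rt c (dbas k A i)) (bas k A i) =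
      ∑ l, pr (dbas k A i) (bas k A l * c) • Φ (dbas k A l) (bas k A i) := fun i => by
    rw [← dbas_sum' (h₁ _) (rt c _)]; rfl
  simp only [e]
  rw [Finset.sum_comm]
  exact Finset.sum_congr rfl fun i _ => dbas_sum (h₂ _) _

theorem dbas_lt {Φ : DualCop k A → A → M} (h₁ : ∀ x, IsLinearMap k (fun p => Φ p x))
    (h₂ : ∀ p, IsLinearMap k (fun x => Φ p x)) (c : A) :
    ∑ i, Φ (lt c (dbas k A i)) (bas k A i) = ∑ i, Φ (dbas k A i) (c * bas k A i) := by
  have e : ∀ i, Φ (lt c (dbas k A i)) (bas k A i) =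
      ∑ l, pr (dbas k A i) (c * bas k A l) • Φ (dbas k A l) (bas k A i) := fun i => by
    rw [← dbas_sum' (h₁ _) (lt c _)]; rfl
  simp only [e]
  rw [Finset.sum_comm]
  exact Finset.sum_congr rfl fun i _ => dbas_sum (h₂ _) _

/-- Evaluation of an element of `A* ⊗ A*` on a pair of elements of `A`. -/
noncomputable def ev₂ (x y : A) :
    DualCop k A ⊗[k] DualCop k A →ₗ[k] k :=
  lft (fun p q => pr p x * pr q y) (by fun_prop) (by fun_prop)

theorem ev₂_ext {s t : DualCop k A ⊗[k] DualCop k A}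
    (h : ∀ x y, ev₂ x y s = ev₂ x y t) : s = t := by
  have e : ∀ t : DualCop k A ⊗[k] DualCop k A,
      ∑ i, ∑ j, ev₂ (bas k A i) (bas k A j) t • (dbas k A i ⊗ₜ[k] dbas k A j) = t := by
    intro t
    induction t with
    | zero => simp
    | add s t hs ht => simp only [map_add, add_smul, Finset.sum_add_distrib, hs, ht]
    | tmul p q =>
      refine Eq.trans ?_ (dbas_sum' (f := fun p => p ⊗ₜ[k] q) (by fun_prop) p)
      refine Finset.sum_congr rfl fun i _ => ?_
      rw [← dbas_sum' (f := fun q => dbas k A i ⊗ₜ[k] q) (by fun_prop) q, Finset.smul_sum]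
      simp only [ev₂, lft_tmul, mul_smul]
  rw [← e s, ← e t]
  simp only [h]

end fd

section dual
variable (k : Type*) [Field k] (A : Type*) [Ring A] [HopfAlgebra k A]

variable [FiniteDimensional k A]

/-- The coalgebra structure on `A*ᶜᵒᵖ`; see `DualCop.ev₂_comul` for the characterisation
`⟨Δᶜᵒᵖ p, x ⊗ y⟩ = ⟨p, y x⟩` of the coproduct, which is written here as
`Δᶜᵒᵖ p = ∑ᵢ eⁱ ⊗ p(- eᵢ)`. -/
noncomputable instance DualCop.instCoalgebra : Coalgebra k (DualCop k A) where
  comul := ∑ i, (TensorProduct.mk k (DualCop k A) (DualCop k A) (dbas k A i)) ∘ₗ rt (bas k A i)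
  counit := (lin_pr_app (k := k) (f := fun p : DualCop k A => p) (by fun_prop) 1).mk'
  coassoc := by
    refine LinearMap.ext fun p => ?_
    simp only [LinearMap.comp_apply, LinearMap.sum_apply, TensorProduct.mk_apply, map_sum,
      LinearMap.rTensor_tmul, LinearMap.lTensor_tmul, TensorProduct.sum_tmul,
      TensorProduct.tmul_sum, LinearEquiv.coe_coe, TensorProduct.assoc_tmul]
    rw [Finset.sum_comm]
    refine Finset.sum_congr rfl fun j _ => ?_
    rw [dbas_rt (Φ := fun q x => dbas k A j ⊗ₜ[k] (q ⊗ₜ[k] rt x p)) (by fun_prop) (by fun_prop)]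
    refine Finset.sum_congr rfl fun i _ => ?_
    congr 2
    refine pr_ext fun a => ?_
    simp [mul_assoc]
  rTensor_counit_comp_comul := by
    refine LinearMap.ext fun p => ?_
    simp only [LinearMap.comp_apply, LinearMap.sum_apply, TensorProduct.mk_apply, map_sum,
      LinearMap.rTensor_tmul, IsLinearMap.mk'_apply]
    have := dbas_sum (k := k) (A := A) (f := fun x => (1 : k) ⊗ₜ[k] rt x p) (by fun_prop) 1
    simp only [TensorProduct.smul_tmul', smul_eq_mul, mul_one] at this
    rw [this]
    congr 1
    exact pr_ext fun a => by simp
  lTensor_counit_comp_comul := by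
    refine LinearMap.ext fun p => ?_
    simp only [LinearMap.comp_apply, LinearMap.sum_apply, TensorProduct.mk_apply, map_sum,
      LinearMap.lTensor_tmul, IsLinearMap.mk'_apply, pr_rt, one_mul]
    have := dbas_sum' (k := k) (A := A) (f := fun q => q ⊗ₜ[k] (1 : k)) (by fun_prop) p
    simp only [← TensorProduct.tmul_smul, smul_eq_mul, mul_one] at this
    rw [this]; rfl

variable {k A}

theorem DualCop.comul_def (p : DualCop k A) :
    comul (R := k) p = ∑ i, dbas k A i ⊗ₜ[k] rt (bas k A i) p := by
  simp [CoalgebraStruct.comul]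

@[simp] theorem DualCop.counit_def (p : DualCop k A) : counit (R := k) p = pr p 1 := rfl

theorem DualCop.ev₂_comul (p : DualCop k A) (x y : A) :
    ev₂ x y (comul (R := k) p) = pr p (y * x) := by
  rw [DualCop.comul_def, map_sum]
  simp only [ev₂, lft_tmul, pr_rt]
  exact dbas_sum (f := fun z => pr p (y * z)) (by fun_prop) x

theorem DualCop.ev₂_mul (s t : DualCop k A ⊗[k] DualCop k A) (x y : A) :
    ev₂ x y (s * t) = sw k (fun x₁ x₂ => sw k (fun y₁ y₂ => ev₂ x₁ y₁ s * ev₂ x₂ y₂ t) y) x := by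
  induction s with
  | zero => simp [sw]
  | add s s' hs hs' =>
    simp only [add_mul, map_add, hs, hs']
    simp only [sw, Finset.sum_add_distrib]
  | tmul p q =>
    induction t with
    | zero => simp [sw]
    | add t t' ht ht' =>
      simp only [mul_add, map_add, ht, ht']
      simp only [sw, Finset.sum_add_distrib]
    | tmul p' q' =>
      simp only [Algebra.TensorProduct.tmul_mul_tmul, ev₂, lft_tmul, pr_mul]
      simp only [sw, Finset.sum_mul_sum]
      refine Finset.sum_congr rfl fun i _ => Finset.sum_congr rfl fun j _ => by ring

theorem DualCop.comul_mul (p q : DualCop k A) :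
    comul (R := k) (p * q) = comul (R := k) p * comul (R := k) q := by
  refine ev₂_ext fun x y => ?_
  rw [DualCop.ev₂_mul, DualCop.ev₂_comul, pr_mul, sw_mul (by fun_prop) (by fun_prop), sw_comm]
  simp only [DualCop.ev₂_comul]

theorem DualCop.comul_one : comul (R := k) (1 : DualCop k A) = 1 := by
  refine ev₂_ext fun x y => ?_
  rw [DualCop.ev₂_comul, Algebra.TensorProduct.one_def]
  simp [ev₂, mul_comm]

/-- `A*ᶜᵒᵖ` is a bialgebra. -/
noncomputable instance DualCop.instBialgebra : Bialgebra k (DualCop k A) :=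
  Bialgebra.mk' k (DualCop k A) (by simp) (by
    intro p q
    simp only [DualCop.counit_def, pr_mul]
    rw [sw_one (by fun_prop) (by fun_prop)]) DualCop.comul_one (fun {p q} => DualCop.comul_mul p q)

end dual
end HopfMorita

namespace HopfMorita
open HopfAlgebra

section double
variable {k : Type*} [Field k] {A : Type*} [Ring A] [HopfAlgebra k A] [FiniteDimensional k A]

variable (k A) in
/-- The inverse `S⁻¹` of the antipode. -/
noncomputable def sinv : A →ₗ[k] A := (antipodeEquiv k A).symm.toLinearMap

theorem antipode_sinv (a : A) : antipode k (sinv k A a) = a :=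
  (antipodeEquiv k A).apply_symm_apply a

theorem sinv_antipode (a : A) : sinv k A (antipode k a) = a :=
  (antipodeEquiv k A).symm_apply_apply a

theorem sinv_mul (a b : A) : sinv k A (a * b) =
    sinv k A b * sinv k A a := by
  apply antipode_injective k A
  simp only [antipode_mul_antidistrib, antipode_sinv]

theorem sinv_one : sinv k A (1 : A) = 1 := by
  apply antipode_injective k A
  simp only [antipode_one, antipode_sinv]

theorem counit_sinv (a : A) : counit (R := k) (sinv k A a) = counit (R := k) a := by
  rw [← counit_antipode, antipode_sinv]

variable {M : Type*} [AddCommGroup M] [Module k M]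

theorem sw_sinv {F : A → A → M} (h₁ : ∀ y, IsLinearMap k (fun x => F x y))
    (h₂ : ∀ x, IsLinearMap k (fun y => F x y)) (a : A) :
    sw k F (sinv k A a) =
      sw k (fun x y => F (sinv k A y) (sinv k A x)) a := by
  conv_rhs => rw [← antipode_sinv (k := k) a, sw_antipode (by fun_prop) (by fun_prop)]
  simp only [sinv_antipode]

/-- `∑ S⁻¹(a₂) a₁ = ε(a)`. -/
theorem sw_sinv_mul {f : A → M} (hf : IsLinearMap k f) (a : A) :
    sw k (fun x y => f (sinv k A y * x)) a = counit (R := k) a • f 1 := by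
  have e := sw_S_mul (k := k) (f := fun z => f (sinv k A z)) (by fun_prop) a
  rw [sinv_one] at e
  rw [← e]
  congr 1; funext x y
  rw [sinv_mul, sinv_antipode]

/-- `∑ a₂ S⁻¹(a₁) = ε(a)`. -/
theorem sw_mul_sinv {f : A → M} (hf : IsLinearMap k f) (a : A) :
    sw k (fun x y => f (y * sinv k A x)) a = counit (R := k) a • f 1 := by
  have e := sw_mul_S (k := k) (f := fun z => f (sinv k A z)) (by fun_prop) a
  rw [sinv_one] at e
  rw [← e]
  congr 1; funext x y
  rw [sinv_mul, sinv_antipode]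

/-- The Drinfel'd double `D(A)`, with underlying coalgebra `A*ᶜᵒᵖ ⊗ A`. -/
def Double (k : Type*) [Field k] (A : Type*) [Ring A] [HopfAlgebra k A] : Type _ :=
  DualCop k A ⊗[k] A

noncomputable instance : AddCommGroup (Double k A) :=
  inferInstanceAs (AddCommGroup (DualCop k A ⊗[k] A))

noncomputable instance : Module k (Double k A) :=
  inferInstanceAs (Module k (DualCop k A ⊗[k] A))

noncomputable instance : Coalgebra k (Double k A) :=
  inferInstanceAs (Coalgebra k (DualCop k A ⊗[k] A))

namespace Double

/-- The element `p ⋈ a` of the Drinfel'd double. -/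
noncomputable def bow (p : DualCop k A) (a : A) : Double k A := p ⊗ₜ[k] a

@[fun_prop] theorem lin_bow_left {U : Type*} [AddCommGroup U] [Module k U] {f : U → DualCop k A}
    (hf : IsLinearMap k f) (a : A) : IsLinearMap k (fun x => bow (f x) a) :=
  lin_tmul_left hf a

@[fun_prop] theorem lin_bow_right {U : Type*} [AddCommGroup U] [Module k U] {f : U → A}
    (hf : IsLinearMap k f) (p : DualCop k A) : IsLinearMap k (fun x => bow p (f x)) :=
  lin_tmul_right hf p

theorem induction {P : Double k A → Prop} (h₀ : P 0) (h₁ : ∀ p a, P (bow p a))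
    (h₂ : ∀ x y, P x → P y → P (x + y)) (x : Double k A) : P x :=
  TensorProduct.induction_on x h₀ h₁ h₂

theorem hom_ext {f g : Double k A →ₗ[k] M} (h : ∀ p a, f (bow p a) = g (bow p a)) : f = g :=
  TensorProduct.ext' h

/-- The linear map out of the double given by a bilinear function. -/
noncomputable def elim (F : DualCop k A → A → M) (h₁ : ∀ y, IsLinearMap k (fun x => F x y))
    (h₂ : ∀ x, IsLinearMap k (fun y => F x y)) : Double k A →ₗ[k] M := lft F h₁ h₂

@[simp] theorem elim_bow (F : DualCop k A → A → M) (h₁ : ∀ y, IsLinearMap k (fun x => F x y))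
    (h₂ : ∀ x, IsLinearMap k (fun y => F x y)) (p : DualCop k A) (a : A) :
    elim F h₁ h₂ (bow p a) = F p a := rfl

/-- The operator `r ⋈ b ↦ f(r) ⋈ g(b)`. -/
noncomputable def opr (f : DualCop k A →ₗ[k] DualCop k A) (g : A →ₗ[k] A) :
    Module.End k (Double k A) := TensorProduct.map f g

@[simp] theorem opr_bow (f : DualCop k A →ₗ[k] DualCop k A) (g : A →ₗ[k] A) (p : DualCop k A)
    (a : A) : opr f g (bow p a) = bow (f p) (g a) := rfl

/-- `p ↦ (r ⋈ b ↦ p r ⋈ b)`. -/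
noncomputable def opP : DualCop k A →ₐ[k] Module.End k (Double k A) :=
  AlgHom.ofLinearMap
    (IsLinearMap.mk' (fun p => opr (LinearMap.mulLeft k p) .id)
      ⟨fun x y => hom_ext fun p a => by
        simp [add_mul, (lin_bow_left (k := k) (A := A) lin_id a).map_add],
       fun c x => hom_ext fun p a => by
        simp [(lin_bow_left (k := k) (A := A) lin_id a).map_smul]⟩)
    (hom_ext fun p a => by simp) (fun x y => hom_ext fun p a => by simp)

/-- `c ↦ (r ⋈ b ↦ r(- c) ⋈ b)`. -/
noncomputable def op₁ : A →ₐ[k] Module.End k (Double k A) :=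
  AlgHom.ofLinearMap
    (IsLinearMap.mk' (fun c => opr (rt c) .id)
      ⟨fun x y => hom_ext fun p a => by
        simp [(lin_bow_left (k := k) (A := A) lin_id a).map_add],
       fun c x => hom_ext fun p a => by
        simp [(lin_bow_left (k := k) (A := A) lin_id a).map_smul]⟩)
    (hom_ext fun p a => by simp [show rt 1 p = p from pr_ext fun a => by simp])
    (fun x y => hom_ext fun p a => by
      simp [show rt (x * y) p = rt x (rt y p) from pr_ext fun a => by simp [mul_assoc]])

/-- `c ↦ (r ⋈ b ↦ r ⋈ c b)`. -/
noncomputable def op₂ : A →ₐ[k] Module.End k (Double k A) :=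
  AlgHom.ofLinearMap
    (IsLinearMap.mk' (fun c => opr .id (LinearMap.mulLeft k c))
      ⟨fun x y => hom_ext fun p a => by
        simp [add_mul, (lin_bow_right (k := k) (A := A) lin_id p).map_add],
       fun c x => hom_ext fun p a => by
        simp [(lin_bow_right (k := k) (A := A) lin_id p).map_smul]⟩)
    (hom_ext fun p a => by simp) (fun x y => hom_ext fun p a => by simp)

/-- `c ↦ (r ⋈ b ↦ r(S⁻¹(c) -) ⋈ b)`. -/
noncomputable def op₃ : A →ₐ[k] Module.End k (Double k A) :=
  AlgHom.ofLinearMap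
    (IsLinearMap.mk' (fun c => opr (lt (sinv k A c)) .id)
      ⟨fun x y => hom_ext fun p a => by
        simp [(lin_bow_left (k := k) (A := A) lin_id a).map_add],
       fun c x => hom_ext fun p a => by
        simp [(lin_bow_left (k := k) (A := A) lin_id a).map_smul]⟩)
    (hom_ext fun p a => by
      simp [sinv_one, show lt 1 p = p from pr_ext fun a => by simp])
    (fun x y => hom_ext fun p a => by
      simp [sinv_mul, show ∀ x y, lt (y * x) p = lt x (lt y p) from fun x y =>
        pr_ext fun a => by simp [mul_assoc]])

@[simp] theorem opP_bow (q p : DualCop k A) (a : A) : opP q (bow p a) = bow (q * p) a := rfl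
@[simp] theorem op₁_bow (c : A) (p : DualCop k A) (a : A) : op₁ c (bow p a) = bow (rt c p) a := rfl
@[simp] theorem op₂_bow (c : A) (p : DualCop k A) (a : A) : op₂ c (bow p a) = bow p (c * a) := rfl
@[simp] theorem op₃_bow (c : A) (p : DualCop k A) (a : A) :
    op₃ c (bow p a) = bow (lt (sinv k A c) p) a := rfl

theorem commute₂₃ (x y : A) : Commute (op₂ (k := k) x) (op₃ y) := hom_ext fun p a => by simp

theorem commute₁₂ (x y : A) : Commute (op₁ (k := k) x) (op₂ y) := hom_ext fun p a => by simp

theorem commute₁₃ (x y : A) : Commute (op₁ (k := k) x) (op₃ y) := hom_ext fun p a => by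
  simp only [Module.End.mul_apply, op₁_bow, op₃_bow]
  congr 1
  exact pr_ext fun a => by simp [mul_assoc]

/-- The operator `a ↦ (r ⋈ b ↦ ∑ r(S⁻¹(a₃) - a₁) ⋈ a₂ b)`. -/
noncomputable def opL : A →ₐ[k] Module.End k (Double k A) :=
  (Algebra.TensorProduct.lift op₁
    ((Algebra.TensorProduct.lift op₂ op₃ commute₂₃).comp (Bialgebra.comulAlgHom k A))
    (fun x y => by
      simp only [AlgHom.comp_apply, Bialgebra.comulAlgHom_apply]
      generalize comul (R := k) y = t
      induction t with
      | zero => simp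
      | tmul u v =>
        simp only [Algebra.TensorProduct.lift_tmul]
        exact (commute₁₂ x u).mul_right (commute₁₃ x v)
      | add s t hs ht => rw [map_add]; exact hs.add_right ht)).comp (Bialgebra.comulAlgHom k A)

theorem opL_eq (a : A) : opL (k := k) a =
    sw k (fun x y => sw k (fun u v => op₁ x * (op₂ u * op₃ v)) y) a := by
  have e := map_comul (k := k)
    ((Algebra.TensorProduct.lift (op₂ (k := k) (A := A)) op₃ commute₂₃).toLinearMap)
  simp only [AlgHom.toLinearMap_apply, Algebra.TensorProduct.lift_tmul] at e
  simp only [opL, AlgHom.comp_apply, Bialgebra.comulAlgHom_apply]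
  rw [← AlgHom.toLinearMap_apply, map_comul]
  simp only [AlgHom.toLinearMap_apply, Algebra.TensorProduct.lift_tmul, AlgHom.comp_apply,
    Bialgebra.comulAlgHom_apply, e]
  congr 1; funext x y
  exact map_sw (f := fun z => op₁ x * z) (by fun_prop) _ _

theorem opL_bow (a : A) (p : DualCop k A) (b : A) : opL (k := k) a (bow p b) =
    sw k (fun x y => sw k (fun u v =>
      bow (rt x (lt (sinv k A v) p)) (u * b)) y) a := by
  rw [opL_eq, map_sw (f := fun z : Module.End k (Double k A) => z (bow p b)) (by fun_prop)]
  congr 1; funext x y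
  rw [map_sw (f := fun z : Module.End k (Double k A) => z (bow p b)) (by fun_prop)]
  rfl

theorem op₁_opP (c : A) (q : DualCop k A) :
    op₁ c * opP q = sw k (fun x y => opP (rt x q) * op₁ y) c := by
  refine hom_ext fun p a => ?_
  rw [map_sw (f := fun z : Module.End k (Double k A) => z (bow p a)) (by fun_prop)]
  simp only [Module.End.mul_apply, opP_bow, op₁_bow, rt_mul]
  exact map_sw (f := fun z => bow z a) (by fun_prop) _ _

theorem op₃_opP (c : A) (q : DualCop k A) :
    op₃ c * opP q = sw k (fun x y => opP (lt (sinv k A y) q) * op₃ x) c := by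
  refine hom_ext fun p a => ?_
  rw [map_sw (f := fun z : Module.End k (Double k A) => z (bow p a)) (by fun_prop)]
  simp only [Module.End.mul_apply, opP_bow, op₃_bow, lt_mul]
  rw [map_sw (f := fun z => bow z a) (by fun_prop), sw_sinv (by fun_prop) (by fun_prop)]

theorem op₂_opP (c : A) (q : DualCop k A) : op₂ c * opP q = opP q * op₂ c :=
  hom_ext fun p a => by simp

theorem opL_opP (a : A) (q : DualCop k A) : opL a * opP q =
    sw k (fun x y => sw k (fun u v =>
      opP (rt x (lt (sinv k A v) q)) * opL u) y) a := by
  have e₁ : opL a * opP q = sw k (fun a₁ y => sw k (fun a₂ y => sw k (fun a₃ y => sw k (fun a₄ a₅ =>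
      opP (rt a₁ (lt (sinv k A a₅) q)) * (op₁ a₂ * (op₂ a₃ * op₃ a₄))) y) y) y) a := by
    rw [opL_eq, map_sw (f := fun z => z * opP q) (by fun_prop)]
    have : ∀ x y, sw k (fun u v => op₁ (k := k) (A := A) x * (op₂ u * op₃ v)) y * opP q =
        sw k (fun x₁ x₂ => sw k (fun u v => sw k (fun v₁ v₂ =>
          opP (rt x₁ (lt (sinv k A v₂) q)) * (op₁ x₂ * (op₂ u * op₃ v₁))) v) y) x := by
      intro x y
      rw [map_sw (f := fun z => z * opP q) (by fun_prop), sw_comm]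
      congr 1; funext u v
      rw [mul_assoc, mul_assoc, op₃_opP, map_sw (f := fun z => op₁ x * (op₂ u * z)) (by fun_prop),
        sw_comm]
      congr 1; funext v₁ v₂
      rw [← mul_assoc (op₂ u), op₂_opP, mul_assoc, ← mul_assoc, op₁_opP,
        map_sw (f := fun z => z * _) (by fun_prop)]
      simp only [mul_assoc]
    simp only [this]
    rw [sw_coassoc (by fun_prop) (by fun_prop) (by fun_prop)]
  rw [e₁]
  refine congrArg (fun F => sw k F a) (funext₂ fun x y => ?_)
  have e₂ : ∀ u v, opP (rt x (lt (sinv k A v) q)) * opL u =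
      sw k (fun a₂ y => sw k (fun a₃ a₄ =>
        opP (rt x (lt (sinv k A v) q)) * (op₁ a₂ * (op₂ a₃ * op₃ a₄))) y) u := by
    intro u v
    rw [opL_eq, map_sw (f := fun z => _ * z) (by fun_prop)]
    congr 1; funext a b
    rw [map_sw (f := fun z => _ * z) (by fun_prop)]
  simp only [e₂]
  rw [sw_coassoc (by fun_prop) (by fun_prop) (by fun_prop)]
  refine congrArg (fun F => sw k F y) (funext₂ fun a₂ y => ?_)
  rw [sw_coassoc (by fun_prop) (by fun_prop) (by fun_prop)]

/-- Left multiplication operators of the Drinfel'd double. -/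
noncomputable def mulL : Double k A →ₗ[k] Module.End k (Double k A) :=
  elim (fun p a => opP p * opL a) (by fun_prop) (by fun_prop)

@[simp] theorem mulL_bow (p : DualCop k A) (a : A) : mulL (bow p a) = opP p * opL a := rfl

theorem mulL_opP (p : DualCop k A) (z : Double k A) : mulL (opP p z) = opP p * mulL z := by
  induction z using induction with
  | h₀ => simp
  | h₁ q b => simp [mul_assoc]
  | h₂ x y hx hy => simp only [map_add, hx, hy, mul_add]

theorem mulL_opL (a : A) (z : Double k A) : mulL (opL a z) = opL a * mulL z := by
  induction z using induction with
  | h₀ => simp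
  | h₁ q b =>
    rw [mulL_bow, ← mul_assoc, opL_opP, opL_bow, map_sw (f := fun z => mulL z) (by fun_prop),
      map_sw (f := fun z => z * opL b) (by fun_prop)]
    congr 1; funext x y
    rw [map_sw (f := fun z => mulL z) (by fun_prop),
      map_sw (f := fun z => z * opL b) (by fun_prop)]
    simp [mul_assoc]
  | h₂ x y hx hy => simp only [map_add, hx, hy, mul_add]

theorem mulL_mulL (x z : Double k A) : mulL (mulL x z) = mulL x * mulL z := by
  induction x using induction with
  | h₀ => simp
  | h₁ p a => simp [mulL_opP, mulL_opL, mul_assoc]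
  | h₂ x y hx hy => simp only [map_add, hx, hy, add_mul, LinearMap.add_apply]

theorem opL_one (a : A) : opL (k := k) a (bow 1 1) = bow 1 a := by
  rw [opL_bow]
  have e : ∀ x u v : A, bow (k := k) (rt x (lt (sinv k A v) 1)) (u * 1) =
      counit (R := k) v • counit (R := k) x • bow 1 u := by
    intro x u v
    rw [lt_one, map_smul, rt_one, counit_sinv, mul_one]
    rw [← (lin_bow_left (k := k) (A := A) lin_id u).map_smul,
      ← (lin_bow_left (k := k) (A := A) lin_id u).map_smul]
  simp only [e]
  have e' : ∀ x y : A, sw k (fun u v => counit (R := k) v • counit (R := k) x • bow (k := k) 1 u) y =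
    counit (R := k) x • bow (k := k) 1 y := fun x y =>
      sw_counit_right (f := fun u => counit (R := k) x • bow (k := k) 1 u) (by fun_prop) y
  simp only [e']
  exact sw_counit_left (f := fun u => bow (k := k) 1 u) (by fun_prop) a

noncomputable instance : Ring (Double k A) :=
  { (inferInstance : AddCommGroup (Double k A)) with
    mul := fun x y => mulL x y
    one := bow 1 1
    left_distrib := fun x y z => map_add (mulL x) y z
    right_distrib := fun x y z => by
      change mulL (x + y) z = mulL x z + mulL y z
      rw [map_add]; rfl
    zero_mul := fun x => by change mulL 0 x = 0; rw [map_zero]; rfl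
    mul_zero := fun x => map_zero (mulL x)
    mul_assoc := fun x y z => by
      change mulL (mulL x y) z = mulL x (mulL y z)
      rw [mulL_mulL]; rfl
    one_mul := fun x => by
      change mulL (bow 1 1) x = x
      simp
    mul_one := fun x => by
      change mulL x (bow 1 1) = x
      induction x using induction with
      | h₀ => simp
      | h₁ p a => simp [opL_one]
      | h₂ x y hx hy => simp only [map_add, LinearMap.add_apply, hx, hy] }

theorem mul_eq (x y : Double k A) : x * y = mulL x y := rfl

theorem one_eq : (1 : Double k A) = bow 1 1 := rfl

noncomputable instance : Algebra k (Double k A) :=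
  Algebra.ofModule (fun c x y => by simp [mul_eq]) (fun c x y => by simp [mul_eq])

/-- The multiplication of the Drinfel'd double:
`(p ⋈ a)(q ⋈ b) = ∑ p q(S⁻¹(a₃) - a₁) ⋈ a₂ b`, where
`q(S⁻¹(c) - a) = ∑ ⟨q₁, S⁻¹(c)⟩ ⟨q₃, a⟩ q₂`. -/
theorem bow_mul_bow (p q : DualCop k A) (a b : A) : bow p a * bow q b =
    sw k (fun x y => sw k (fun u v =>
      bow (p * rt x (lt (sinv k A v) q)) (u * b)) y) a := by
  rw [mul_eq, mulL_bow, Module.End.mul_apply, opL_bow, map_sw (f := fun z => opP p z) (by fun_prop)]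
  congr 1; funext x y
  rw [map_sw (f := fun z => opP p z) (by fun_prop)]
  rfl

end Double
end double
end HopfMorita

namespace HopfMorita
open HopfAlgebra

section fd
variable {k : Type*} [Field k] {A : Type*} [Ring A] [HopfAlgebra k A] [FiniteDimensional k A]
  {M : Type*} [AddCommGroup M] [Module k M]

theorem rt_rt (x y : A) (p : DualCop k A) : rt x (rt y p) = rt (x * y) p :=
  pr_ext fun a => by simp [mul_assoc]

theorem lt_lt (x y : A) (p : DualCop k A) : lt x (lt y p) = lt (y * x) p :=
  pr_ext fun a => by simp [mul_assoc]

theorem rt_lt (x y : A) (p : DualCop k A) : rt x (lt y p) = lt y (rt x p) :=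
  pr_ext fun a => by simp [mul_assoc]

theorem lt_id (p : DualCop k A) : lt 1 p = p := pr_ext fun a => by simp

theorem rt_id (p : DualCop k A) : rt 1 p = p := pr_ext fun a => by simp

theorem DualCop.comul_def' (p : DualCop k A) :
    comul (R := k) p = ∑ i, lt (bas k A i) p ⊗ₜ[k] dbas k A i := by
  refine ev₂_ext fun x y => ?_
  rw [DualCop.ev₂_comul, map_sum]
  simp only [ev₂, lft_tmul, pr_lt]
  rw [← dbas_sum (f := fun z => pr p (z * x)) (by fun_prop) y]
  exact Finset.sum_congr rfl fun i _ => mul_comm _ _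

end fd

namespace Double
variable {k : Type*} [Field k] {A : Type*} [Ring A] [HopfAlgebra k A] [FiniteDimensional k A]
  {M : Type*} [AddCommGroup M] [Module k M] {E : Type*} [Ring E] [Algebra k E]

/-- The inclusion `p ↦ p ⋈ 1`. -/
noncomputable def P : DualCop k A →ₐ[k] Double k A :=
  AlgHom.ofLinearMap ((lin_bow_left (k := k) (A := A) lin_id 1).mk') rfl
    (fun p q => by simp [mul_eq])

/-- The inclusion `a ↦ ε ⋈ a`. -/
noncomputable def Q : A →ₐ[k] Double k A :=
  AlgHom.ofLinearMap ((lin_bow_right (k := k) (A := A) lin_id 1).mk') rfl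
    (fun a b => by
      simp only [IsLinearMap.mk'_apply, mul_eq, mulL_bow, map_one, one_mul]
      rw [← opL_one b, ← Module.End.mul_apply, ← map_mul, opL_one])

theorem P_apply (p : DualCop k A) : P p = bow p (1 : A) := rfl

theorem Q_apply (a : A) : Q (k := k) a = bow 1 a := rfl

theorem P_mul_Q (p : DualCop k A) (a : A) : P p * Q a = bow p a := by
  simp [mul_eq, P_apply, Q_apply]

theorem Q_mul_P (a : A) (p : DualCop k A) : Q a * P p =
    sw k (fun x y => sw k (fun u v => P (rt x (lt (sinv k A v) p)) * Q u) y) a := by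
  simp only [P_mul_Q]
  simp [mul_eq, P_apply, Q_apply, opL_bow]

/-- The relation `∑ a₁ p(a₂ -) = ∑ p(- a₁) a₂` in the Drinfel'd double. -/
theorem cross (a : A) (p : DualCop k A) :
    sw k (fun x y => Q x * P (lt y p)) a = sw k (fun x y => P (rt x p) * Q y) a := by
  simp only [Q_mul_P, lt_lt]
  rw [sw_coassoc (by fun_prop) (by fun_prop) (by fun_prop)]
  congr 1; funext x y
  rw [sw_coassoc (by fun_prop) (by fun_prop) (by fun_prop)]
  have e : ∀ u z : A, sw k (fun v w => P (rt x (lt (w * sinv k A v) p)) * Q u) z =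
      counit (R := k) z • (P (rt x p) * Q u) := by
    intro u z
    rw [sw_mul_sinv (f := fun t => P (rt x (lt t p)) * Q u) (by fun_prop), lt_id]
  simp only [e]
  rw [sw_counit_right (f := fun u => P (rt x p) * Q u) (by fun_prop)]

/-- The universal property of the Drinfel'd double as an algebra. -/
noncomputable def liftD (f : DualCop k A →ₐ[k] E) (g : A →ₐ[k] E)
    (h : ∀ a p, sw k (fun x y => g x * f (lt y p)) a = sw k (fun x y => f (rt x p) * g y) a) :
    Double k A →ₐ[k] E :=
  have h' : ∀ a p, sw k (fun x y => sw k (fun u v =>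
      f (rt x (lt (sinv k A v) p)) * g u) y) a = g a * f p := by
    intro a p
    rw [← sw_coassoc (F := fun x u v => f (rt x (lt (sinv k A v) p)) * g u)
      (by fun_prop) (by fun_prop) (by fun_prop)]
    simp only [← h, lt_lt]
    rw [sw_coassoc (by fun_prop) (by fun_prop) (by fun_prop)]
    have e : ∀ x y : A, sw k (fun u v => g x * f (lt (sinv k A v * u) p)) y =
        counit (R := k) y • (g x * f p) := by
      intro x y
      rw [sw_sinv_mul (f := fun t => g x * f (lt t p)) (by fun_prop), lt_id]
    simp only [e]
    rw [sw_counit_right (f := fun x => g x * f p) (by fun_prop)]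
  let φ : Double k A →ₗ[k] E := elim (fun p a => f p * g a) (by fun_prop) (by fun_prop)
  AlgHom.ofLinearMap φ (by simp [φ, one_eq]) (by
    have hP : ∀ p z, φ (opP p z) = f p * φ z := by
      intro p z
      induction z using induction with
      | h₀ => simp
      | h₁ q b => simp [φ, mul_assoc]
      | h₂ x y hx hy => simp only [map_add, hx, hy, mul_add]
    have hQ : ∀ a z, φ (opL a z) = g a * φ z := by
      intro a z
      induction z using induction with
      | h₀ => simp
      | h₁ q b =>
        have : φ (bow q b) = f q * g b := rfl
        rw [opL_bow, this, ← mul_assoc, ← h', map_sw (f := fun z => φ z) (by fun_prop),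
          map_sw (f := fun z => z * g b) (by fun_prop)]
        congr 1; funext x y
        rw [map_sw (f := fun z => φ z) (by fun_prop),
          map_sw (f := fun z => z * g b) (by fun_prop)]
        congr 1; funext u v
        simp [φ, mul_assoc]
      | h₂ x y hx hy => simp only [map_add, hx, hy, mul_add]
    intro x y
    induction x using induction with
    | h₀ => simp
    | h₁ p a =>
      rw [mul_eq, mulL_bow, Module.End.mul_apply, hP, hQ, ← mul_assoc]
      rfl
    | h₂ x y hx hy => simp only [add_mul, map_add, hx, hy])

theorem liftD_bow (f : DualCop k A →ₐ[k] E) (g : A →ₐ[k] E)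
    (h : ∀ a p, sw k (fun x y => g x * f (lt y p)) a = sw k (fun x y => f (rt x p) * g y) a)
    (p : DualCop k A) (a : A) : liftD f g h (bow p a) = f p * g a := rfl

theorem counit_bow (p : DualCop k A) (a : A) :
    counit (R := k) (bow p a) = pr p 1 * counit (R := k) a := by
  rw [mul_comm]
  exact TensorProduct.counit_tmul (R := k) (S := k) p a

theorem comul_bow (p : DualCop k A) (a : A) : comul (R := k) (bow p a) =
    ∑ i, sw k (fun x y => bow (dbas k A i) x ⊗ₜ[k] bow (rt (bas k A i) p) y) a := by
  refine (TensorProduct.comul_tmul (R := k) (S := k) p a).trans ?_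
  rw [DualCop.comul_def, TensorProduct.sum_tmul, map_sum]
  refine Finset.sum_congr rfl fun i _ => ?_
  rw [← sw_tmul_comul a, map_sw (f := fun z => TensorProduct.AlgebraTensorModule.tensorTensorTensorComm
    k k k k (DualCop k A) (DualCop k A) A A ((dbas k A i ⊗ₜ[k] (rt (bas k A i)) p) ⊗ₜ[k] z))
    ⟨fun x y => by rw [TensorProduct.tmul_add, map_add],
     fun c x => by rw [TensorProduct.tmul_smul, map_smul]⟩]
  rfl


theorem sw_sum {ι : Type*} (s : Finset ι) {C : Type*} [AddCommGroup C] [Module k C]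
    [Coalgebra k C] (F : ι → C → C → M) (a : C) :
    sw k (fun x y => ∑ i ∈ s, F i x y) a = ∑ i ∈ s, sw k (F i) a := Finset.sum_comm

/-- The comultiplication as an algebra homomorphism. -/
noncomputable def comulHom : Double k A →ₐ[k] Double k A ⊗[k] Double k A :=
  liftD ((Algebra.TensorProduct.map P P).comp (Bialgebra.comulAlgHom k (DualCop k A)))
    ((Algebra.TensorProduct.map Q Q).comp (Bialgebra.comulAlgHom k A)) (by
    intro a p
    have hg : ∀ a, ((Algebra.TensorProduct.map Q Q).comp (Bialgebra.comulAlgHom k A)) a =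
        sw k (fun x y => Q (k := k) x ⊗ₜ[k] Q (k := k) y) a := by
      intro a
      simp only [AlgHom.comp_apply, Bialgebra.comulAlgHom_apply]
      rw [← AlgHom.toLinearMap_apply, map_comul]
      rfl
    have hf : ∀ p, ((Algebra.TensorProduct.map P P).comp
        (Bialgebra.comulAlgHom k (DualCop k A))) p =
        ∑ i, P (dbas k A i) ⊗ₜ[k] P (rt (bas k A i) p) := by
      intro p
      simp only [AlgHom.comp_apply, Bialgebra.comulAlgHom_apply, DualCop.comul_def, map_sum]
      rfl
    simp only [hf, hg]
    have e₁ : ∀ x y : A, sw k (fun x y => Q (k := k) x ⊗ₜ[k] Q (k := k) y) x *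
        ∑ i, P (dbas k A i) ⊗ₜ[k] P (rt (bas k A i) (lt y p)) = sw k (fun u v => ∑ i,
        (Q u * P (dbas k A i)) ⊗ₜ[k] (Q v * P (lt y (rt (bas k A i) p)))) x := by
      intro x y
      rw [map_sw (f := fun z => z * _) (by fun_prop)]
      simp only [Finset.mul_sum, Algebra.TensorProduct.tmul_mul_tmul, rt_lt]
    have e₂ : ∀ u z : A, sw k (fun v y => ∑ i,
        (Q u * P (dbas k A i)) ⊗ₜ[k] (Q v * P (lt y (rt (bas k A i) p)))) z =
        sw k (fun v y => ∑ i, (Q u * P (lt v (dbas k A i))) ⊗ₜ[k] (P (rt (bas k A i) p) * Q y))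
          z := by
      intro u z
      rw [sw_sum]
      have : ∀ i, sw k (fun v y => (Q u * P (dbas k A i)) ⊗ₜ[k]
          (Q v * P (lt y (rt (bas k A i) p)))) z = sw k (fun v y => (Q u * P (dbas k A i)) ⊗ₜ[k]
          (P (rt (v * bas k A i) p) * Q y)) z := by
        intro i
        rw [← map_sw (f := fun z => (Q u * P (dbas k A i)) ⊗ₜ[k] z) (by fun_prop), cross,
          map_sw (f := fun z => (Q u * P (dbas k A i)) ⊗ₜ[k] z) (by fun_prop)]
        simp only [rt_rt]
      simp only [this]
      rw [← sw_sum]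
      congr 1; funext v y
      exact (dbas_lt (Φ := fun q x => (Q u * P q) ⊗ₜ[k] (P (rt x p) * Q y)) (by fun_prop)
        (by fun_prop) v).symm
    have e₃ : ∀ x y : A, sw k (fun u v => ∑ i,
        (Q u * P (lt v (dbas k A i))) ⊗ₜ[k] (P (rt (bas k A i) p) * Q y)) x =
        sw k (fun u v => ∑ i,
        (P (rt u (dbas k A i)) * Q v) ⊗ₜ[k] (P (rt (bas k A i) p) * Q y)) x := by
      intro x y
      rw [sw_sum, sw_sum]
      refine Finset.sum_congr rfl fun i _ => ?_
      rw [← map_sw (f := fun z => z ⊗ₜ[k] (P (rt (bas k A i) p) * Q y)) (by fun_prop), cross,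
        map_sw (f := fun z => z ⊗ₜ[k] (P (rt (bas k A i) p) * Q y)) (by fun_prop)]
    have e₄ : ∀ x y : A, (∑ i, P (dbas k A i) ⊗ₜ[k] P (rt (bas k A i) (rt x p))) *
        sw k (fun x y => Q (k := k) x ⊗ₜ[k] Q (k := k) y) y = sw k (fun u v => ∑ i,
        (P (rt x (dbas k A i)) * Q u) ⊗ₜ[k] (P (rt (bas k A i) p) * Q v)) y := by
      intro x y
      rw [map_sw (f := fun z => _ * z) (by fun_prop)]
      congr 1; funext u v
      simp only [Finset.sum_mul, Algebra.TensorProduct.tmul_mul_tmul, rt_rt]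
      exact (dbas_rt (Φ := fun q x => (P q * Q u) ⊗ₜ[k] (P (rt x p) * Q v)) (by fun_prop)
        (by fun_prop) x).symm
    simp only [e₁, e₄]
    rw [sw_coassoc (by fun_prop) (by fun_prop) (by fun_prop)]
    simp only [e₂]
    rw [← sw_coassoc (by fun_prop) (by fun_prop) (by fun_prop)]
    simp only [e₃]
    rw [sw_coassoc (by fun_prop) (by fun_prop) (by fun_prop)])

theorem comulHom_eq (x : Double k A) : comulHom x = comul (R := k) x := by
  induction x using induction with
  | h₀ => simp
  | h₂ x y hx hy => simp only [map_add, hx, hy]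
  | h₁ p a =>
    rw [comul_bow, comulHom, liftD_bow]
    simp only [AlgHom.comp_apply, Bialgebra.comulAlgHom_apply, DualCop.comul_def, map_sum]
    rw [Finset.sum_mul]
    refine Finset.sum_congr rfl fun i _ => ?_
    rw [← AlgHom.toLinearMap_apply (Algebra.TensorProduct.map Q Q), map_comul,
      map_sw (f := fun z => _ * z) (by fun_prop)]
    congr 1; funext x y
    simp [P_mul_Q]

theorem counit_mul' (x y : Double k A) :
    counit (R := k) (x * y) = counit (R := k) x * counit (R := k) y := by
  have hP : ∀ (p : DualCop k A) z, counit (R := k) (opP p z) = pr p 1 * counit (R := k) z := by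
    intro p z
    induction z using induction with
    | h₀ => simp
    | h₁ q b =>
      simp only [opP_bow, counit_bow, pr_mul]
      rw [sw_one (by fun_prop) (by fun_prop), mul_assoc]
    | h₂ x y hx hy => simp only [map_add, hx, hy, mul_add]
  have hQ : ∀ (a : A) z, counit (R := k) (opL (k := k) a z) =
      counit (R := k) a * counit (R := k) z := by
    intro a z
    induction z using induction with
    | h₀ => simp
    | h₁ q b =>
      rw [opL_bow, map_sw (f := fun z => counit (R := k) z) (by fun_prop)]
      have : ∀ x y : A, counit (R := k) (sw k (fun u v =>
          bow (rt x (lt (sinv k A v) q)) (u * b)) y) =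
          pr q (sinv k A y * x) * counit (R := k) b := by
        intro x y
        rw [map_sw (f := fun z => counit (R := k) z) (by fun_prop)]
        simp only [counit_bow, pr_rt, pr_lt, Bialgebra.counit_mul, one_mul]
        have := sw_counit_left (k := k) (f := fun v =>
          pr q (sinv k A v * x) * counit (R := k) b) (by fun_prop) y
        rw [← this]
        congr 1; funext u v
        simp only [smul_eq_mul]; ring
      simp only [this]
      rw [sw_sinv_mul (k := k) (f := fun t => pr q t * counit (R := k) b) (by fun_prop),
        counit_bow, smul_eq_mul]
    | h₂ x y hx hy => simp only [map_add, hx, hy, mul_add]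
  induction x using induction with
  | h₀ => simp
  | h₁ p a => rw [mul_eq, mulL_bow, Module.End.mul_apply, hP, hQ, counit_bow, mul_assoc]
  | h₂ x y hx hy => simp only [add_mul, map_add, hx, hy]

/-- The Drinfel'd double is a bialgebra. -/
noncomputable instance : Bialgebra k (Double k A) :=
  Bialgebra.mk' k (Double k A) (by simp [one_eq, counit_bow]) (fun {x y} => counit_mul' x y)
    (by rw [← comulHom_eq, map_one])
    (fun {x y} => by rw [← comulHom_eq, map_mul, comulHom_eq, comulHom_eq])

end Double
end HopfMorita

namespace HopfMorita
open HopfAlgebra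

/-- A quasitriangular structure on a bialgebra: an invertible universal R-matrix. -/
class QuasiTriangular (k : Type*) [CommRing k] (H : Type*) [Ring H] [Bialgebra k H] where
  /-- The universal R-matrix. -/
  R : (H ⊗[k] H)ˣ
  /-- `Δᶜᵒᵖ(x) R = R Δ(x)`. -/
  comm_comul (x : H) : TensorProduct.comm k H H (comul x) * (R : H ⊗[k] H) =
    (R : H ⊗[k] H) * comul x
  /-- `(Δ ⊗ id)(R) = R₁₃ R₂₃`. -/
  comul_left : TensorProduct.assoc k H H H ((comul (R := k) (A := H)).rTensor H (R : H ⊗[k] H)) =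
    Algebra.TensorProduct.map (AlgHom.id k H)
        (Algebra.TensorProduct.includeRight : H →ₐ[k] H ⊗[k] H) (R : H ⊗[k] H) *
      (Algebra.TensorProduct.includeRight : H ⊗[k] H →ₐ[k] H ⊗[k] (H ⊗[k] H)) (R : H ⊗[k] H)
  /-- `(id ⊗ Δ)(R) = R₁₃ R₁₂`. -/
  comul_right : (comul (R := k) (A := H)).lTensor H (R : H ⊗[k] H) =
    Algebra.TensorProduct.map (AlgHom.id k H)
        (Algebra.TensorProduct.includeRight : H →ₐ[k] H ⊗[k] H) (R : H ⊗[k] H) *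
      Algebra.TensorProduct.map (AlgHom.id k H)
        (Algebra.TensorProduct.includeLeft : H →ₐ[k] H ⊗[k] H) (R : H ⊗[k] H)

namespace Double
variable {k : Type*} [Field k] {A : Type*} [Ring A] [HopfAlgebra k A] [FiniteDimensional k A]
  {M : Type*} [AddCommGroup M] [Module k M] {E : Type*} [Ring E] [Algebra k E]

/-- `p ↦ p ∘ S⁻¹`. -/
noncomputable def dsinv : DualCop k A →ₗ[k] DualCop k A :=
  (show IsLinearMap k (fun p : DualCop k A => form ((lin_pr p).mk' ∘ₗ sinv k A)) from
    ⟨fun _ _ => rfl, fun _ _ => rfl⟩).mk'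

@[simp] theorem pr_dsinv (p : DualCop k A) (a : A) : pr (dsinv p) a = pr p (sinv k A a) := rfl

theorem sum_dsinv_mul (p : DualCop k A) :
    ∑ i, dsinv (dbas k A i) * rt (bas k A i) p = pr p 1 • 1 := by
  refine pr_ext fun z => ?_
  have l : IsLinearMap k (fun p : DualCop k A => pr p z) := by fun_prop
  rw [← l.mk'_apply, map_sum]
  simp only [IsLinearMap.mk'_apply, pr_mul, pr_dsinv, pr_rt, pr_smul, pr_one]
  rw [← sw_sum]
  have : ∀ u v : A, ∑ i, pr (dbas k A i) (sinv k A u) * pr p (v * bas k A i) =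
      pr p (v * sinv k A u) := fun u v =>
    dbas_sum (f := fun t => pr p (v * t)) (by fun_prop) _
  simp only [this]
  rw [sw_mul_sinv (k := k) (f := fun t => pr p t) (by fun_prop), smul_eq_mul, mul_comm]

theorem sum_mul_dsinv (p : DualCop k A) :
    ∑ i, dbas k A i * dsinv (rt (bas k A i) p) = pr p 1 • 1 := by
  refine pr_ext fun z => ?_
  have l : IsLinearMap k (fun p : DualCop k A => pr p z) := by fun_prop
  rw [← l.mk'_apply, map_sum]
  simp only [IsLinearMap.mk'_apply, pr_mul, pr_dsinv, pr_rt, pr_smul, pr_one]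
  rw [← sw_sum]
  have : ∀ u v : A, ∑ i, pr (dbas k A i) u * pr p (sinv k A v * bas k A i) =
      pr p (sinv k A v * u) := fun u v =>
    dbas_sum (f := fun t => pr p (sinv k A v * t)) (by fun_prop) _
  simp only [this]
  rw [sw_sinv_mul (k := k) (f := fun t => pr p t) (by fun_prop), smul_eq_mul, mul_comm]

/-- The Drinfel'd double is a Hopf algebra. -/
noncomputable instance : HopfAlgebra k (Double k A) where
  antipode := elim (fun p a => Q (antipode k a) * P (dsinv p)) (by fun_prop) (by fun_prop)
  mul_antipode_rTensor_comul := hom_ext fun p a => by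
    simp only [LinearMap.comp_apply, comul_bow, map_sum, counit_bow]
    have : ∀ i, LinearMap.mul' k (Double k A) (LinearMap.rTensor _
        (elim (fun p a => Q (antipode k a) * P (dsinv p)) (by fun_prop) (by fun_prop))
        (sw k (fun x y => bow (dbas k A i) x ⊗ₜ[k] bow (rt (bas k A i) p) y) a)) =
        sw k (fun x y => Q (antipode k x) * P (dsinv (dbas k A i) * rt (bas k A i) p) * Q y) a := by
      intro i
      rw [map_sw (f := fun z => LinearMap.mul' k (Double k A) (LinearMap.rTensor _ _ z))
        (by fun_prop)]
      simp only [LinearMap.rTensor_tmul, elim_bow, LinearMap.mul'_apply, map_mul, mul_assoc,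
        P_mul_Q]
    simp only [this]
    rw [← sw_sum]
    simp only [← Finset.sum_mul, ← Finset.mul_sum, ← map_sum, sum_dsinv_mul, map_smul, map_one]
    simp only [mul_smul_comm, mul_one, smul_mul_assoc, ← map_mul]
    rw [sw_S_mul (f := fun t => pr p 1 • Q t) (by fun_prop)]
    simp [Algebra.algebraMap_eq_smul_one, smul_smul, mul_comm]
  mul_antipode_lTensor_comul := hom_ext fun p a => by
    simp only [LinearMap.comp_apply, comul_bow, map_sum, counit_bow]
    have : ∀ i, LinearMap.mul' k (Double k A) (LinearMap.lTensor _
        (elim (fun p a => Q (antipode k a) * P (dsinv p)) (by fun_prop) (by fun_prop))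
        (sw k (fun x y => bow (dbas k A i) x ⊗ₜ[k] bow (rt (bas k A i) p) y) a)) =
        counit (R := k) a • P (dbas k A i * dsinv (rt (bas k A i) p)) := by
      intro i
      rw [map_sw (f := fun z => LinearMap.mul' k (Double k A) (LinearMap.lTensor _ _ z))
        (by fun_prop)]
      simp only [LinearMap.lTensor_tmul, elim_bow, LinearMap.mul'_apply]
      have := sw_mul_S (k := k) (f := fun t => P (dbas k A i) * Q t *
        P (dsinv (rt (bas k A i) p))) (by fun_prop) a
      simp only [map_one, mul_one, ← map_mul] at this
      rw [← this]
      simp only [map_mul, ← P_mul_Q, mul_assoc]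
    simp only [this]
    simp only [← Finset.smul_sum, ← map_sum, sum_mul_dsinv, map_smul, map_one]
    simp [Algebra.algebraMap_eq_smul_one, smul_smul, mul_comm]

theorem comul_P (p : DualCop k A) : comul (R := k) (P (A := A) p) =
    ∑ i, P (dbas k A i) ⊗ₜ[k] P (rt (bas k A i) p) := by
  rw [P_apply, comul_bow]
  refine Finset.sum_congr rfl fun i _ => ?_
  rw [sw_one (by fun_prop) (by fun_prop)]
  rfl

theorem comul_P' (p : DualCop k A) : comul (R := k) (P (A := A) p) =
    ∑ i, P (lt (bas k A i) p) ⊗ₜ[k] P (dbas k A i) := by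
  have h := congrArg (Algebra.TensorProduct.map (P (A := A)) P)
    ((DualCop.comul_def p).symm.trans (DualCop.comul_def' p))
  simp only [map_sum, Algebra.TensorProduct.map_tmul] at h
  rw [comul_P, h]

theorem comul_Q (a : A) : comul (R := k) (Q (k := k) a) =
    sw k (fun x y => Q (k := k) x ⊗ₜ[k] Q (k := k) y) a := by
  rw [← comulHom_eq, Q_apply, comulHom, liftD_bow, map_one, one_mul, AlgHom.comp_apply,
    Bialgebra.comulAlgHom_apply, ← AlgHom.toLinearMap_apply, map_comul]
  rfl

variable (k A) in
/-- The universal R-matrix `∑ᵢ (ε ⋈ eᵢ) ⊗ (eⁱ ⋈ 1)` of the Drinfel'd double. -/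
noncomputable def Rmat : (Double k A ⊗[k] Double k A)ˣ where
  val := ∑ i, Q (bas k A i) ⊗ₜ[k] P (dbas k A i)
  inv := ∑ i, Q (antipode k (bas k A i)) ⊗ₜ[k] P (dbas k A i)
  val_inv := by
    simp only [Finset.sum_mul_sum, Algebra.TensorProduct.tmul_mul_tmul, ← map_mul]
    rw [← dbas_sw (Ψ := fun x y p => Q (x * antipode k y) ⊗ₜ[k] P p) (by fun_prop) (by fun_prop)
      (by fun_prop)]
    have : ∀ i, sw k (fun x y => Q (k := k) (x * antipode k y) ⊗ₜ[k] P (dbas k A i))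
        (bas k A i) = pr (1 : DualCop k A) (bas k A i) • (1 ⊗ₜ[k] P (dbas k A i)) := by
      intro i
      rw [sw_mul_S (f := fun t => Q t ⊗ₜ[k] P (dbas k A i)) (by fun_prop), map_one, pr_one]
    simp only [this]
    rw [dbas_sum' (f := fun p => (1 : Double k A) ⊗ₜ[k] P p) (by fun_prop), map_one]
    rfl
  inv_val := by
    simp only [Finset.sum_mul_sum, Algebra.TensorProduct.tmul_mul_tmul, ← map_mul]
    rw [← dbas_sw (Ψ := fun x y p => Q (antipode k x * y) ⊗ₜ[k] P p) (by fun_prop) (by fun_prop)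
      (by fun_prop)]
    have : ∀ i, sw k (fun x y => Q (k := k) (antipode k x * y) ⊗ₜ[k] P (dbas k A i))
        (bas k A i) = pr (1 : DualCop k A) (bas k A i) • (1 ⊗ₜ[k] P (dbas k A i)) := by
      intro i
      rw [sw_S_mul (f := fun t => Q t ⊗ₜ[k] P (dbas k A i)) (by fun_prop), map_one, pr_one]
    simp only [this]
    rw [dbas_sum' (f := fun p => (1 : Double k A) ⊗ₜ[k] P p) (by fun_prop), map_one]
    rfl

theorem Rmat_val : (Rmat k A : Double k A ⊗[k] Double k A) =
    ∑ i, Q (bas k A i) ⊗ₜ[k] P (dbas k A i) := rfl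

theorem intertwine_P (p : DualCop k A) :
    TensorProduct.comm k _ _ (comul (P (A := A) p)) * (Rmat k A : Double k A ⊗[k] Double k A) =
      (Rmat k A : Double k A ⊗[k] Double k A) * comul (P p) := by
  conv_rhs => rw [comul_P']
  rw [comul_P]
  simp only [map_sum, TensorProduct.comm_tmul, Rmat_val, Finset.sum_mul_sum,
    Algebra.TensorProduct.tmul_mul_tmul, ← map_mul]
  rw [← dbas_sw (Ψ := fun x y q => (P (rt x p) * Q y) ⊗ₜ[k] P q) (by fun_prop) (by fun_prop)
      (by fun_prop), ← dbas_sw (Ψ := fun x y q => (Q x * P (lt y p)) ⊗ₜ[k] P q) (by fun_prop)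
      (by fun_prop) (by fun_prop)]
  refine Finset.sum_congr rfl fun i _ => ?_
  rw [← map_sw (f := fun t => t ⊗ₜ[k] P (dbas k A i)) (by fun_prop), ← cross,
    map_sw (f := fun t => t ⊗ₜ[k] P (dbas k A i)) (by fun_prop)]

theorem intertwine_Q (a : A) :
    TensorProduct.comm k _ _ (comul (Q (k := k) a)) *
      (Rmat k A : Double k A ⊗[k] Double k A) =
      (Rmat k A : Double k A ⊗[k] Double k A) * comul (Q a) := by
  rw [comul_Q, map_sw (f := fun t => _ * t) (by fun_prop),
    map_sw (f := fun t => TensorProduct.comm k _ _ t * _)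
    (lin_mul_left (TensorProduct.comm k _ _).toLinearMap.isLinear _)]
  simp only [TensorProduct.comm_tmul, Rmat_val, Finset.sum_mul, Finset.mul_sum,
    Algebra.TensorProduct.tmul_mul_tmul, ← map_mul]
  have e₁ : ∀ x y : A, ∑ i, Q (k := k) (y * bas k A i) ⊗ₜ[k] (Q (k := k) x * P (dbas k A i)) =
      ∑ i, Q (k := k) (bas k A i) ⊗ₜ[k] (Q (k := k) x * P (lt y (dbas k A i))) := fun x y =>
    (dbas_lt (Φ := fun q z => Q (k := k) z ⊗ₜ[k] (Q (k := k) x * P q)) (by fun_prop) (by fun_prop) y).symm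
  have e₂ : ∀ x y : A, ∑ i, Q (k := k) (bas k A i * x) ⊗ₜ[k] (P (dbas k A i) * Q (k := k) y) =
      ∑ i, Q (k := k) (bas k A i) ⊗ₜ[k] (P (rt x (dbas k A i)) * Q (k := k) y) := fun x y =>
    (dbas_rt (Φ := fun q z => Q (k := k) z ⊗ₜ[k] (P q * Q (k := k) y)) (by fun_prop) (by fun_prop) x).symm
  simp only [e₁, e₂]
  rw [sw_sum, sw_sum]
  refine Finset.sum_congr rfl fun i _ => ?_
  rw [← map_sw (f := fun t => Q (bas k A i) ⊗ₜ[k] t) (by fun_prop), cross,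
    map_sw (f := fun t => Q (bas k A i) ⊗ₜ[k] t) (by fun_prop)]

/-- The Drinfel'd double is quasitriangular. -/
noncomputable instance : QuasiTriangular k (Double k A) where
  R := Rmat k A
  comm_comul x := by
    induction x using induction with
    | h₀ => simp
    | h₂ x y hx hy => simp only [map_add, add_mul, mul_add, hx, hy]
    | h₁ p a =>
      have hc : ∀ s t : Double k A ⊗[k] Double k A, TensorProduct.comm k _ _ (s * t) =
          TensorProduct.comm k _ _ s * TensorProduct.comm k _ _ t := fun s t =>
        map_mul (Algebra.TensorProduct.comm k (Double k A) (Double k A)) s t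
      rw [← P_mul_Q, Bialgebra.comul_mul, hc, mul_assoc, intertwine_Q, ← mul_assoc, intertwine_P,
        mul_assoc]
  comul_left := by
    simp only [Rmat_val, map_sum, LinearMap.rTensor_tmul, comul_Q, Algebra.TensorProduct.map_tmul,
      Algebra.TensorProduct.includeRight_apply, Finset.sum_mul_sum,
      Algebra.TensorProduct.tmul_mul_tmul, AlgHom.id_apply, ← map_mul, one_mul, mul_one]
    have e : ∀ i, TensorProduct.assoc k _ _ _ (sw k (fun x y => Q (k := k) x ⊗ₜ[k] Q (k := k) y)
        (bas k A i) ⊗ₜ[k] P (dbas k A i)) =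
        sw k (fun x y => Q (k := k) x ⊗ₜ[k] (Q (k := k) y ⊗ₜ[k] P (dbas k A i))) (bas k A i) := by
      intro i
      rw [map_sw (f := fun t => t ⊗ₜ[k] P (dbas k A i)) (by fun_prop),
        map_sw (f := fun t => TensorProduct.assoc k (Double k A) (Double k A) (Double k A) t)
          (TensorProduct.assoc k _ _ _).toLinearMap.isLinear]
      rfl
    simp only [e]
    exact dbas_sw (Ψ := fun x y p => Q (k := k) x ⊗ₜ[k] (Q (k := k) y ⊗ₜ[k] P p)) (by fun_prop)
      (by fun_prop) (by fun_prop)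
  comul_right := by
    simp only [Rmat_val, map_sum, LinearMap.lTensor_tmul, comul_P, Algebra.TensorProduct.map_tmul,
      Algebra.TensorProduct.includeRight_apply, Algebra.TensorProduct.includeLeft_apply,
      Finset.sum_mul_sum, TensorProduct.tmul_sum,
      Algebra.TensorProduct.tmul_mul_tmul, AlgHom.id_apply, ← map_mul, one_mul, mul_one]
    rw [Finset.sum_comm]
    conv_rhs => rw [Finset.sum_comm]
    refine Finset.sum_congr rfl fun j _ => ?_
    exact dbas_rt (Φ := fun q x => Q (k := k) x ⊗ₜ[k] (P (dbas k A j) ⊗ₜ[k] P q)) (by fun_prop)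
      (by fun_prop) (bas k A j)

/-- The adjoint action `a ▶ b = ∑ a₁ b S(a₂)`. -/
noncomputable def adj : A →ₐ[k] Module.End k A :=
  AlgHom.ofLinearMap
    (show IsLinearMap k (fun a : A => (show IsLinearMap k (fun b : A =>
        sw k (fun x y => x * b * antipode k y) a) from by fun_prop).mk') from
      ⟨fun x y => LinearMap.ext fun b => IsLinearMap.map_add (R := k)
          (f := fun a : A => sw k (fun x y => x * b * antipode k y) a) (by fun_prop) x y,
       fun c x => LinearMap.ext fun b => IsLinearMap.map_smul (R := k)
          (f := fun a : A => sw k (fun x y => x * b * antipode k y) a) (by fun_prop) c x⟩).mk'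
    (LinearMap.ext fun b => by
      simp only [IsLinearMap.mk'_apply]
      rw [sw_one (by fun_prop) (by fun_prop)]
      simp)
    (fun a c => LinearMap.ext fun b => by
      simp only [IsLinearMap.mk'_apply, Module.End.mul_apply]
      rw [sw_mul (by fun_prop) (by fun_prop)]
      congr 1; funext x y
      rw [map_sw (k := k) (f := fun t => x * t * antipode k y) (by fun_prop)]
      simp only [antipode_mul_antidistrib, mul_assoc])

theorem adj_apply (a b : A) : adj (k := k) a b = sw k (fun x y => x * b * antipode k y) a := rfl

/-- The action `p • b = ∑ ⟨p, S⁻¹(b₁)⟩ b₂` of the dual, that is `b ↼ S⁻¹(p)` for the right action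
`b ↼ p = ∑ ⟨p, b₁⟩ b₂`. -/
noncomputable def coadj : DualCop k A →ₐ[k] Module.End k A :=
  AlgHom.ofLinearMap
    (show IsLinearMap k (fun p : DualCop k A => (show IsLinearMap k (fun b : A =>
        sw k (fun x y => pr p (sinv k A x) • y) b) from by fun_prop).mk') from
      ⟨fun x y => LinearMap.ext fun b => IsLinearMap.map_add (R := k)
          (f := fun p : DualCop k A => sw k (fun x y => pr p (sinv k A x) • y) b)
            (by fun_prop) x y,
       fun c x => LinearMap.ext fun b => IsLinearMap.map_smul (R := k)
          (f := fun p : DualCop k A => sw k (fun x y => pr p (sinv k A x) • y) b)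
            (by fun_prop) c x⟩).mk'
    (LinearMap.ext fun b => by
      simp only [IsLinearMap.mk'_apply, pr_one, counit_sinv]
      exact sw_counit_left (k := k) (f := fun y => y) (by fun_prop) b)
    (fun p q => LinearMap.ext fun b => by
      simp only [IsLinearMap.mk'_apply, Module.End.mul_apply]
      rw [map_sw (k := k) (f := fun t => sw k (fun x y => pr p (sinv k A x) • y) t) (by fun_prop)]
      have e₁ : ∀ x y : A, pr (p * q) (sinv k A x) • y =
          sw k (fun u v => (pr p (sinv k A v) * pr q (sinv k A u)) • y) x := by
        intro x y
        rw [pr_mul, sw_sinv (k := k) (by fun_prop) (by fun_prop),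
          map_sw (k := k) (f := fun t : k => t • y) (by fun_prop)]
      have e₂ : ∀ x y : A, sw k (fun u v => pr p (sinv k A u) • v) (pr q (sinv k A x) • y) =
          sw k (fun u v => (pr p (sinv k A u) * pr q (sinv k A x)) • v) y := by
        intro x y
        rw [IsLinearMap.map_smul (R := k) (f := fun t : A =>
          sw k (fun u v => pr p (sinv k A u) • v) t) (by fun_prop),
          map_sw (k := k) (f := fun t => pr q (sinv k A x) • t) (by fun_prop)]
        simp only [smul_smul, mul_comm]
      simp only [e₁, e₂]
      rw [sw_coassoc (F := fun u v y => (pr p (sinv k A v) * pr q (sinv k A u)) • y)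
        (by fun_prop) (by fun_prop) (by fun_prop)])

theorem coadj_apply (p : DualCop k A) (b : A) :
    coadj p b = sw k (fun x y => pr p (sinv k A x) • y) b := rfl

variable (k A) in
/-- The action of the Drinfel'd double on the Schrödinger module `A`:
`(p ⋈ a) • b = (a ▶ b) ↼ S⁻¹(p)`. -/
noncomputable def schr : Double k A →ₐ[k] Module.End k A :=
  liftD coadj adj (by
    intro a p
    refine LinearMap.ext fun b => ?_
    rw [map_sw (k := k) (f := fun t : Module.End k A => t b) (by fun_prop),
      map_sw (k := k) (f := fun t : Module.End k A => t b) (by fun_prop)]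
    simp only [Module.End.mul_apply]
    have e₁ : ∀ x y : A, adj (k := k) x (coadj (lt y p) b) = sw k (fun c d => sw k (fun u v =>
        pr p (y * sinv k A u) • (c * v * antipode k d)) b) x := by
      intro x y
      rw [adj_apply, coadj_apply]
      congr 1; funext c d
      rw [map_sw (k := k) (f := fun t => c * t * antipode k d) (by fun_prop)]
      simp
    have e₂ : ∀ x y : A, coadj (rt x p) (adj (k := k) y b) =
        sw k (fun c d => sw k (fun c₁ c₂ => sw k (fun d₁ d₂ => sw k (fun u v =>
          pr p (d₂ * sinv k A u * (sinv k A c₁ * x)) • (c₂ * v * antipode k d₁)) b) d) c) y := by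
      intro x y
      rw [adj_apply, map_sw (k := k) (f := fun t => coadj (rt x p) t) (by fun_prop)]
      congr 1; funext c d
      rw [coadj_apply, sw_mul (by fun_prop) (by fun_prop), sw_mul (by fun_prop) (by fun_prop)]
      congr 1; funext c₁ c₂
      conv_rhs => rw [sw_comm]
      congr 1; funext u v
      rw [sw_antipode (by fun_prop) (by fun_prop)]
      simp only [sinv_mul, sinv_antipode, pr_rt, mul_assoc]
    simp only [e₁, e₂]
    have e₃ : ∀ x y : A,
        sw k (fun c d => sw k (fun c₁ c₂ => sw k (fun d₁ d₂ => sw k (fun u v =>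
          pr p (d₂ * sinv k A u * (sinv k A c₁ * x)) • (c₂ * v * antipode k d₁)) b) d) c) y =
        sw k (fun c₁ c => sw k (fun c₂ d => sw k (fun d₁ d₂ => sw k (fun u v =>
          pr p (d₂ * sinv k A u * (sinv k A c₁ * x)) • (c₂ * v * antipode k d₁)) b) d) c) y :=
      fun x y => sw_coassoc (F := fun c₁ c₂ d => sw k (fun d₁ d₂ => sw k (fun u v =>
          pr p (d₂ * sinv k A u * (sinv k A c₁ * x)) • (c₂ * v * antipode k d₁)) b) d)
          (by fun_prop) (by fun_prop) (by fun_prop) y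
    simp only [e₃]
    rw [← sw_coassoc (F := fun x c₁ c => sw k (fun c₂ d => sw k (fun d₁ d₂ => sw k (fun u v =>
          pr p (d₂ * sinv k A u * (sinv k A c₁ * x)) • (c₂ * v * antipode k d₁)) b) d) c)
          (by fun_prop) (by fun_prop) (by fun_prop)]
    have e₄ : ∀ x c : A, sw k (fun x c₁ => sw k (fun c₂ d => sw k (fun d₁ d₂ => sw k (fun u v =>
          pr p (d₂ * sinv k A u * (sinv k A c₁ * x)) • (c₂ * v * antipode k d₁)) b) d) c) x =
        counit (R := k) x • sw k (fun c₂ d => sw k (fun d₁ d₂ => sw k (fun u v =>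
          pr p (d₂ * sinv k A u) • (c₂ * v * antipode k d₁)) b) d) c := by
      intro x c
      rw [sw_sinv_mul (k := k) (f := fun t => sw k (fun c₂ d => sw k (fun d₁ d₂ => sw k (fun u v =>
          pr p (d₂ * sinv k A u * t) • (c₂ * v * antipode k d₁)) b) d) c) (by fun_prop)]
      simp only [mul_one]
    simp only [e₄]
    rw [sw_counit_left (k := k) (f := fun c => sw k (fun c₂ d => sw k (fun d₁ d₂ => sw k (fun u v =>
          pr p (d₂ * sinv k A u) • (c₂ * v * antipode k d₁)) b) d) c) (by fun_prop)]
    exact sw_coassoc (F := fun c d y => sw k (fun u v =>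
        pr p (y * sinv k A u) • (c * v * antipode k d)) b)
        (by fun_prop) (by fun_prop) (by fun_prop) a)

theorem schr_bow (p : DualCop k A) (a b : A) :
    schr k A (bow p a) b = coadj p (adj (k := k) a b) := rfl

end Double
end HopfMorita

namespace HopfMorita
open CategoryTheory MonoidalCategory

section reps
variable {k : Type*} [Field k] {H : Type*} [Ring H] [Algebra k H]
  {U V W : Type*} [AddCommGroup U] [Module k U] [AddCommGroup V] [Module k V]
  [AddCommGroup W] [Module k W]

/-- The action of `H ⊗ H` on the tensor product of two `H`-modules. -/
noncomputable def tens (ρ : H →ₐ[k] Module.End k V) (σ : H →ₐ[k] Module.End k W) :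
    H ⊗[k] H →ₐ[k] Module.End k (V ⊗[k] W) :=
  (Module.endTensorEndAlgHom (R := k) (S := k) (A := k)).comp (Algebra.TensorProduct.map ρ σ)

@[simp] theorem tens_tmul (ρ : H →ₐ[k] Module.End k V) (σ : H →ₐ[k] Module.End k W) (x y : H)
    (v : V) (w : W) : tens ρ σ (x ⊗ₜ y) (v ⊗ₜ w) = ρ x v ⊗ₜ σ y w := rfl

end reps

section bireps
variable {k : Type*} [Field k] {H : Type*} [Ring H] [Bialgebra k H]
  {U V W : Type*} [AddCommGroup U] [Module k U] [AddCommGroup V] [Module k V]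
  [AddCommGroup W] [Module k W]

/-- The tensor product of two representations of a bialgebra. -/
noncomputable def rtens (ρ : H →ₐ[k] Module.End k V) (σ : H →ₐ[k] Module.End k W) :
    H →ₐ[k] Module.End k (V ⊗[k] W) := (tens ρ σ).comp (Bialgebra.comulAlgHom k H)

theorem rtens_eq (ρ : H →ₐ[k] Module.End k V) (σ : H →ₐ[k] Module.End k W) (h : H) :
    rtens ρ σ h = tens ρ σ (comul (R := k) h) := rfl

theorem rtens_tmul (ρ : H →ₐ[k] Module.End k V) (σ : H →ₐ[k] Module.End k W) (h : H) (v : V)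
    (w : W) : rtens ρ σ h (v ⊗ₜ w) = sw k (fun x y => ρ x v ⊗ₜ[k] σ y w) h := by
  rw [rtens_eq, ← AlgHom.toLinearMap_apply, map_comul,
    map_sw (k := k) (f := fun t : Module.End k (V ⊗[k] W) => t (v ⊗ₜ w)) (by fun_prop)]
  rfl

variable (k H) in
/-- The trivial representation, given by the counit. -/
noncomputable def runit : H →ₐ[k] Module.End k k :=
  (Algebra.ofId k (Module.End k k)).comp (Bialgebra.counitAlgHom k H)

theorem runit_apply (h : H) (c : k) : runit k H h c = counit (R := k) h * c := by
  simp [runit, Algebra.ofId_apply]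

theorem assoc_rtens (ρ : H →ₐ[k] Module.End k U) (σ : H →ₐ[k] Module.End k V)
    (τ : H →ₐ[k] Module.End k W) (h : H) (x : (U ⊗[k] V) ⊗[k] W) :
    TensorProduct.assoc k U V W (rtens (rtens ρ σ) τ h x) =
      rtens ρ (rtens σ τ) h (TensorProduct.assoc k U V W x) := by
  have : (TensorProduct.assoc k U V W).toLinearMap ∘ₗ rtens (rtens ρ σ) τ h =
      rtens ρ (rtens σ τ) h ∘ₗ (TensorProduct.assoc k U V W).toLinearMap := by
    refine TensorProduct.ext_threefold fun u v w => ?_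
    simp only [LinearMap.comp_apply, LinearEquiv.coe_coe, TensorProduct.assoc_tmul, rtens_tmul]
    have e₁ : ∀ x y : H, sw k (fun a b => ρ a u ⊗ₜ[k] σ b v) x ⊗ₜ[k] τ y w =
        sw k (fun a b => (ρ a u ⊗ₜ[k] σ b v) ⊗ₜ[k] τ y w) x := fun x y =>
      map_sw (k := k) (f := fun t => t ⊗ₜ[k] τ y w) (by fun_prop) _ _
    have e₂ : ∀ x y : H, ρ x u ⊗ₜ[k] sw k (fun a b => σ a v ⊗ₜ[k] τ b w) y =
        sw k (fun a b => ρ x u ⊗ₜ[k] (σ a v ⊗ₜ[k] τ b w)) y := fun x y =>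
      map_sw (k := k) (f := fun t => ρ x u ⊗ₜ[k] t) (by fun_prop) _ _
    simp only [e₁, e₂]
    rw [← sw_coassoc (F := fun a b c => ρ a u ⊗ₜ[k] (σ b v ⊗ₜ[k] τ c w))
      (by fun_prop) (by fun_prop) (by fun_prop),
      map_sw (k := k) (f := fun t => TensorProduct.assoc k U V W t)
        (TensorProduct.assoc k U V W).toLinearMap.isLinear]
    congr 1; funext x y
    rw [map_sw (k := k) (f := fun t => TensorProduct.assoc k U V W t)
        (TensorProduct.assoc k U V W).toLinearMap.isLinear]
    rfl
  exact LinearMap.congr_fun this x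

theorem lid_rtens (ρ : H →ₐ[k] Module.End k U) (h : H) (x : k ⊗[k] U) :
    TensorProduct.lid k U (rtens (runit k H) ρ h x) = ρ h (TensorProduct.lid k U x) := by
  have : (TensorProduct.lid k U).toLinearMap ∘ₗ rtens (runit k H) ρ h =
      ρ h ∘ₗ (TensorProduct.lid k U).toLinearMap := by
    refine TensorProduct.ext' fun c u => ?_
    simp only [LinearMap.comp_apply, LinearEquiv.coe_coe, TensorProduct.lid_tmul, rtens_tmul,
      runit_apply]
    rw [map_sw (k := k) (f := fun t => TensorProduct.lid k U t)
        (TensorProduct.lid k U).toLinearMap.isLinear]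
    simp only [TensorProduct.lid_tmul, mul_smul]
    rw [sw_counit_left (k := k) (f := fun y => c • ρ y u) (by fun_prop), map_smul]
  exact LinearMap.congr_fun this x

theorem rid_rtens (ρ : H →ₐ[k] Module.End k U) (h : H) (x : U ⊗[k] k) :
    TensorProduct.rid k U (rtens ρ (runit k H) h x) = ρ h (TensorProduct.rid k U x) := by
  have : (TensorProduct.rid k U).toLinearMap ∘ₗ rtens ρ (runit k H) h =
      ρ h ∘ₗ (TensorProduct.rid k U).toLinearMap := by
    refine TensorProduct.ext' fun u c => ?_
    simp only [LinearMap.comp_apply, LinearEquiv.coe_coe, TensorProduct.rid_tmul, rtens_tmul,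
      runit_apply]
    rw [map_sw (k := k) (f := fun t => TensorProduct.rid k U t)
        (TensorProduct.rid k U).toLinearMap.isLinear]
    simp only [TensorProduct.rid_tmul, mul_smul]
    rw [sw_counit_right (k := k) (f := fun y => c • ρ y u) (by fun_prop), map_smul]
  exact LinearMap.congr_fun this x

theorem map_rtens {U' V' : Type*} [AddCommGroup U'] [Module k U'] [AddCommGroup V'] [Module k V']
    {ρ : H →ₐ[k] Module.End k U} {σ : H →ₐ[k] Module.End k V} {ρ' : H →ₐ[k] Module.End k U'}
    {σ' : H →ₐ[k] Module.End k V'} {f : U →ₗ[k] U'} {g : V →ₗ[k] V'}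
    (hf : ∀ h x, f (ρ h x) = ρ' h (f x)) (hg : ∀ h x, g (σ h x) = σ' h (g x)) (t : H ⊗[k] H)
    (x : U ⊗[k] V) : TensorProduct.map f g (tens ρ σ t x) = tens ρ' σ' t (TensorProduct.map f g x) := by
  induction t with
  | zero => simp
  | add s t hs ht => simp only [map_add, LinearMap.add_apply, hs, ht]
  | tmul a b =>
    induction x with
    | zero => simp
    | add s t hs ht => simp only [map_add, hs, ht]
    | tmul u v => simp [hf, hg]

end bireps

/-- A left module over a `k`-algebra `H`: a vector space with a representation of `H`. -/
structure HMod (k : Type u) [Field k] (H : Type u) [Ring H] [Algebra k H] where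
  /-- The underlying vector space. -/
  V : ModuleCat.{u} k
  /-- The action of `H`. -/
  ρ : H →ₐ[k] Module.End k V

namespace HMod
variable {k : Type u} [Field k] {H : Type u} [Ring H]

section alg
variable [Algebra k H]

/-- The space of `H`-linear maps. -/
def homs (M N : HMod k H) : Submodule k (M.V →ₗ[k] N.V) where
  carrier := {f | ∀ h x, f (M.ρ h x) = N.ρ h (f x)}
  add_mem' hf hg h x := by simp [hf h x, hg h x]
  zero_mem' h x := by simp
  smul_mem' c f hf h x := by simp [hf h x]

/-- Morphisms of left `H`-modules. -/
def Hom (M N : HMod k H) : Type u := homs M N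

instance (M N : HMod k H) : AddCommGroup (Hom M N) := inferInstanceAs (AddCommGroup (homs M N))

instance (M N : HMod k H) : Module k (Hom M N) := inferInstanceAs (Module k (homs M N))

/-- The category of left `H`-modules. -/
instance : Category (HMod k H) where
  Hom := Hom
  id M := ⟨LinearMap.id, fun _ _ => rfl⟩
  comp f g := ⟨g.1 ∘ₗ f.1, fun h x => by simp [f.2 h x, g.2 h (f.1 x)]⟩

/-- The linear map underlying a morphism. -/
def lin {M N : HMod k H} (f : M ⟶ N) : M.V →ₗ[k] N.V := f.1

theorem lin_ρ {M N : HMod k H} (f : M ⟶ N) (h : H) (x : M.V) :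
    lin f (M.ρ h x) = N.ρ h (lin f x) := f.2 h x

/-- A morphism from an `H`-linear map. -/
def mk' {M N : HMod k H} (f : M.V →ₗ[k] N.V) (hf : ∀ h x, f (M.ρ h x) = N.ρ h (f x)) : M ⟶ N :=
  ⟨f, hf⟩

@[simp] theorem lin_mk' {M N : HMod k H} (f : M.V →ₗ[k] N.V)
    (hf : ∀ h x, f (M.ρ h x) = N.ρ h (f x)) : lin (mk' f hf) = f := rfl

@[simp] theorem lin_id (M : HMod k H) : lin (𝟙 M) = LinearMap.id := rfl

@[simp] theorem lin_comp {M N L : HMod k H} (f : M ⟶ N) (g : N ⟶ L) :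
    lin (f ≫ g) = lin g ∘ₗ lin f := rfl

@[ext] theorem hom_ext {M N : HMod k H} {f g : M ⟶ N} (h : lin f = lin g) : f = g := Subtype.ext h

instance : Preadditive (HMod k H) where
  homGroup M N := inferInstanceAs (AddCommGroup (Hom M N))
  add_comp _ _ _ f g h := hom_ext (LinearMap.comp_add (lin f) (lin g) (lin h))
  comp_add _ _ _ f g h := hom_ext (LinearMap.add_comp (lin f) (lin h) (lin g))

noncomputable instance : Linear k (HMod k H) where
  homModule M N := inferInstanceAs (Module k (Hom M N))
  smul_comp _ _ _ r f g := hom_ext (LinearMap.comp_smul (lin g) r (lin f))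
  comp_smul _ _ _ f r g := hom_ext (LinearMap.smul_comp r (lin g) (lin f))

/-- An isomorphism from an `H`-linear equivalence. -/
def mkIso {M N : HMod k H} (f : M.V ≃ₗ[k] N.V) (hf : ∀ h x, f (M.ρ h x) = N.ρ h (f x)) : M ≅ N where
  hom := mk' f.toLinearMap hf
  inv := mk' f.symm.toLinearMap (fun h x => f.injective (by
    change f (f.symm _) = f (M.ρ h (f.symm x))
    rw [hf, f.apply_symm_apply, f.apply_symm_apply]))
  hom_inv_id := hom_ext (LinearMap.ext f.symm_apply_apply)
  inv_hom_id := hom_ext (LinearMap.ext f.apply_symm_apply)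

/-- The underlying vector space functor. -/
def forget (k : Type u) [Field k] (H : Type u) [Ring H] [Algebra k H] :
    HMod k H ⥤ ModuleCat.{u} k where
  obj M := M.V
  map f := ModuleCat.ofHom (lin f)

instance : (forget k H).Faithful where
  map_injective h := hom_ext (congrArg ModuleCat.Hom.hom h)

end alg

section bialg
variable [Bialgebra k H]

/-- The tensor product of modules over a bialgebra. -/
noncomputable def tensor (M N : HMod k H) : HMod k H := ⟨.of k (M.V ⊗[k] N.V), rtens M.ρ N.ρ⟩

noncomputable instance : MonoidalCategoryStruct (HMod k H) where
  tensorObj := tensor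
  tensorUnit := ⟨.of k k, runit k H⟩
  tensorHom f g := mk' (TensorProduct.map (lin f) (lin g))
    (fun h x => map_rtens (lin_ρ f) (lin_ρ g) (comul h) x)
  whiskerLeft M _ _ f := mk' (TensorProduct.map LinearMap.id (lin f))
    (fun h x => map_rtens (lin_ρ (𝟙 M)) (lin_ρ f) (comul h) x)
  whiskerRight f M := mk' (TensorProduct.map (lin f) LinearMap.id)
    (fun h x => map_rtens (lin_ρ f) (lin_ρ (𝟙 M)) (comul h) x)
  associator M N L := mkIso (TensorProduct.assoc k M.V N.V L.V) (assoc_rtens M.ρ N.ρ L.ρ)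
  leftUnitor M := mkIso (TensorProduct.lid k M.V) (lid_rtens M.ρ)
  rightUnitor M := mkIso (TensorProduct.rid k M.V) (rid_rtens M.ρ)

/-- The monoidal category of left modules over a bialgebra. -/
noncomputable instance : MonoidalCategory (HMod k H) :=
  Monoidal.induced (forget k H)
    { μIso := fun _ _ => Iso.refl _
      whiskerLeft_eq := fun _ _ _ _ => rfl
      whiskerRight_eq := fun _ _ => rfl
      tensorHom_eq := fun _ _ => rfl
      εIso := Iso.refl _
      associator_eq := fun _ _ _ =>
        ModuleCat.hom_ext (TensorProduct.ext_threefold fun _ _ _ => rfl)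
      leftUnitor_eq := fun _ => ModuleCat.hom_ext (TensorProduct.ext' fun _ _ => rfl)
      rightUnitor_eq := fun _ => ModuleCat.hom_ext (TensorProduct.ext' fun _ _ => rfl) }

end bialg
end HMod
end HopfMorita

namespace HopfMorita
open CategoryTheory MonoidalCategory

section braid
variable {k : Type*} [Field k] {H : Type*} [Ring H] [Bialgebra k H] [QuasiTriangular k H]
  {U V W : Type*} [AddCommGroup U] [Module k U] [AddCommGroup V] [Module k V]
  [AddCommGroup W] [Module k W]

variable (k H) in
/-- The universal R-matrix. -/
def RM : (H ⊗[k] H)ˣ := QuasiTriangular.R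

theorem comm_tens (ρ : H →ₐ[k] Module.End k V) (σ : H →ₐ[k] Module.End k W) (t : H ⊗[k] H)
    (x : V ⊗[k] W) : TensorProduct.comm k V W (tens ρ σ t x) =
      tens σ ρ (TensorProduct.comm k H H t) (TensorProduct.comm k V W x) := by
  induction t with
  | zero => simp
  | add s t hs ht => simp only [map_add, LinearMap.add_apply, hs, ht]
  | tmul a b =>
    induction x with
    | zero => simp
    | add s t hs ht => simp only [map_add, hs, ht]
    | tmul u v => simp

/-- The braiding `x ⊗ y ↦ T(R (x ⊗ y))`, where `T` is the flip. -/
noncomputable def braidEquiv (ρ : H →ₐ[k] Module.End k V) (σ : H →ₐ[k] Module.End k W) :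
    V ⊗[k] W ≃ₗ[k] W ⊗[k] V :=
  (LinearMap.GeneralLinearGroup.generalLinearEquiv k (V ⊗[k] W)
    (Units.map (tens ρ σ : H ⊗[k] H →* Module.End k (V ⊗[k] W)) (RM k H))).trans
      (TensorProduct.comm k V W)

theorem braidEquiv_apply (ρ : H →ₐ[k] Module.End k V) (σ : H →ₐ[k] Module.End k W)
    (x : V ⊗[k] W) :
    braidEquiv ρ σ x = TensorProduct.comm k V W (tens ρ σ (RM k H : H ⊗[k] H) x) := rfl

theorem braidEquiv_rtens (ρ : H →ₐ[k] Module.End k V) (σ : H →ₐ[k] Module.End k W) (h : H)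
    (x : V ⊗[k] W) : braidEquiv ρ σ (rtens ρ σ h x) = rtens σ ρ h (braidEquiv ρ σ x) := by
  have hc : ∀ s : H ⊗[k] H, TensorProduct.comm k H H (TensorProduct.comm k H H s) = s :=
    fun s => (TensorProduct.comm k H H).apply_symm_apply s
  rw [braidEquiv_apply, braidEquiv_apply, rtens_eq, rtens_eq, ← Module.End.mul_apply, ← map_mul,
    ← hc (comul h), ← comm_tens, hc, ← Module.End.mul_apply, ← map_mul]
  exact congrArg (fun t => TensorProduct.comm k V W (tens ρ σ t x))
    (QuasiTriangular.comm_comul h).symm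

theorem braidEquiv_map {U' V' : Type*} [AddCommGroup U'] [Module k U'] [AddCommGroup V']
    [Module k V'] {ρ : H →ₐ[k] Module.End k U} {σ : H →ₐ[k] Module.End k V}
    {ρ' : H →ₐ[k] Module.End k U'} {σ' : H →ₐ[k] Module.End k V'} {f : U →ₗ[k] U'} {g : V →ₗ[k] V'}
    (hf : ∀ h x, f (ρ h x) = ρ' h (f x)) (hg : ∀ h x, g (σ h x) = σ' h (g x)) (x : U ⊗[k] V) :
    braidEquiv ρ' σ' (TensorProduct.map f g x) = TensorProduct.map g f (braidEquiv ρ σ x) := by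
  rw [braidEquiv_apply, braidEquiv_apply, ← map_rtens hf hg]
  generalize tens ρ σ _ x = y
  induction y with
  | zero => simp
  | add s t hs ht => simp only [map_add, hs, ht]
  | tmul u v => simp

theorem braid_hexagon_right (ρ : H →ₐ[k] Module.End k U) (σ : H →ₐ[k] Module.End k V)
    (τ : H →ₐ[k] Module.End k W) (x : (U ⊗[k] V) ⊗[k] W) :
    TensorProduct.assoc k V W U (braidEquiv ρ (rtens σ τ) (TensorProduct.assoc k U V W x)) =
      TensorProduct.map LinearMap.id (braidEquiv ρ τ).toLinearMap
        (TensorProduct.assoc k V U W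
          (TensorProduct.map (braidEquiv ρ σ).toLinearMap LinearMap.id x)) := by
  let G (u : U) (v : V) (w : W) : H ⊗[k] (H ⊗[k] H) →ₗ[k] V ⊗[k] (W ⊗[k] U) :=
    (TensorProduct.assoc k V W U).toLinearMap ∘ₗ (TensorProduct.comm k U (V ⊗[k] W)).toLinearMap ∘ₗ
      TensorProduct.map ((LinearMap.applyₗ u) ∘ₗ ρ.toLinearMap)
        ((LinearMap.applyₗ (v ⊗ₜ w)) ∘ₗ (tens σ τ).toLinearMap)
  have e₁ : ∀ (s : H ⊗[k] H) (u : U) (v : V) (w : W),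
      TensorProduct.assoc k V W U (TensorProduct.comm k _ _ (tens ρ (rtens σ τ) s (u ⊗ₜ (v ⊗ₜ w)))) =
      G u v w ((comul (R := k) (A := H)).lTensor H s) := by
    intro s u v w
    induction s with
    | zero => simp
    | add s t hs ht => simp only [map_add, LinearMap.add_apply, hs, ht]
    | tmul a b => rfl
  have e₂ : ∀ (s t : H ⊗[k] H) (u : U) (v : V) (w : W),
      TensorProduct.map LinearMap.id ((TensorProduct.comm k U W).toLinearMap ∘ₗ tens ρ τ s)
        (TensorProduct.assoc k V U W
          ((TensorProduct.comm k U V (tens ρ σ t (u ⊗ₜ v))) ⊗ₜ w)) =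
      G u v w (Algebra.TensorProduct.map (AlgHom.id k H)
        (Algebra.TensorProduct.includeRight : H →ₐ[k] H ⊗[k] H) s *
      Algebra.TensorProduct.map (AlgHom.id k H)
        (Algebra.TensorProduct.includeLeft : H →ₐ[k] H ⊗[k] H) t) := by
    intro s t u v w
    induction t with
    | zero => simp
    | add t t' ht ht' =>
      simp only [map_add, LinearMap.add_apply, mul_add, ← ht, ← ht', TensorProduct.add_tmul]
    | tmul c d =>
      induction s with
      | zero => simp
      | add s s' hs hs' =>
        simp only [map_add, LinearMap.comp_add, TensorProduct.map_add_right, LinearMap.add_apply, add_mul, hs, hs']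
      | tmul a b => simp [G]
  have : (TensorProduct.assoc k V W U).toLinearMap ∘ₗ (braidEquiv ρ (rtens σ τ)).toLinearMap ∘ₗ
      (TensorProduct.assoc k U V W).toLinearMap =
      TensorProduct.map LinearMap.id (braidEquiv ρ τ).toLinearMap ∘ₗ
        (TensorProduct.assoc k V U W).toLinearMap ∘ₗ
          TensorProduct.map (braidEquiv ρ σ).toLinearMap LinearMap.id := by
    refine TensorProduct.ext_threefold fun u v w => ?_
    refine (e₁ (RM k H) u v w).trans ?_
    refine Eq.trans ?_ (e₂ (RM k H) (RM k H) u v w).symm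
    exact congrArg (G u v w) QuasiTriangular.comul_right
  exact LinearMap.congr_fun this x

theorem braid_hexagon_left (ρ : H →ₐ[k] Module.End k U) (σ : H →ₐ[k] Module.End k V)
    (τ : H →ₐ[k] Module.End k W) (x : U ⊗[k] (V ⊗[k] W)) :
    (TensorProduct.assoc k W U V).symm
      (braidEquiv (rtens ρ σ) τ ((TensorProduct.assoc k U V W).symm x)) =
      TensorProduct.map (braidEquiv ρ τ).toLinearMap LinearMap.id
        ((TensorProduct.assoc k U W V).symm
          (TensorProduct.map LinearMap.id (braidEquiv σ τ).toLinearMap x)) := by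
  let G (u : U) (v : V) (w : W) : H ⊗[k] (H ⊗[k] H) →ₗ[k] (W ⊗[k] U) ⊗[k] V :=
    (TensorProduct.assoc k W U V).symm.toLinearMap ∘ₗ
      (TensorProduct.comm k (U ⊗[k] V) W).toLinearMap ∘ₗ
      (TensorProduct.assoc k U V W).symm.toLinearMap ∘ₗ
      TensorProduct.map ((LinearMap.applyₗ u) ∘ₗ ρ.toLinearMap)
        ((LinearMap.applyₗ (v ⊗ₜ w)) ∘ₗ (tens σ τ).toLinearMap)
  have e₁ : ∀ (s : H ⊗[k] H) (u : U) (v : V) (w : W),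
      (TensorProduct.assoc k W U V).symm
        (TensorProduct.comm k _ _ (tens (rtens ρ σ) τ s ((u ⊗ₜ v) ⊗ₜ w))) =
      G u v w (TensorProduct.assoc k H H H ((comul (R := k) (A := H)).rTensor H s)) := by
    intro s u v w
    induction s with
    | zero => simp
    | add s t hs ht => simp only [map_add, LinearMap.add_apply, hs, ht]
    | tmul a b =>
      simp only [tens_tmul, rtens_eq, LinearMap.rTensor_tmul]
      generalize comul (R := k) a = r
      induction r with
      | zero => simp
      | add s t hs ht => simp only [map_add, LinearMap.add_apply, TensorProduct.add_tmul, hs, ht]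
      | tmul c d => simp [G]
  have e₂ : ∀ (s t : H ⊗[k] H) (u : U) (v : V) (w : W),
      TensorProduct.map ((TensorProduct.comm k U W).toLinearMap ∘ₗ tens ρ τ s) LinearMap.id
        ((TensorProduct.assoc k U W V).symm
          (u ⊗ₜ (TensorProduct.comm k V W (tens σ τ t (v ⊗ₜ w))))) =
      G u v w (Algebra.TensorProduct.map (AlgHom.id k H)
        (Algebra.TensorProduct.includeRight : H →ₐ[k] H ⊗[k] H) s *
      (Algebra.TensorProduct.includeRight : H ⊗[k] H →ₐ[k] H ⊗[k] (H ⊗[k] H)) t) := by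
    intro s t u v w
    induction t with
    | zero => simp
    | add t t' ht ht' =>
      simp only [map_add, LinearMap.add_apply, mul_add, ← ht, ← ht', TensorProduct.tmul_add]
    | tmul c d =>
      induction s with
      | zero => simp
      | add s s' hs hs' =>
        simp only [map_add, LinearMap.comp_add, TensorProduct.map_add_left, LinearMap.add_apply, add_mul, hs, hs']
      | tmul a b => simp [G]
  have : (TensorProduct.assoc k W U V).symm.toLinearMap ∘ₗ
      (braidEquiv (rtens ρ σ) τ).toLinearMap ∘ₗ (TensorProduct.assoc k U V W).symm.toLinearMap =
      TensorProduct.map (braidEquiv ρ τ).toLinearMap LinearMap.id ∘ₗ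
        (TensorProduct.assoc k U W V).symm.toLinearMap ∘ₗ
          TensorProduct.map LinearMap.id (braidEquiv σ τ).toLinearMap := by
    refine TensorProduct.ext_threefold' fun u v w => ?_
    refine (e₁ (RM k H) u v w).trans ?_
    refine Eq.trans ?_ (e₂ (RM k H) (RM k H) u v w).symm
    exact congrArg (G u v w) QuasiTriangular.comul_left
  exact LinearMap.congr_fun this x

end braid

section dual
variable {k : Type*} [Field k] {H : Type*} [Ring H] [HopfAlgebra k H]
  {V : Type*} [AddCommGroup V] [Module k V]

/-- The dual representation `(h φ)(v) = φ(S(h) v)`. -/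
noncomputable def rdual (ρ : H →ₐ[k] Module.End k V) :
    H →ₐ[k] Module.End k (Module.Dual k V) :=
  AlgHom.ofLinearMap
    (Module.Dual.transpose ∘ₗ ρ.toLinearMap ∘ₗ HopfAlgebra.antipode k)
    (by refine LinearMap.ext fun φ => LinearMap.ext fun v => ?_; simp; rfl)
    (fun x y => by
      refine LinearMap.ext fun φ => LinearMap.ext fun v => ?_
      simp [HopfAlgebra.antipode_mul_antidistrib]
      rfl)

theorem rdual_apply (ρ : H →ₐ[k] Module.End k V) (h : H) (φ : Module.Dual k V) (v : V) :
    rdual ρ h φ v = φ (ρ (HopfAlgebra.antipode k h) v) := rfl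

theorem contractLeft_rtens (ρ : H →ₐ[k] Module.End k V) (h : H) (x : Module.Dual k V ⊗[k] V) :
    contractLeft k V (rtens (rdual ρ) ρ h x) = runit k H h (contractLeft k V x) := by
  have : contractLeft k V ∘ₗ rtens (rdual ρ) ρ h = runit k H h ∘ₗ contractLeft k V := by
    refine TensorProduct.ext' fun φ v => ?_
    simp only [LinearMap.comp_apply, rtens_tmul, runit_apply]
    rw [map_sw (k := k) (f := fun t => contractLeft k V t)
      (contractLeft k V).isLinear]
    simp only [contractLeft_apply, rdual_apply]
    have := sw_S_mul (k := k) (A := H) (f := fun t => φ (ρ t v)) (by fun_prop) h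
    simpa using this
  exact LinearMap.congr_fun this x

theorem coevaluation_rtens [FiniteDimensional k V] (ρ : H →ₐ[k] Module.End k V) (h : H) (c : k) :
    coevaluation k V (runit k H h c) = rtens ρ (rdual ρ) h (coevaluation k V c) := by
  let b := Module.Basis.ofVectorSpace k V
  have e : ∀ f T : Module.End k V, ∑ i, f (b i) ⊗ₜ[k] (b.coord i ∘ₗ T) =
      ∑ i, f (T (b i)) ⊗ₜ[k] b.coord i := by
    intro f T
    have h₁ : ∀ i, b.coord i ∘ₗ T = ∑ j, (b.coord i (T (b j))) • b.coord j := by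
      intro i
      refine b.ext fun l => ?_
      classical
      rw [LinearMap.sum_apply, Finset.sum_eq_single l]
      · simp
      · intro j _ hj
        rw [LinearMap.smul_apply, Module.Basis.coord_apply b j, Module.Basis.repr_self_apply,
          if_neg hj.symm, smul_zero]
      · simp
    have h₂ : ∀ j, f (T (b j)) = ∑ i, (b.coord i (T (b j))) • f (b i) := by
      intro j
      refine (congrArg f (b.sum_repr (T (b j)))).symm.trans ?_
      rw [map_sum]
      simp only [map_smul]
      rfl
    simp only [h₁, h₂, TensorProduct.tmul_sum, TensorProduct.sum_tmul]
    rw [Finset.sum_comm]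
    simp only [TensorProduct.tmul_smul, TensorProduct.smul_tmul']
  have h₁ : coevaluation k V 1 = ∑ i, b i ⊗ₜ[k] b.coord i := coevaluation_apply_one k V
  have h₂ : rtens ρ (rdual ρ) h (coevaluation k V 1) =
      counit (R := k) h • coevaluation k V 1 := by
    rw [h₁, map_sum]
    simp only [rtens_tmul]
    rw [← Double.sw_sum]
    have e' : ∀ x y : H, ∑ i, ρ x (b i) ⊗ₜ[k] rdual ρ y (b.coord i) =
        ∑ i, ρ (x * HopfAlgebra.antipode k y) (b i) ⊗ₜ[k] b.coord i := by
      intro x y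
      rw [map_mul]
      exact e _ _
    simp only [e']
    rw [sw_mul_S (k := k) (f := fun t => ∑ i, ρ t (b i) ⊗ₜ[k] b.coord i) (by fun_prop)]
    simp
  have h₃ : coevaluation k V c = c • coevaluation k V 1 := by
    rw [← map_smul, smul_eq_mul, mul_one]
  rw [runit_apply, h₃, map_smul, h₂, smul_smul, ← map_smul, smul_eq_mul, mul_one, mul_comm]

end dual

namespace HMod
variable {k : Type u} [Field k] {H : Type u} [Ring H]

/-- The braiding of the category of left modules over a quasitriangular bialgebra. -/
noncomputable instance [Bialgebra k H] [QuasiTriangular k H] : BraidedCategory (HMod k H) where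
  braiding M N := mkIso (braidEquiv M.ρ N.ρ) (braidEquiv_rtens M.ρ N.ρ)
  braiding_naturality_right X _ _ f := hom_ext (LinearMap.ext fun x =>
    braidEquiv_map (lin_ρ (𝟙 X)) (lin_ρ f) x)
  braiding_naturality_left f Z := hom_ext (LinearMap.ext fun x =>
    braidEquiv_map (lin_ρ f) (lin_ρ (𝟙 Z)) x)
  hexagon_forward X Y Z := hom_ext (LinearMap.ext fun x =>
    braid_hexagon_right X.ρ Y.ρ Z.ρ x)
  hexagon_reverse X Y Z := hom_ext (LinearMap.ext fun x =>
    braid_hexagon_left X.ρ Y.ρ Z.ρ x)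

/-- The dual of a module over a Hopf algebra. -/
noncomputable def dual [HopfAlgebra k H] (M : HMod k H) : HMod k H :=
  ⟨.of k (Module.Dual k M.V), rdual M.ρ⟩

/-- A finite-dimensional module over a Hopf algebra and its dual, with the evaluation map
`φ ⊗ v ↦ φ(v)` and the coevaluation map `1 ↦ ∑ᵢ eᵢ ⊗ eⁱ`. -/
noncomputable instance [HopfAlgebra k H] (M : HMod k H) [FiniteDimensional k M.V] :
    ExactPairing M (dual M) where
  coevaluation' := mk' (coevaluation k M.V) (coevaluation_rtens M.ρ)
  evaluation' := mk' (contractLeft k M.V) (contractLeft_rtens M.ρ)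
  coevaluation_evaluation' := hom_ext (contractLeft_assoc_coevaluation k M.V)
  evaluation_coevaluation' := hom_ext (contractLeft_assoc_coevaluation' k M.V)

end HMod
end HopfMorita

namespace HopfMorita
open CategoryTheory MonoidalCategory

/-- The relations of the standard presentation of the braid group on `n` strands, where the
generator `i : Fin (n - 1)` stands for `σ_{i+1}`. -/
def braidRels (n : ℕ) : Set (FreeGroup (Fin (n - 1))) :=
  {r | ∃ i j : Fin (n - 1), (i : ℕ) + 1 < j ∧ r = FreeGroup.of i * FreeGroup.of j *
      (FreeGroup.of j * FreeGroup.of i)⁻¹} ∪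
  {r | ∃ i j : Fin (n - 1), (i : ℕ) + 1 = j ∧ r = FreeGroup.of i * FreeGroup.of j *
      FreeGroup.of i * (FreeGroup.of j * FreeGroup.of i * FreeGroup.of j)⁻¹}

/-- The braid group `B_n` on `n` strands. -/
abbrev BraidGroup (n : ℕ) : Type := PresentedGroup (braidRels n)

universe v w
section general
variable {C : Type w} [Category.{v} C] [MonoidalCategory C]

/-- The tensor power `M^{⊗ n} = M ⊗ (M ⊗ ⋯)`. -/
def tpow (M : C) : ℕ → C
  | 0 => 𝟙_ C
  | n + 1 => M ⊗ tpow M n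

/-- The canonical isomorphism `M ⊗ M^{⊗ n} ≅ M^{⊗ n} ⊗ M`, built from associators and unitors. -/
def tpowSucc (M : C) : (n : ℕ) → (tpow M (n + 1) ≅ tpow M n ⊗ M)
  | 0 => ρ_ M ≪≫ (λ_ M).symm
  | n + 1 => whiskerLeftIso M (tpowSucc M n) ≪≫ (α_ M (tpow M n) M).symm

variable [BraidedCategory C]

/-- The left partial braided trace of `f : X ⊗ Y ⟶ X ⊗ Z`, where `X'` is the left dual of `X`. -/
def leftPartialTrace (X X' : C) [ExactPairing X X'] {Y Z : C} (f : X ⊗ Y ⟶ X ⊗ Z) : Y ⟶ Z :=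
  (λ_ Y).inv ≫ η_ X X' ▷ Y ≫ (β_ X' X).inv ▷ Y ≫ (α_ X' X Y).hom ≫ X' ◁ f ≫
    (α_ X' X Z).inv ≫ ε_ X X' ▷ Z ≫ (λ_ Z).hom

/-- The right partial braided trace of `f : Y ⊗ X ⟶ Z ⊗ X`, where `X'` is the left dual of `X`. -/
def rightPartialTrace (X X' : C) [ExactPairing X X'] {Y Z : C} (f : Y ⊗ X ⟶ Z ⊗ X) : Y ⟶ Z :=
  (ρ_ Y).inv ≫ Y ◁ η_ X X' ≫ (α_ Y X X').inv ≫ f ▷ X' ≫ (α_ Z X X').hom ≫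
    Z ◁ (β_ X X').hom ≫ Z ◁ ε_ X X' ≫ (ρ_ Z).hom

/-- The nested left braided trace of an endomorphism of `M^{⊗ n}`: the leftmost tensor factor is
traced out `n` times. -/
def nestedLeftTrace (M M' : C) [ExactPairing M M'] :
    (n : ℕ) → (tpow M n ⟶ tpow M n) → (𝟙_ C ⟶ 𝟙_ C)
  | 0, f => f
  | n + 1, f => nestedLeftTrace M M' n (leftPartialTrace M M' f)

/-- The nested right braided trace of an endomorphism of `M^{⊗ n}`: the rightmost tensor factor is
traced out `n` times. -/
def nestedRightTrace (M M' : C) [ExactPairing M M'] :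
    (n : ℕ) → (tpow M n ⟶ tpow M n) → (𝟙_ C ⟶ 𝟙_ C)
  | 0, f => f
  | n + 1, f => nestedRightTrace M M' n
      (rightPartialTrace M M' ((tpowSucc M n).inv ≫ f ≫ (tpowSucc M n).hom))

/-- The braiding `c_{M,M}` acting on the tensor factors with (zero-based) indices `i` and `i + 1` of
`M^{⊗ n}`. (If there are no such factors, the value is the identity.) -/
def braidGen (M : C) : (n : ℕ) → ℕ → (tpow M n ≅ tpow M n)
  | 0, _ => Iso.refl _
  | 1, _ => Iso.refl _
  | n + 2, 0 => (α_ M M (tpow M n)).symm ≪≫ whiskerRightIso (β_ M M) (tpow M n) ≪≫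
      α_ M M (tpow M n)
  | n + 2, i + 1 => whiskerLeftIso M (braidGen M (n + 1) i)

theorem braid_far (M : C) {T : C} (g : T ⟶ T) :
    ((α_ M M T).inv ≫ (β_ M M).hom ▷ T ≫ (α_ M M T).hom) ≫ M ◁ M ◁ g =
      M ◁ M ◁ g ≫ (α_ M M T).inv ≫ (β_ M M).hom ▷ T ≫ (α_ M M T).hom := by
  have h₁ : M ◁ M ◁ g = (α_ M M T).inv ≫ (M ⊗ M) ◁ g ≫ (α_ M M T).hom := by simp
  rw [h₁]
  simp only [Category.assoc, Iso.hom_inv_id_assoc]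
  rw [whisker_exchange_assoc]

theorem braid_near (M T : C) :
    ((α_ M M (M ⊗ T)).inv ≫ (β_ M M).hom ▷ (M ⊗ T) ≫ (α_ M M (M ⊗ T)).hom) ≫
      M ◁ ((α_ M M T).inv ≫ (β_ M M).hom ▷ T ≫ (α_ M M T).hom) ≫
      ((α_ M M (M ⊗ T)).inv ≫ (β_ M M).hom ▷ (M ⊗ T) ≫ (α_ M M (M ⊗ T)).hom) =
    M ◁ ((α_ M M T).inv ≫ (β_ M M).hom ▷ T ≫ (α_ M M T).hom) ≫
      ((α_ M M (M ⊗ T)).inv ≫ (β_ M M).hom ▷ (M ⊗ T) ≫ (α_ M M (M ⊗ T)).hom) ≫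
      M ◁ ((α_ M M T).inv ≫ (β_ M M).hom ▷ T ≫ (α_ M M T).hom) := by
  have h := congrArg (fun f => M ◁ (α_ M M T).inv ≫ (α_ M (M ⊗ M) T).inv ≫ f ▷ T ≫
    (α_ M (M ⊗ M) T).hom ≫ M ◁ (α_ M M T).hom) (BraidedCategory.yang_baxter M M M)
  refine Eq.trans ?_ (h.trans ?_)
  · monoidal
  · monoidal

theorem braidGen_far (M : C) : ∀ n i j : ℕ, i + 1 < j →
    braidGen M n i ≪≫ braidGen M n j = braidGen M n j ≪≫ braidGen M n i
  | 0, i, j, h => rfl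
  | 1, i, j, h => rfl
  | 2, 0, j + 2, h => by
    have : braidGen M 2 (j + 2) = Iso.refl _ := by
      change whiskerLeftIso M (Iso.refl _) = _
      ext; simp; rfl
    simp [this]
  | n + 3, 0, j + 2, h => Iso.ext (braid_far M (braidGen M (n + 1) j).hom)
  | n + 2, i + 1, j + 1, h => by
    have ih := congrArg (fun f => M ◁ f.hom) (braidGen_far M (n + 1) i j (by omega))
    simp only [Iso.trans_hom, whiskerLeft_comp] at ih
    exact Iso.ext ih

theorem braidGen_near (M : C) : ∀ n i : ℕ, i + 2 < n →
    braidGen M n i ≪≫ braidGen M n (i + 1) ≪≫ braidGen M n i =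
      braidGen M n (i + 1) ≪≫ braidGen M n i ≪≫ braidGen M n (i + 1)
  | n + 3, 0, h => Iso.ext (braid_near M (tpow M n))
  | n + 2, i + 1, h => by
    have ih := congrArg (fun f => M ◁ f.hom) (braidGen_near M (n + 1) i (by omega))
    simp only [Iso.trans_hom, whiskerLeft_comp] at ih
    exact Iso.ext ih

/-- The automorphism of `M^{⊗ n}` given by `braidGen`. -/
def braidAut (M : C) (n i : ℕ) : Aut (tpow M n) := braidGen M n i

/-- The representation of the braid group on `M^{⊗ n}`, which maps `σ_i` to `c_{M,M}` acting on the
`i`-th and the `(i+1)`-st tensor factors. -/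
def braidRep (M : C) (n : ℕ) : BraidGroup n →* Aut (tpow M n) :=
  PresentedGroup.toGroup (f := fun i : Fin (n - 1) => braidAut M n i) (by
    rintro r (⟨i, j, h, rfl⟩ | ⟨i, j, h, rfl⟩)
    · simp only [map_mul, map_inv, FreeGroup.lift_apply_of, mul_inv_eq_one]
      exact (braidGen_far M n i j h).symm
    · simp only [map_mul, map_inv, FreeGroup.lift_apply_of, mul_inv_eq_one, ← h]
      exact braidGen_near M n i (by omega))

/-- The left braided dimension of `M` associated with a braid, as an endomorphism of the unit. -/
def leftBraidedDim (M M' : C) [ExactPairing M M'] {n : ℕ} (b : BraidGroup n) : 𝟙_ C ⟶ 𝟙_ C :=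
  nestedLeftTrace M M' n (braidRep M n b).hom

/-- The right braided dimension of `M` associated with a braid, as an endomorphism of the unit. -/
def rightBraidedDim (M M' : C) [ExactPairing M M'] {n : ℕ} (b : BraidGroup n) : 𝟙_ C ⟶ 𝟙_ C :=
  nestedRightTrace M M' n (braidRep M n b).hom

end general

namespace HMod
variable {k : Type u} [Field k]

/-- The scalar by which an endomorphism of the unit object acts. -/
noncomputable def scalar {H : Type u} [Ring H] [Bialgebra k H] (f : 𝟙_ (HMod k H) ⟶ 𝟙_ (HMod k H)) :
    k := (lin f : k →ₗ[k] k) 1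

end HMod

section main
variable (k : Type u) [Field k] (A : Type u) [Ring A] [HopfAlgebra k A] [FiniteDimensional k A]

/-- The Schrödinger module, a left module over the Drinfel'd double with underlying space `A`. -/
noncomputable def schrodingerModule : HMod k (Double k A) := ⟨.of k A, Double.schr k A⟩

instance : FiniteDimensional k (schrodingerModule k A).V :=
  inferInstanceAs (FiniteDimensional k A)

/-- The left braided dimension of the Schrödinger module. -/
noncomputable def bdimLeft {n : ℕ} (b : BraidGroup n) : k :=
  HMod.scalar (leftBraidedDim (schrodingerModule k A) (schrodingerModule k A).dual b)

/-- The right braided dimension of the Schrödinger module. -/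
noncomputable def bdimRight {n : ℕ} (b : BraidGroup n) : k :=
  HMod.scalar (rightBraidedDim (schrodingerModule k A) (schrodingerModule k A).dual b)

end main

/-- Two Hopf algebras are monoidally Morita equivalent if their categories of left modules are
equivalent as `k`-linear monoidal categories. -/
def MonoidalMoritaEquivalent (k A B : Type u) [Field k] [Ring A] [Bialgebra k A] [Ring B]
    [Bialgebra k B] : Prop :=
  ∃ F : HMod k A ⥤ HMod k B, F.IsEquivalence ∧ F.Additive ∧ F.Linear k ∧ Nonempty F.Monoidal

end HopfMorita

/-!
The idea is to recover the Schrödinger module, together with its braiding, from the monoidal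
category of `A`-modules alone, without mentioning the Drinfel'd double.

Restricted to `A`, the Schrödinger module is the adjoint module `adjModule k A`. The action of `A*`
amounts to the half-braiding `u ⊗ b ↦ ∑ b₂ ⊗ S⁻¹(b₁) u` (`adjHalfBr`), and the counit of `A` is a
morphism from the adjoint module to the unit object. These data are characterised by a universal
property (`adj_terminal`): for every module `X` with a half-braiding `σ` and a morphism
`g : X ⟶ 𝟙` there is exactly one morphism from `X` to the adjoint module that is compatible with all
of this. It is `S ∘ ψ`, where `ψ : X → A` is the linear map for which `u ⊗ x ↦ (g ⊗ id) (σ (u ⊗ x))`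
equals `u ⊗ x ↦ ψ(x) u`; the existence of `ψ` comes from naturality along the homomorphisms
`a ↦ a u` out of the regular module, and the axioms of a half-braiding say precisely that `S ∘ ψ` is
a compatible morphism.

A monoidal equivalence `F` preserves a universal property of this kind, and so it identifies the
restrictions of the two Schrödinger modules together with their half-braidings
(`HalfBr.exists_iso`). By the explicit form of the universal `R`-matrix, the braiding of the
Schrödinger module with itself is the component of this half-braiding at the adjoint module
(`map_braiding`). Hence the braidings `c_{M,M}` for the two doubles have the same image in the
category of `B`-modules.

The braided dimensions depend on `c_{M,M}` and the duality only. The braidings of `M` with its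
dual that occur in the partial traces are obtained from `c_{M,M}` and its inverse by bending a
strand (`bend_braiding`, `bend_braiding_inv`), and duals are unique up to canonical isomorphism. This is
organised by the relation `Rel`, which says that two morphisms of different categories have the same
image in a third one up to fixed identifications of sources and targets; it is stable under all
operations used in the construction of the braided dimensions (`Rel.leftBraidedDim`,
`Rel.rightBraidedDim`). Finally, related endomorphisms of the unit objects act by the same scalar,
because `F` is `k`-linear (`Rel.scalar`).
-/

namespace HopfMorita
open CategoryTheory MonoidalCategory Functor.LaxMonoidal Functor.OplaxMonoidal Functor.Monoidal

/-! ### Braidings with a dual object -/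

section mates
universe v w
variable {C : Type w} [Category.{v} C] [MonoidalCategory C] (X X' : C) [ExactPairing X X']

/-- The morphism `X' ⊗ X ⟶ X ⊗ X'` obtained from an endomorphism of `X ⊗ X` by bending its second
input strand up and its first output strand down by means of the duality. -/
def bend (c : X ⊗ X ⟶ X ⊗ X) : X' ⊗ X ⟶ X ⊗ X' :=
  (ρ_ (X' ⊗ X)).inv ≫ (X' ⊗ X) ◁ η_ X X' ≫ (α_ X' X (X ⊗ X')).hom ≫
    X' ◁ (α_ X X X').inv ≫ X' ◁ c ▷ X' ≫ X' ◁ (α_ X X X').hom ≫ (α_ X' X (X ⊗ X')).inv ≫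
      ε_ X X' ▷ (X ⊗ X') ≫ (λ_ (X ⊗ X')).hom

/-- `bend X X' c` is the only morphism `f` for which
`(ev ⊗ id) ∘ (id ⊗ c) = (id ⊗ ev) ∘ (f ⊗ id)`. -/
theorem bend_eq (f : X' ⊗ X ⟶ X ⊗ X') (c : X ⊗ X ⟶ X ⊗ X)
    (h : (α_ X' X X).hom ≫ X' ◁ c ≫ (α_ X' X X).inv ≫ ε_ X X' ▷ X ≫ (λ_ X).hom =
      f ▷ X ≫ (α_ X X' X).hom ≫ X ◁ ε_ X X' ≫ (ρ_ X).hom) : bend X X' c = f := by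
  calc
    _ = (ρ_ (X' ⊗ X)).inv ≫ (X' ⊗ X) ◁ η_ X X' ≫ (α_ (X' ⊗ X) X X').inv ≫
        ((α_ X' X X).hom ≫ X' ◁ c ≫ (α_ X' X X).inv ≫ ε_ X X' ▷ X ≫ (λ_ X).hom) ▷ X' := by
      unfold bend; monoidal
    _ = 𝟙 _ ⊗≫ ((X' ⊗ X) ◁ η_ X X' ≫ f ▷ (X ⊗ X')) ⊗≫ X ◁ ε_ X X' ▷ X' ⊗≫ 𝟙 _ := by
      rw [h]; monoidal
    _ = f ⊗≫ X ◁ (X' ◁ η_ X X' ⊗≫ ε_ X X' ▷ X') ⊗≫ 𝟙 _ := by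
      rw [whisker_exchange]; monoidal
    _ = f := by
      rw [ExactPairing.coevaluation_evaluation'']; monoidal

variable [BraidedCategory C]

/-- Bending the braiding yields an inverse braiding with the dual object, by naturality of the
braiding along the evaluation. -/
theorem bend_braiding : bend X X' (β_ X X).hom = (β_ X X').inv := by
  apply bend_eq
  have h := BraidedCategory.braiding_naturality_right X (ε_ X X')
  rw [BraidedCategory.braiding_tensor_right_hom, braiding_tensorUnit_right] at h
  rw [← cancel_epi ((β_ X X').hom ▷ X), ← cancel_epi ((α_ X X' X).inv),
    ← cancel_mono (λ_ X).inv]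
  simpa using h.symm

theorem bend_braiding_inv : bend X X' (β_ X X).inv = (β_ X' X).hom := by
  apply bend_eq
  have h := BraidedCategory.braiding_inv_naturality_right X (ε_ X X')
  rw [BraidedCategory.braiding_tensor_left_inv, braiding_inv_tensorUnit_left] at h
  rw [← cancel_epi ((β_ X' X).inv ▷ X), ← cancel_epi ((α_ X X' X).inv),
    ← cancel_mono (λ_ X).inv]
  simpa using h.symm
end mates

/-! ### Morphisms related over a third category -/

section related
universe v₁ v₂ v₃ w₁ w₂ w₃
variable {C : Type w₁} [Category.{v₁} C] [MonoidalCategory C]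
  {D : Type w₂} [Category.{v₂} D] [MonoidalCategory D]
  {E : Type w₃} [Category.{v₃} E] [MonoidalCategory E]
  {P : C ⥤ E} {Q : D ⥤ E}

/-- Two morphisms in different categories over `E` are related if their images in `E` agree up to
given isomorphisms between the images of their sources and of their targets. -/
def Rel {X X' : C} {Y Y' : D} (S : P.obj X ≅ Q.obj Y) (T : P.obj X' ≅ Q.obj Y') (f : X ⟶ X')
    (g : Y ⟶ Y') : Prop :=
  P.map f ≫ T.hom = S.hom ≫ Q.map g

namespace Rel
variable {X₁ X₂ X₃ : C} {Y₁ Y₂ Y₃ : D} {S : P.obj X₁ ≅ Q.obj Y₁} {T : P.obj X₂ ≅ Q.obj Y₂}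
  {U : P.obj X₃ ≅ Q.obj Y₃}

theorem id (S : P.obj X₁ ≅ Q.obj Y₁) : Rel S S (𝟙 X₁) (𝟙 Y₁) := by simp [Rel]

theorem comp {f : X₁ ⟶ X₂} {f' : X₂ ⟶ X₃} {g : Y₁ ⟶ Y₂} {g' : Y₂ ⟶ Y₃} (h : Rel S T f g)
    (h' : Rel T U f' g') : Rel S U (f ≫ f') (g ≫ g') := by
  unfold Rel at *
  rw [P.map_comp, Category.assoc, h', reassoc_of% h, Q.map_comp]

theorem inv {f : X₁ ≅ X₂} {g : Y₁ ≅ Y₂} (h : Rel S T f.hom g.hom) : Rel T S f.inv g.inv := by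
  unfold Rel at *
  rw [← cancel_epi (P.map f.hom), reassoc_of% h]
  simp

end Rel

variable [P.Monoidal] [Q.Monoidal]

variable (P Q) in
/-- The canonical isomorphism between the images of the unit objects. -/
def unitRel : P.obj (𝟙_ C) ≅ Q.obj (𝟙_ D) := (εIso P).symm ≪≫ εIso Q

/-- The tensor product of two identifications of objects over `E`. -/
def tensRel {X X' : C} {Y Y' : D} (S : P.obj X ≅ Q.obj Y) (T : P.obj X' ≅ Q.obj Y') :
    P.obj (X ⊗ X') ≅ Q.obj (Y ⊗ Y') :=
  (μIso P X X').symm ≪≫ (S ⊗ᵢ T) ≪≫ μIso Q Y Y'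

namespace Rel
variable {X X' X'' : C} {Y Y' Y'' : D} {S : P.obj X ≅ Q.obj Y} {T : P.obj X' ≅ Q.obj Y'}
  {U : P.obj X'' ≅ Q.obj Y''}

theorem whiskerLeft {f : X' ⟶ X''} {g : Y' ⟶ Y''} (h : Rel T U f g) (S : P.obj X ≅ Q.obj Y) :
    Rel (tensRel S T) (tensRel S U) (X ◁ f) (Y ◁ g) := by
  unfold Rel at *
  simp only [tensRel, Iso.trans_hom, Iso.symm_hom, μIso_hom, μIso_inv, tensorIso_hom,
    Category.assoc, ← μ_natural_right, ← δ_natural_right_assoc, MonoidalCategory.tensorHom_def,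
    whisker_exchange_assoc]
  simp only [← MonoidalCategory.whiskerLeft_comp_assoc, h]

theorem whiskerRight {f : X' ⟶ X''} {g : Y' ⟶ Y''} (h : Rel T U f g) (S : P.obj X ≅ Q.obj Y) :
    Rel (tensRel T S) (tensRel U S) (f ▷ X) (g ▷ Y) := by
  unfold Rel at *
  simp only [tensRel, Iso.trans_hom, Iso.symm_hom, μIso_hom, μIso_inv, tensorIso_hom,
    Category.assoc, ← μ_natural_left, ← δ_natural_left_assoc, MonoidalCategory.tensorHom_def,
    ← whisker_exchange_assoc]
  simp only [← comp_whiskerRight_assoc, h]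

theorem associator (S : P.obj X ≅ Q.obj Y) (T : P.obj X' ≅ Q.obj Y') (U : P.obj X'' ≅ Q.obj Y'') :
    Rel (tensRel (tensRel S T) U) (tensRel S (tensRel T U)) (α_ X X' X'').hom
      (α_ Y Y' Y'').hom := by
  unfold Rel
  rw [← cancel_epi (μ P (X ⊗ X') X''), ← cancel_epi (μ P X X' ▷ P.obj X'')]
  have h₁ : (S.hom ⊗ₘ (T.hom ⊗ₘ U.hom) ≫ μ Q Y' Y'') =
      (S.hom ⊗ₘ T.hom ⊗ₘ U.hom) ≫ Q.obj Y ◁ μ Q Y' Y'' := by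
    rw [← id_tensorHom, tensorHom_comp_tensorHom, Category.comp_id]
  have h₂ : ((S.hom ⊗ₘ T.hom) ≫ μ Q Y Y' ⊗ₘ U.hom) =
      ((S.hom ⊗ₘ T.hom) ⊗ₘ U.hom) ≫ μ Q Y Y' ▷ Q.obj Y'' := by
    rw [← tensorHom_id, tensorHom_comp_tensorHom, Category.comp_id]
  simp only [tensRel, Iso.trans_hom, Iso.symm_hom, μIso_hom, μIso_inv, tensorIso_hom,
    Category.assoc, Functor.LaxMonoidal.associativity_assoc, μ_δ_assoc,
    whiskerLeft_comp_tensorHom_assoc,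
    whiskerRight_comp_tensorHom_assoc, h₁, h₂, Functor.LaxMonoidal.associativity,
    associator_naturality_assoc]

theorem leftUnitor (S : P.obj X ≅ Q.obj Y) :
    Rel (tensRel (unitRel P Q) S) S (λ_ X).hom (λ_ Y).hom := by
  unfold Rel
  rw [← cancel_epi (μ P (𝟙_ C) X), ← cancel_epi (ε P ▷ P.obj X)]
  have h : (ε Q ⊗ₘ S.hom) = 𝟙_ E ◁ S.hom ≫ ε Q ▷ Q.obj Y := by simp [tensorHom_def']
  simp only [tensRel, unitRel, Iso.trans_hom, Iso.symm_hom, μIso_hom, μIso_inv, tensorIso_hom,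
    Category.assoc, μ_δ_assoc, εIso_hom, εIso_inv, whiskerRight_comp_tensorHom_assoc, ε_η_assoc, h,
    ← Functor.LaxMonoidal.left_unitality, ← Functor.LaxMonoidal.left_unitality_assoc,
    leftUnitor_naturality]

theorem rightUnitor (S : P.obj X ≅ Q.obj Y) :
    Rel (tensRel S (unitRel P Q)) S (ρ_ X).hom (ρ_ Y).hom := by
  unfold Rel
  rw [← cancel_epi (μ P X (𝟙_ C)), ← cancel_epi (P.obj X ◁ ε P)]
  have h : (S.hom ⊗ₘ ε Q) = S.hom ▷ 𝟙_ E ≫ Q.obj Y ◁ ε Q := by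
    rw [MonoidalCategory.tensorHom_def]
  simp only [tensRel, unitRel, Iso.trans_hom, Iso.symm_hom, μIso_hom, μIso_inv, tensorIso_hom,
    Category.assoc, μ_δ_assoc, εIso_hom, εIso_inv, whiskerLeft_comp_tensorHom_assoc, ε_η_assoc, h,
    ← Functor.LaxMonoidal.right_unitality, ← Functor.LaxMonoidal.right_unitality_assoc,
    rightUnitor_naturality]

end Rel

/-- The image of an exact pairing under a monoidal functor. -/
@[reducible] def mapPairing (P : C ⥤ E) [P.Monoidal] (X X' : C) [ExactPairing X X'] :
    ExactPairing (P.obj X) (P.obj X') where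
  coevaluation' := ε P ≫ P.map (η_ X X') ≫ δ P X X'
  evaluation' := μ P X' X ≫ P.map (ε_ X X') ≫ η P
  coevaluation_evaluation' := by
    have h := congrArg P.map (ExactPairing.coevaluation_evaluation X X')
    rw [← cancel_epi (P.obj X' ◁ η P), ← cancel_epi (δ P X' (𝟙_ C)), ← cancel_mono (ε P ▷ P.obj X'),
      ← cancel_mono (μ P (𝟙_ C) X')]
    simp only [Functor.map_comp, map_whiskerLeft, map_whiskerRight, map_associator_inv,
      map_rightUnitor, map_leftUnitor_inv, Category.assoc, μ_δ_assoc] at h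
    simp only [Category.assoc, MonoidalCategory.whiskerLeft_comp, comp_whiskerRight]
    simp only [← MonoidalCategory.whiskerLeft_comp_assoc, η_ε, ← comp_whiskerRight_assoc]
    simpa using h
  evaluation_coevaluation' := by
    have h := congrArg P.map (ExactPairing.evaluation_coevaluation X X')
    rw [← cancel_epi (η P ▷ P.obj X), ← cancel_epi (δ P (𝟙_ C) X), ← cancel_mono (P.obj X ◁ ε P),
      ← cancel_mono (μ P X (𝟙_ C))]
    simp only [Functor.map_comp, map_whiskerLeft, map_whiskerRight, map_associator,
      map_rightUnitor_inv, map_leftUnitor, Category.assoc, μ_δ_assoc] at h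
    simp only [Category.assoc, MonoidalCategory.whiskerLeft_comp, comp_whiskerRight]
    simp only [← MonoidalCategory.whiskerLeft_comp_assoc, η_ε, ← comp_whiskerRight_assoc]
    simpa using h

section dual
variable {X X' : C} {Y Y' : D} [ExactPairing X X'] [ExactPairing Y Y']

/-- An identification of objects over `E` induces an identification of their duals. -/
def dualRel (X' : C) (Y' : D) [ExactPairing X X'] [ExactPairing Y Y'] (S : P.obj X ≅ Q.obj Y) :
    P.obj X' ≅ Q.obj Y' :=
  letI := mapPairing Q Y Y'
  rightDualIso (mapPairing P X X') (exactPairingCongrLeft S)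

/-- The evaluations are related: the identification of the duals is the mate of that of the
objects. -/
theorem Rel.evaluation (S : P.obj X ≅ Q.obj Y) :
    Rel (tensRel (dualRel X' Y' S) S) (unitRel P Q) (ε_ X X') (ε_ Y Y') := by
  let _i := mapPairing Q Y Y'
  let p₁ := mapPairing P X X'
  let p₂ : ExactPairing (P.obj X) (Q.obj Y') := exactPairingCongrLeft S
  have h := @rightAdjointMate_comp_evaluation E _ _ _ _ ⟨Q.obj Y'⟩ ⟨P.obj X'⟩ (𝟙 (P.obj X))
  rw [MonoidalCategory.whiskerLeft_id, Category.id_comp] at h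
  change (dualRel X' Y' S).hom ▷ P.obj X ≫ Q.obj Y' ◁ S.hom ≫ μ Q Y' Y ≫ Q.map (ε_ Y Y') ≫ η Q =
    μ P X' X ≫ P.map (ε_ X X') ≫ η P at h
  unfold Rel
  rw [← cancel_epi (μ P X' X), ← cancel_mono (η Q)]
  simp only [tensRel, unitRel, Iso.trans_hom, Iso.symm_hom, εIso_hom, εIso_inv, μIso_hom, μIso_inv,
    tensorIso_hom, Category.assoc, ε_η, Category.comp_id, ← h, μ_δ_assoc,
    MonoidalCategory.tensorHom_def]

theorem Rel.coevaluation (S : P.obj X ≅ Q.obj Y) :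
    Rel (unitRel P Q) (tensRel S (dualRel X' Y' S)) (η_ X X') (η_ Y Y') := by
  let _i := mapPairing Q Y Y'
  let p₁ := mapPairing P X X'
  let p₂ : ExactPairing (P.obj X) (Q.obj Y') := exactPairingCongrLeft S
  have h := @coevaluation_comp_rightAdjointMate E _ _ _ _ ⟨Q.obj Y'⟩ ⟨P.obj X'⟩ (𝟙 (P.obj X))
  rw [MonoidalCategory.id_whiskerRight, Category.comp_id] at h
  change (ε P ≫ P.map (η_ X X') ≫ δ P X X') ≫ P.obj X ◁ (dualRel X' Y' S).hom =
    (ε Q ≫ Q.map (η_ Y Y') ≫ δ Q Y Y') ≫ S.inv ▷ Q.obj Y' at h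
  have h' := congrArg (fun f => f ≫ S.hom ▷ Q.obj Y' ≫ μ Q Y Y') h
  simp only [Category.assoc, ← comp_whiskerRight_assoc, Iso.inv_hom_id, id_whiskerRight,
    Category.id_comp, δ_μ, Category.comp_id] at h'
  unfold Rel
  rw [← cancel_epi (ε P)]
  simp only [tensRel, unitRel, Iso.trans_hom, Iso.symm_hom, εIso_hom, εIso_inv, μIso_hom, μIso_inv,
    tensorIso_hom, Category.assoc, ε_η_assoc, h', MonoidalCategory.tensorHom_def']

end dual

theorem braidRep_of {n : ℕ} [BraidedCategory C] (X : C) (i : Fin (n - 1)) :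
    braidRep X n (PresentedGroup.mk (braidRels n) (FreeGroup.of i)) = braidGen X n i :=
  PresentedGroup.toGroup.of _

section braided
variable [BraidedCategory C] [BraidedCategory D] {X X' : C} {Y Y' : D} [ExactPairing X X']
  [ExactPairing Y Y'] {S : P.obj X ≅ Q.obj Y}

theorem Rel.bend {c : X ⊗ X ⟶ X ⊗ X} {d : Y ⊗ Y ⟶ Y ⊗ Y}
    (h : Rel (tensRel S S) (tensRel S S) c d) :
    Rel (tensRel (dualRel X' Y' S) S) (tensRel S (dualRel X' Y' S)) (bend X X' c) (bend Y Y' d) :=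
  have hη := Rel.coevaluation (X' := X') (Y' := Y') S
  have hε := Rel.evaluation (X' := X') (Y' := Y') S
  ((rightUnitor _).inv).comp <| (hη.whiskerLeft _).comp <| (associator _ _ _).comp <|
    ((associator _ _ _).inv.whiskerLeft _).comp <| ((h.whiskerRight _).whiskerLeft _).comp <|
    ((associator _ _ _).whiskerLeft _).comp <| (associator _ _ _).inv.comp <|
    (hε.whiskerRight _).comp (leftUnitor _)

variable (h : Rel (tensRel S S) (tensRel S S) (β_ X X).hom (β_ Y Y).hom)
include h

theorem Rel.braiding_dual : Rel (tensRel S (dualRel X' Y' S)) (tensRel (dualRel X' Y' S) S)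
    (β_ X X').hom (β_ Y Y').hom := by
  have := Rel.bend (X' := X') (Y' := Y') h
  rw [bend_braiding, bend_braiding] at this
  exact this.inv (f := (β_ X X').symm) (g := (β_ Y Y').symm)

theorem Rel.dual_braiding : Rel (tensRel (dualRel X' Y' S) S) (tensRel S (dualRel X' Y' S))
    (β_ X' X).hom (β_ Y' Y).hom := by
  have := Rel.bend (X' := X') (Y' := Y') h.inv
  rwa [bend_braiding_inv, bend_braiding_inv] at this

variable {V V' : C} {W W' : D} {T : P.obj V ≅ Q.obj W} {T' : P.obj V' ≅ Q.obj W'}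

theorem Rel.leftPartialTrace {f : X ⊗ V ⟶ X ⊗ V'} {g : Y ⊗ W ⟶ Y ⊗ W'}
    (hf : Rel (tensRel S T) (tensRel S T') f g) :
    Rel T T' (leftPartialTrace X X' f) (leftPartialTrace Y Y' g) :=
  have hη := Rel.coevaluation (X' := X') (Y' := Y') S
  have hε := Rel.evaluation (X' := X') (Y' := Y') S
  (leftUnitor _).inv.comp <| (hη.whiskerRight _).comp <|
    ((Rel.dual_braiding h).inv.whiskerRight _).comp <| (associator _ _ _).comp <|
    (hf.whiskerLeft _).comp <| (associator _ _ _).inv.comp <| (hε.whiskerRight _).comp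
    (leftUnitor _)

theorem Rel.rightPartialTrace {f : V ⊗ X ⟶ V' ⊗ X} {g : W ⊗ Y ⟶ W' ⊗ Y}
    (hf : Rel (tensRel T S) (tensRel T' S) f g) :
    Rel T T' (rightPartialTrace X X' f) (rightPartialTrace Y Y' g) :=
  have hη := Rel.coevaluation (X' := X') (Y' := Y') S
  have hε := Rel.evaluation (X' := X') (Y' := Y') S
  (rightUnitor _).inv.comp <| (hη.whiskerLeft _).comp <| (associator _ _ _).inv.comp <|
    (hf.whiskerRight _).comp <| (associator _ _ _).comp <|
    ((Rel.braiding_dual h).whiskerLeft _).comp <| (hε.whiskerLeft _).comp (rightUnitor _)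

omit h in
/-- The identification of tensor powers over `E`. -/
def tpowRel (S : P.obj X ≅ Q.obj Y) : (n : ℕ) → (P.obj (tpow X n) ≅ Q.obj (tpow Y n))
  | 0 => unitRel P Q
  | n + 1 => tensRel S (tpowRel S n)

omit h [ExactPairing X X'] [ExactPairing Y Y'] [BraidedCategory C] [BraidedCategory D] in
theorem Rel.tpowSucc : ∀ n : ℕ, Rel (tpowRel S (n + 1)) (tensRel (tpowRel S n) S)
    (tpowSucc X n).hom (tpowSucc Y n).hom
  | 0 => (rightUnitor _).comp (leftUnitor _).inv
  | n + 1 => ((Rel.tpowSucc n).whiskerLeft _).comp (associator _ _ _).inv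

theorem Rel.nestedLeftTrace : ∀ (n : ℕ) {f : tpow X n ⟶ tpow X n} {g : tpow Y n ⟶ tpow Y n},
    Rel (tpowRel S n) (tpowRel S n) f g →
      Rel (unitRel P Q) (unitRel P Q) (nestedLeftTrace X X' n f) (nestedLeftTrace Y Y' n g)
  | 0, _, _, hf => hf
  | n + 1, _, _, hf => Rel.nestedLeftTrace n (Rel.leftPartialTrace h hf)

theorem Rel.nestedRightTrace : ∀ (n : ℕ) {f : tpow X n ⟶ tpow X n} {g : tpow Y n ⟶ tpow Y n},
    Rel (tpowRel S n) (tpowRel S n) f g →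
      Rel (unitRel P Q) (unitRel P Q) (nestedRightTrace X X' n f) (nestedRightTrace Y Y' n g)
  | 0, _, _, hf => hf
  | n + 1, _, _, hf => Rel.nestedRightTrace n (Rel.rightPartialTrace h
      ((Rel.tpowSucc n).inv.comp (hf.comp (Rel.tpowSucc n))))

omit [ExactPairing X X'] [ExactPairing Y Y'] in
theorem Rel.braidGen : ∀ n i : ℕ,
    Rel (tpowRel S n) (tpowRel S n) (braidGen X n i).hom (braidGen Y n i).hom
  | 0, _ => Rel.id _
  | 1, _ => Rel.id _
  | _ + 2, 0 => (associator _ _ _).inv.comp ((h.whiskerRight _).comp (associator _ _ _))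
  | n + 2, i + 1 => (Rel.braidGen (n + 1) i).whiskerLeft _

omit [ExactPairing X X'] [ExactPairing Y Y'] in
theorem Rel.braidRep {n : ℕ} (b : BraidGroup n) :
    Rel (tpowRel S n) (tpowRel S n) (braidRep X n b).hom (braidRep Y n b).hom := by
  induction b using PresentedGroup.induction_on with
  | _ z =>
  induction z using FreeGroup.induction_on with
  | C1 => simp only [map_one]; exact Rel.id _
  | of i =>
    have e₁ := congrArg Iso.hom (braidRep_of X i)
    have e₂ := congrArg Iso.hom (braidRep_of Y i)
    rw [e₁, e₂]
    exact Rel.braidGen h n i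
  | inv_of i ih => simp only [map_inv]; exact ih.inv
  | mul x y hx hy => simp only [map_mul]; exact hy.comp hx

theorem Rel.leftBraidedDim {n : ℕ} (b : BraidGroup n) :
    Rel (unitRel P Q) (unitRel P Q) (leftBraidedDim X X' b) (leftBraidedDim Y Y' b) :=
  Rel.nestedLeftTrace h n (Rel.braidRep h b)

theorem Rel.rightBraidedDim {n : ℕ} (b : BraidGroup n) :
    Rel (unitRel P Q) (unitRel P Q) (rightBraidedDim X X' b) (rightBraidedDim Y Y' b) :=
  Rel.nestedRightTrace h n (Rel.braidRep h b)

end braided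
end related

/-! ### Half-braidings and their transport along monoidal equivalences -/

section halfBraiding
universe v₁ v₂ w₁ w₂

/-- A lax half-braiding `U ⊗ X ⟶ X ⊗ U` on an object `X`: natural and monoidal in `U`, but not
required to be invertible. -/
structure HalfBr {C : Type w₁} [Category.{v₁} C] [MonoidalCategory C] (X : C) where
  /-- The components. -/
  σ (U : C) : U ⊗ X ⟶ X ⊗ U
  naturality {U V : C} (f : U ⟶ V) : f ▷ X ≫ σ V = σ U ≫ X ◁ f
  tensor (U V : C) : σ (U ⊗ V) =
    (α_ U V X).hom ≫ U ◁ σ V ≫ (α_ U X V).inv ≫ σ U ▷ V ≫ (α_ X U V).hom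
  unit : σ (𝟙_ C) = (λ_ X).hom ≫ (ρ_ X).inv

namespace HalfBr
variable {C : Type w₁} [Category.{v₁} C] [MonoidalCategory C]
  {D : Type w₂} [Category.{v₂} D] [MonoidalCategory D]

/-- Compatibility of a morphism with half-braidings. -/
def Compat {X Y : C} (s : HalfBr X) (t : HalfBr Y) (f : X ⟶ Y) : Prop :=
  ∀ U, U ◁ f ≫ t.σ U = s.σ U ≫ f ▷ U

theorem Compat.id {X : C} (s : HalfBr X) : Compat s s (𝟙 X) := fun U => by simp

theorem Compat.comp {X Y Z : C} {s : HalfBr X} {t : HalfBr Y} {u : HalfBr Z} {f : X ⟶ Y}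
    {g : Y ⟶ Z} (hf : Compat s t f) (hg : Compat t u g) : Compat s u (f ≫ g) := fun U => by
  rw [MonoidalCategory.whiskerLeft_comp, Category.assoc, hg, reassoc_of% (hf U), comp_whiskerRight]

/-- The triple of an object, a half-braiding and a morphism to the unit object is terminal among
all such triples. -/
def Terminal {M : C} (s : HalfBr M) (e : M ⟶ 𝟙_ C) : Prop :=
  ∀ (X : C) (t : HalfBr X) (g : X ⟶ 𝟙_ C), ∃! f : X ⟶ M, f ≫ e = g ∧ Compat t s f

variable (F : C ⥤ D) [F.Monoidal]

/-- The preimage of a half-braiding under a fully faithful monoidal functor. -/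
noncomputable def pull [F.Full] [F.Faithful] {X : C} {Y : D} (e : F.obj X ≅ Y) (t : HalfBr Y) :
    HalfBr X where
  σ U := F.preimage (δ F U X ≫ F.obj U ◁ e.hom ≫ t.σ (F.obj U) ≫ e.inv ▷ F.obj U ≫ μ F X U)
  naturality {U V} f := F.map_injective (by
    simp only [Functor.map_comp, Functor.map_preimage, map_whiskerRight, map_whiskerLeft,
      Category.assoc, μ_δ_assoc]
    rw [← whisker_exchange_assoc, reassoc_of% (t.naturality (F.map f)), whisker_exchange_assoc])
  tensor U V := F.map_injective (by
    have h := t.naturality (μ F U V)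
    rw [t.tensor] at h
    simp only [Functor.map_comp, Functor.map_preimage, map_whiskerRight, map_whiskerLeft,
      Category.assoc, μ_δ_assoc, map_associator, map_associator_inv,
      MonoidalCategory.whiskerLeft_comp, comp_whiskerRight]
    have h' : t.σ (F.obj (U ⊗ V)) = δ F U V ▷ Y ≫ μ F U V ▷ Y ≫ t.σ (F.obj (U ⊗ V)) := by
      rw [← comp_whiskerRight_assoc]; simp
    have e₁ : F.obj U ◁ e.inv ▷ F.obj V ≫ (α_ (F.obj U) (F.obj X) (F.obj V)).inv ≫
        (F.obj U ◁ e.hom) ▷ F.obj V = (α_ (F.obj U) Y (F.obj V)).inv := by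
      simp
    rw [h', h]
    simp only [Category.assoc]
    rw [whisker_exchange_assoc, whisker_exchange_assoc]
    simp only [whiskerLeft_μ_δ_assoc, whiskerRight_μ_δ_assoc, reassoc_of% e₁]
    simp)
  unit := F.map_injective (by
    have h := t.naturality (ε F)
    rw [t.unit] at h
    have h' : t.σ (F.obj (𝟙_ C)) = η F ▷ Y ≫ ε F ▷ Y ≫ t.σ (F.obj (𝟙_ C)) := by
      rw [← comp_whiskerRight_assoc]; simp
    simp only [Functor.map_comp, Functor.map_preimage]
    rw [h', h]
    simp only [Category.assoc]
    rw [whisker_exchange_assoc, whisker_exchange_assoc]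
    simp)

theorem map_pull [F.Full] [F.Faithful] {X : C} {Y : D} (e : F.obj X ≅ Y) (t : HalfBr Y) (U : C) :
    F.map ((pull F e t).σ U) =
      δ F U X ≫ F.obj U ◁ e.hom ≫ t.σ (F.obj U) ≫ e.inv ▷ F.obj U ≫ μ F X U :=
  F.map_preimage _

/-- The components, at all objects, of the image of a half-braiding under an equivalence. -/
noncomputable def pushσ [F.IsEquivalence] {X : C} (s : HalfBr X) (V : D) :
    V ⊗ F.obj X ⟶ F.obj X ⊗ V :=
  (F.objObjPreimageIso V).inv ▷ F.obj X ≫ μ F _ X ≫ F.map (s.σ (F.objPreimage V)) ≫ δ F X _ ≫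
    F.obj X ◁ (F.objObjPreimageIso V).hom

/-- The transported components are determined by those at objects in the image, along any morphism
out of such an object. -/
theorem comp_pushσ [F.IsEquivalence] {X : C} (s : HalfBr X) {U : C} {V : D} (f : F.obj U ⟶ V) :
    f ▷ F.obj X ≫ pushσ F s V = μ F U X ≫ F.map (s.σ U) ≫ δ F X U ≫ F.obj X ◁ f := by
  have h := congrArg (fun g => F.map g)
    (s.naturality (F.preimage (f ≫ (F.objObjPreimageIso V).inv)))
  simp only [Functor.map_comp, map_whiskerRight, map_whiskerLeft, Functor.map_preimage] at h
  rw [← cancel_epi (δ F U X), ← cancel_mono (F.obj X ◁ (F.objObjPreimageIso V).inv),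
    ← cancel_mono (μ F X _)]
  simp only [pushσ, Category.assoc]
  simp only [comp_whiskerRight, MonoidalCategory.whiskerLeft_comp, Category.assoc] at h
  simp only [δ_μ_assoc]
  rw [← h]
  simp

/-- The image of a half-braiding under a monoidal equivalence. -/
noncomputable def push [F.IsEquivalence] {X : C} (s : HalfBr X) : HalfBr (F.obj X) where
  σ := pushσ F s
  naturality {U V} f := by
    rw [← cancel_epi ((F.objObjPreimageIso U).hom ▷ F.obj X), ← comp_whiskerRight_assoc,
      comp_pushσ, reassoc_of% (comp_pushσ F s (F.objObjPreimageIso U).hom)]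
    simp
  tensor U V := by
    have hU := comp_pushσ F s (F.objObjPreimageIso U).hom
    have hV := comp_pushσ F s (F.objObjPreimageIso V).hom
    have hUV := comp_pushσ F s (δ F _ _ ≫
      ((F.objObjPreimageIso U).hom ⊗ₘ (F.objObjPreimageIso V).hom))
    generalize F.objObjPreimageIso U = i at *
    generalize F.objObjPreimageIso V = j at *
    generalize F.objPreimage U = A at *
    generalize F.objPreimage V = B at *
    rw [← cancel_epi ((i.hom ⊗ₘ j.hom) ▷ F.obj X), ← cancel_epi (δ F A B ▷ F.obj X),
      ← comp_whiskerRight_assoc, hUV, s.tensor]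
    have e : ∀ (f : V ⊗ F.obj X ⟶ F.obj X ⊗ V) (g : U ⊗ F.obj X ⟶ F.obj X ⊗ U),
        (i.hom ⊗ₘ j.hom) ▷ F.obj X ≫ (α_ U V (F.obj X)).hom ≫ U ◁ f ≫ (α_ U (F.obj X) V).inv ≫
          g ▷ V ≫ (α_ (F.obj X) U V).hom = (α_ _ _ _).hom ≫ F.obj A ◁ (j.hom ▷ F.obj X ≫ f) ≫
            (α_ _ _ _).inv ≫ (i.hom ▷ F.obj X ≫ g) ▷ V ≫ (α_ (F.obj X) U V).hom := fun f g => by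
      have w := whisker_exchange i.hom f
      simp only [whiskerRight_tensor, Category.assoc] at w
      simp [tensorHom_def', ← reassoc_of% w]
    rw [e, hU, hV]
    have w : F.obj A ◁ F.obj X ◁ j.hom ≫ (α_ _ _ _).inv ≫ μ F A X ▷ V ≫ F.map (s.σ A) ▷ V ≫
        δ F X A ▷ V ≫ (α_ _ _ _).hom = (α_ _ _ _).inv ≫ μ F A X ▷ _ ≫ F.map (s.σ A) ▷ _ ≫
        δ F X A ▷ _ ≫ (α_ _ _ _).hom ≫ F.obj X ◁ F.obj A ◁ j.hom := by
      rw [associator_inv_naturality_right_assoc, whisker_exchange_assoc, whisker_exchange_assoc,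
        whisker_exchange_assoc, associator_naturality_right]
    simp only [tensorHom_def', MonoidalCategory.whiskerLeft_comp, comp_whiskerRight,
      Category.assoc, Functor.map_comp, map_associator, map_associator_inv,
      map_whiskerLeft, map_whiskerRight, μ_δ_assoc, whiskerLeft_μ_δ_assoc]
    simp [reassoc_of% w]
  unit := by
    have h := comp_pushσ F s (η F)
    rw [s.unit] at h
    rw [← cancel_epi (η F ▷ F.obj X), h]
    simp

theorem push_obj [F.IsEquivalence] {X : C} (s : HalfBr X) (U : C) :
    (push F s).σ (F.obj U) = μ F U X ≫ F.map (s.σ U) ≫ δ F X U := by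
  change pushσ F s _ = _
  simpa using comp_pushσ F s (𝟙 (F.obj U))

/-- Compatibility can be tested on the essential image of a functor. -/
theorem Compat.of_obj [F.EssSurj] {X Y : D} {s : HalfBr X} {t : HalfBr Y} {f : X ⟶ Y}
    (h : ∀ U, F.obj U ◁ f ≫ t.σ (F.obj U) = s.σ (F.obj U) ≫ f ▷ F.obj U) : Compat s t f := by
  intro V
  have i := F.objObjPreimageIso V
  rw [← cancel_epi (i.hom ▷ X), reassoc_of% (s.naturality i.hom), ← whisker_exchange_assoc,
    t.naturality, reassoc_of% (h _), whisker_exchange]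

/-- A monoidal equivalence maps a terminal triple to a terminal triple, so that it identifies the
underlying objects of the given ones, compatibly with the half-braidings. -/
theorem exists_iso [F.IsEquivalence] {M : C} {N : D} {s : HalfBr M} {t : HalfBr N} {a : M ⟶ 𝟙_ C}
    {b : N ⟶ 𝟙_ D} (hs : Terminal s a) (ht : Terminal t b) : ∃ θ : F.obj M ≅ N,
      ∀ U, F.obj U ◁ θ.hom ≫ t.σ (F.obj U) =
        μ F U M ≫ F.map (s.σ U) ≫ δ F M U ≫ θ.hom ▷ F.obj U := by
  obtain ⟨φ, ⟨hφ, cφ⟩, -⟩ := ht (F.obj M) (push F s) (F.map a ≫ η F)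
  let e := F.objObjPreimageIso N
  obtain ⟨ψ, ⟨hψ, cψ⟩, -⟩ := hs (F.objPreimage N) (pull F e t) (F.preimage (e.hom ≫ b ≫ ε F))
  have hψ' : F.map ψ ≫ F.map a = e.hom ≫ b ≫ ε F := by
    rw [← F.map_comp, hψ, F.map_preimage]
  have cφ' : Compat t (push F s) (e.inv ≫ F.map ψ) := by
    refine .of_obj F fun U => ?_
    have h := congrArg (fun f => F.obj U ◁ e.inv ≫ μ F _ _ ≫ F.map f ≫ δ F _ _) (cψ U)
    simp only [Functor.map_comp, map_whiskerLeft, map_whiskerRight, map_pull, Category.assoc,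
      μ_δ_assoc, μ_δ, Category.comp_id, whiskerLeft_inv_hom_assoc] at h
    rw [push_obj, MonoidalCategory.whiskerLeft_comp, Category.assoc, h, comp_whiskerRight]
  have h₁ : (e.inv ≫ F.map ψ) ≫ φ = 𝟙 N := by
    refine (ht N t b).unique ⟨?_, cφ'.comp cφ⟩ ⟨Category.id_comp b, .id t⟩
    rw [Category.assoc, hφ, Category.assoc, reassoc_of% hψ']
    simp
  have h₂ : φ ≫ e.inv ≫ F.map ψ = 𝟙 (F.obj M) := by
    obtain ⟨κ, hκ⟩ := F.map_surjective (φ ≫ e.inv ≫ F.map ψ)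
    have : κ = 𝟙 M := by
      refine (hs M s a).unique ⟨F.map_injective ?_, fun U => F.map_injective ?_⟩
        ⟨Category.id_comp a, .id s⟩
      · rw [F.map_comp, hκ, Category.assoc, Category.assoc, hψ', Iso.inv_hom_id_assoc,
          reassoc_of% hφ, η_ε, Category.comp_id]
      · have h := cφ.comp cφ' (F.obj U)
        rw [push_obj, ← hκ] at h
        simp only [Functor.map_comp, map_whiskerLeft, map_whiskerRight, Category.assoc] at h ⊢
        rw [← cancel_epi (μ F U M), ← cancel_mono (δ F M U)]
        simpa using h
    rw [← hκ, this, F.map_id]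
  exact ⟨⟨φ, e.inv ≫ F.map ψ, h₂, h₁⟩, fun U => by simpa [push_obj] using cφ (F.obj U)⟩

end HalfBr
end halfBraiding

end HopfMorita

namespace HopfMorita
open CategoryTheory MonoidalCategory HopfAlgebra

/-! ### Restriction of modules -/

section restriction
variable {k : Type u} [Field k] {H K : Type u} [Ring H] [Bialgebra k H] [Ring K] [Bialgebra k K]

theorem rtens_comp {U V : Type*} [AddCommGroup U] [Module k U] [AddCommGroup V] [Module k V]
    (f : H →ₐc[k] K) (ρ : K →ₐ[k] Module.End k U) (σ : K →ₐ[k] Module.End k V) (h : H)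
    (x : U ⊗[k] V) :
    rtens ρ σ (f h) x = rtens (ρ.comp (f : H →ₐ[k] K)) (σ.comp (f : H →ₐ[k] K)) h x := by
  rw [rtens_eq, rtens_eq, ← CoalgHomClass.map_comp_comul_apply]
  generalize comul (R := k) h = s
  induction s with
  | zero => simp
  | add s t hs ht => simp only [map_add, LinearMap.add_apply, hs, ht]
  | tmul a b => rfl

/-- Restriction of modules along a homomorphism of bialgebras. -/
noncomputable def res (f : H →ₐc[k] K) : HMod k K ⥤ HMod k H where
  obj M := ⟨M.V, M.ρ.comp (f : H →ₐ[k] K)⟩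
  map {M N} g := HMod.mk' (M := ⟨M.V, _⟩) (N := ⟨N.V, _⟩) (HMod.lin (M := M) (N := N) g) fun h x =>
    HMod.lin_ρ g (f h) x

/-- Restriction is a strict monoidal functor. -/
noncomputable instance (f : H →ₐc[k] K) : (res f).Monoidal :=
  Functor.CoreMonoidal.toMonoidal
    { εIso := HMod.mkIso (LinearEquiv.refl k k) fun h (c : k) => by
        change runit k H h c = runit k K (f h) c
        rw [runit_apply, runit_apply, CoalgHomClass.counit_comp_apply]
      μIso := fun M N => HMod.mkIso (LinearEquiv.refl k (M.V ⊗[k] N.V)) fun h x =>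
        (rtens_comp f M.ρ N.ρ h x).symm
      μIso_hom_natural_left := fun _ _ => rfl
      μIso_hom_natural_right := fun _ _ => rfl
      associativity := fun M N L => HMod.hom_ext <| TensorProduct.ext_threefold fun _ _ _ => rfl
      left_unitality := fun M => HMod.hom_ext <| TensorProduct.ext' fun _ _ => rfl
      right_unitality := fun M => HMod.hom_ext <| TensorProduct.ext' fun (u : M.V) (c : k) =>
        show TensorProduct.rid k M.V (u ⊗ₜ c) = TensorProduct.rid k M.V (u ⊗ₜ c) from rfl }

end restriction

section inclusion
variable (k : Type u) [Field k] (A : Type u) [Ring A] [HopfAlgebra k A] [FiniteDimensional k A]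

/-- The inclusion of `A` into its Drinfel'd double, as a homomorphism of bialgebras. -/
noncomputable def incl : A →ₐc[k] Double k A :=
  BialgHom.ofAlgHom Double.Q
    (AlgHom.ext fun a => by
      change counit (R := k) (Double.Q (k := k) a) = counit (R := k) a
      rw [Double.Q_apply, Double.counit_bow]
      simp)
    (AlgHom.ext fun a => by
      change TensorProduct.map (Double.Q (k := k)).toLinearMap (Double.Q (k := k)).toLinearMap
        (comul a) = comul (Double.Q (k := k) a)
      rw [Double.comul_Q, ← sw_tmul_comul, map_sw (f := fun t => TensorProduct.map
        (Double.Q (k := k)).toLinearMap (Double.Q (k := k)).toLinearMap t) (by fun_prop)]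
      rfl)

theorem schr_Q (a : A) : Double.schr k A (Double.Q a) = Double.adj a := by
  refine LinearMap.ext fun b => ?_
  rw [Double.Q_apply, Double.schr_bow, map_one]
  rfl

theorem schr_P (p : DualCop k A) : Double.schr k A (Double.P p) = Double.coadj p := by
  refine LinearMap.ext fun b => ?_
  rw [Double.P_apply, Double.schr_bow, map_one]
  rfl

end inclusion

@[fun_prop] theorem lin_linearEquiv {k V W : Type*} [CommSemiring k] [AddCommMonoid V] [Module k V]
    [AddCommMonoid W] [Module k W] (f : V ≃ₗ[k] W) : IsLinearMap k (fun x : V => f x) :=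
  f.toLinearMap.isLinear

theorem map_comp_mk {k U X V W : Type*} [CommRing k] [AddCommGroup U] [Module k U]
    [AddCommGroup X] [Module k X] [AddCommGroup V] [Module k V] [AddCommGroup W] [Module k W]
    (f : U ⊗[k] X →ₗ[k] W) (u : U) (s : X ⊗[k] V) :
    TensorProduct.map (f ∘ₗ TensorProduct.mk k U X u) LinearMap.id s =
      TensorProduct.map f LinearMap.id ((TensorProduct.assoc k U X V).symm (u ⊗ₜ s)) := by
  induction s with
  | zero => simp
  | add s t hs ht => simp only [map_add, TensorProduct.tmul_add, hs, ht]
  | tmul y w => rfl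

theorem map_map_id {k U V W X : Type*} [CommRing k] [AddCommGroup U] [Module k U]
    [AddCommGroup X] [Module k X] [AddCommGroup V] [Module k V] [AddCommGroup W] [Module k W]
    (f : V →ₗ[k] W) (g : U →ₗ[k] V) (s : U ⊗[k] X) : TensorProduct.map f LinearMap.id
      (TensorProduct.map g LinearMap.id s) = TensorProduct.map (f ∘ₗ g) LinearMap.id s := by
  induction s with
  | zero => simp
  | add s t hs ht => simp only [map_add, hs, ht]
  | tmul y w => rfl

/-! ### The adjoint module -/

section module
variable {k : Type u} [Field k] {A : Type u} [Ring A] [HopfAlgebra k A] [FiniteDimensional k A]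

variable (k A) in
/-- The regular module. -/
noncomputable def reg : HMod k A := ⟨.of k A, Algebra.lmul k A⟩

variable (k A) in
/-- The unit element, as an element of the regular module. -/
noncomputable def regOne : (reg k A).V := (1 : A)

/-- The homomorphism `a ↦ a u` from the regular module. -/
noncomputable def orb (U : HMod k A) (u : U.V) : reg k A ⟶ U :=
  HMod.mk' (M := reg k A) (LinearMap.applyₗ u ∘ₗ U.ρ.toLinearMap) fun h (x : A) => by
    change U.ρ (h * x) u = U.ρ h (U.ρ x u)
    rw [map_mul]; rfl

theorem tensor_ρ (U V : HMod k A) (a : A) (u : U.V) (v : V.V) :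
    (U ⊗ V).ρ a (u ⊗ₜ[k] v) = sw k (fun x y => U.ρ x u ⊗ₜ[k] V.ρ y v) a := rtens_tmul _ _ _ _ _

theorem lin_tensor_ρ {U V W : HMod k A} (f : U ⊗ V ⟶ W) (a : A) (u : U.V) (v : V.V) :
    sw k (fun x y => HMod.lin f (U.ρ x u ⊗ₜ[k] V.ρ y v)) a =
      W.ρ a (HMod.lin f (u ⊗ₜ[k] v)) := by
  refine Eq.trans ?_ (HMod.lin_ρ f a (u ⊗ₜ[k] v))
  rw [tensor_ρ]
  exact (map_sw (f := fun s : U.V ⊗[k] V.V => HMod.lin f s) (HMod.lin f).isLinear _ _).symm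

theorem unit_ρ (a : A) (c : k) : (𝟙_ (HMod k A)).ρ a c = counit (R := k) a * c := runit_apply _ _

variable (k A) in
/-- The restriction of the Schrödinger module to `A`: the space `A` with the adjoint action. -/
noncomputable def adjModule : HMod k A := (res (incl k A)).obj (schrodingerModule k A)

theorem adjModule_ρ : (adjModule k A).ρ = Double.adj := AlgHom.ext fun a => schr_Q k A a

/-- The linear map `u ⊗ b ↦ ∑ b₂ ⊗ S⁻¹(b₁) u`. -/
noncomputable def adjσ {V : Type u} [AddCommGroup V] [Module k V] (ρ : A →ₐ[k] Module.End k V) :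
    V ⊗[k] A →ₗ[k] A ⊗[k] V :=
  lft (fun u b => sw k (fun x y => y ⊗ₜ[k] ρ (sinv k A x) u) b) (by fun_prop) (by fun_prop)

theorem adjσ_tmul {V : Type u} [AddCommGroup V] [Module k V] (ρ : A →ₐ[k] Module.End k V) (u : V)
    (b : A) : adjσ ρ (u ⊗ₜ b) = sw k (fun x y => y ⊗ₜ[k] ρ (sinv k A x) u) b := rfl

/-- `Δ(a ▶ b) = ∑ a₁ b₁ S(a₃) ⊗ (a₂ ▶ b₂)` for the adjoint action `▶`. -/
theorem sw_adj {M : Type*} [AddCommGroup M] [Module k M] {F : A → A → M}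
    (h₁ : ∀ y, IsLinearMap k (fun x => F x y))
    (h₂ : ∀ x, IsLinearMap k (fun y => F x y)) (a b : A) :
    sw k F (Double.adj (k := k) a b) = sw k (fun p q => sw k (fun q r => sw k (fun x y =>
      F (p * x * antipode k r) (Double.adj (k := k) q y)) b) q) a := by
  rw [Double.adj_apply, map_sw (f := fun t => sw k F t) (by fun_prop)]
  have e : ∀ x y : A, sw k F (x * b * antipode k y) = sw k (fun x₁ x₂ => sw k (fun y₁ y₂ =>
      sw k (fun u v => F (x₁ * u * antipode k y₂) (x₂ * v * antipode k y₁)) b) y) x := by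
    intro x y
    rw [sw_mul h₁ h₂, sw_mul (by fun_prop) (by fun_prop)]
    congr 1; funext x₁ x₂
    rw [sw_comm, sw_antipode (by fun_prop) (by fun_prop)]
  simp only [e]
  have e' : ∀ q r p : A, sw k (fun x y => F (p * x * antipode k r) (Double.adj (k := k) q y)) b =
      sw k (fun q₁ q₂ => sw k (fun x y => F (p * x * antipode k r) (q₁ * y * antipode k q₂)) b)
        q := by
    intro q r p
    rw [← sw_comm]
    congr 1; funext x y
    rw [Double.adj_apply, map_sw (f := fun t => F _ t) (h₂ _)]
  simp only [e']
  rw [sw_coassoc (F := fun x₁ x₂ y => sw k (fun y₁ y₂ =>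
      sw k (fun u v => F (x₁ * u * antipode k y₂) (x₂ * v * antipode k y₁)) b) y)
      (by fun_prop) (by fun_prop) (by fun_prop)]
  congr 1; funext p z
  exact (sw_coassoc (F := fun x₂ y₁ y₂ =>
      sw k (fun u v => F (p * u * antipode k y₂) (x₂ * v * antipode k y₁)) b)
      (by fun_prop) (by fun_prop) (by fun_prop) z).symm

/-- The half-braiding of the adjoint module is `A`-linear. -/
theorem adjσ_rtens {V : Type u} [AddCommGroup V] [Module k V] (ρ : A →ₐ[k] Module.End k V) (a : A)
    (x : V ⊗[k] A) : adjσ ρ (rtens ρ Double.adj a x) = rtens Double.adj ρ a (adjσ ρ x) := by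
  induction x with
  | zero => simp
  | add s t hs ht => simp only [map_add, hs, ht]
  | tmul u b =>
    rw [rtens_tmul, map_sw (f := fun t => adjσ ρ t) (by fun_prop), adjσ_tmul,
      map_sw (f := fun t => rtens Double.adj ρ a t) (by fun_prop)]
    simp only [adjσ_tmul, rtens_tmul]
    have e : ∀ x y : A, sw k (fun p q => q ⊗ₜ[k] ρ (sinv k A p) (ρ x u)) (Double.adj (k := k) y b) =
        sw k (fun p z => sw k (fun q r => sw k (fun c d => Double.adj (k := k) q d ⊗ₜ[k]
          ρ (r * sinv k A c * (sinv k A p * x)) u) b) z) y := by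
      intro x y
      rw [sw_adj (by fun_prop) (by fun_prop)]
      simp only [sinv_mul, sinv_antipode, map_mul, Module.End.mul_apply]
    simp only [e]
    rw [← sw_coassoc (F := fun x p z => sw k (fun q r => sw k (fun c d =>
          Double.adj (k := k) q d ⊗ₜ[k] ρ (r * sinv k A c * (sinv k A p * x)) u) b) z)
        (by fun_prop) (by fun_prop) (by fun_prop)]
    have e₂ : ∀ x z : A, sw k (fun x p => sw k (fun q r => sw k (fun c d =>
        Double.adj (k := k) q d ⊗ₜ[k] ρ (r * sinv k A c * (sinv k A p * x)) u) b) z) x =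
        counit (R := k) x • sw k (fun q r => sw k (fun c d =>
          Double.adj (k := k) q d ⊗ₜ[k] ρ (r * sinv k A c) u) b) z := by
      intro x z
      rw [sw_sinv_mul (f := fun t => sw k (fun q r => sw k (fun c d =>
        Double.adj (k := k) q d ⊗ₜ[k] ρ (r * sinv k A c * t) u) b) z) (by fun_prop)]
      simp only [mul_one]
    simp only [e₂]
    rw [sw_counit_left (f := fun z => sw k (fun q r => sw k (fun c d =>
          Double.adj (k := k) q d ⊗ₜ[k] ρ (r * sinv k A c) u) b) z) (by fun_prop), sw_comm]
    simp only [map_mul, Module.End.mul_apply]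

theorem adjσ_map {U V : Type u} [AddCommGroup U] [Module k U] [AddCommGroup V] [Module k V]
    {ρ : A →ₐ[k] Module.End k U} {σ : A →ₐ[k] Module.End k V} (f : U →ₗ[k] V)
    (hf : ∀ a u, f (ρ a u) = σ a (f u)) (u : U) (b : A) :
    adjσ σ (f u ⊗ₜ b) = TensorProduct.map LinearMap.id f (adjσ ρ (u ⊗ₜ b)) := by
  rw [adjσ_tmul, adjσ_tmul, map_sw (f := fun t => TensorProduct.map LinearMap.id f t)
    (by fun_prop)]
  simp only [TensorProduct.map_tmul, LinearMap.id_apply, hf]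

theorem counit_adj (a b : A) : counit (R := k) (Double.adj (k := k) a b) =
    counit (R := k) a * counit (R := k) b := by
  rw [Double.adj_apply, map_sw (f := fun t : A => counit (R := k) t) (by fun_prop)]
  have := sw_counit_left (k := k) (f := fun x : A => counit (R := k) b * counit (R := k) x)
    (by fun_prop) a
  simp only [smul_eq_mul, ← mul_assoc] at this
  simp only [Bialgebra.counit_mul, counit_antipode, this]
  exact mul_comm _ _

theorem adjσ_tensor {U V : Type u} [AddCommGroup U] [Module k U] [AddCommGroup V] [Module k V]
    (ρ : A →ₐ[k] Module.End k U) (σ : A →ₐ[k] Module.End k V) (u : U) (v : V) (b : A) :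
    adjσ (rtens ρ σ) ((u ⊗ₜ v) ⊗ₜ b) = TensorProduct.assoc k A U V
      (TensorProduct.map (adjσ ρ) LinearMap.id ((TensorProduct.assoc k U A V).symm
        (u ⊗ₜ adjσ σ (v ⊗ₜ b)))) := by
  have e : ∀ x y : A, y ⊗ₜ[k] rtens ρ σ (sinv k A x) (u ⊗ₜ v) = sw k (fun p q =>
      y ⊗ₜ[k] (ρ (sinv k A q) u ⊗ₜ[k] σ (sinv k A p) v)) x := fun x y => by
    rw [rtens_tmul, sw_sinv (by fun_prop) (by fun_prop),
      map_sw (f := fun t => y ⊗ₜ t) (by fun_prop)]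
  have e' : ∀ x y : A, TensorProduct.assoc k A U V (adjσ ρ (u ⊗ₜ y) ⊗ₜ σ (sinv k A x) v) =
      sw k (fun p q => q ⊗ₜ[k] (ρ (sinv k A p) u ⊗ₜ[k] σ (sinv k A x) v)) y := fun x y => by
    rw [adjσ_tmul, map_sw (f := fun t => TensorProduct.assoc k A U V (t ⊗ₜ σ (sinv k A x) v))
      (by fun_prop)]
    simp only [TensorProduct.assoc_tmul]
  rw [adjσ_tmul, adjσ_tmul, map_sw (f := fun t => TensorProduct.assoc k A U V
      (TensorProduct.map (adjσ ρ) LinearMap.id ((TensorProduct.assoc k U A V).symm (u ⊗ₜ t))))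
      ((TensorProduct.assoc k A U V).toLinearMap ∘ₗ TensorProduct.map (adjσ ρ) LinearMap.id ∘ₗ
        (TensorProduct.assoc k U A V).symm.toLinearMap ∘ₗ
          TensorProduct.mk k U (A ⊗[k] V) u).isLinear]
  simp only [TensorProduct.assoc_symm_tmul, TensorProduct.map_tmul, LinearMap.id_apply, e, e']
  exact sw_coassoc (F := fun p q y => y ⊗ₜ[k] (ρ (sinv k A q) u ⊗ₜ[k] σ (sinv k A p) v))
    (by fun_prop) (by fun_prop) (by fun_prop) b

/-- The half-braiding of the adjoint module, contracted with the counit. -/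
theorem lid_counit_adjσ {V : Type u} [AddCommGroup V] [Module k V] (ρ : A →ₐ[k] Module.End k V)
    (v : V) (b : A) : TensorProduct.lid k V (TensorProduct.map (counit (R := k) (A := A))
      LinearMap.id (adjσ ρ (v ⊗ₜ b))) = ρ (sinv k A b) v := by
  rw [adjσ_tmul, map_sw (f := fun t => TensorProduct.lid k V (TensorProduct.map
    (counit (R := k) (A := A)) LinearMap.id t)) (by fun_prop)]
  simp only [TensorProduct.map_tmul, TensorProduct.lid_tmul, LinearMap.id_apply]
  rw [sw_counit_right (f := fun x => ρ (sinv k A x) v) (by fun_prop)]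

theorem adjσ_unit (c : k) (b : A) : adjσ (runit k A) (c ⊗ₜ b) = (c • b) ⊗ₜ (1 : k) := by
  rw [adjσ_tmul]
  simp only [runit_apply, counit_sinv, ← smul_eq_mul, TensorProduct.tmul_smul]
  rw [sw_counit_left (f := fun y : A => y ⊗ₜ[k] c) (by fun_prop), TensorProduct.smul_tmul,
    smul_eq_mul, mul_one]

variable (k A) in
/-- The half-braiding `u ⊗ b ↦ ∑ b₂ ⊗ S⁻¹(b₁) u` on the adjoint module. -/
noncomputable def adjHalfBr : HalfBr (adjModule k A) where
  σ U := HMod.mk' (adjσ (A := A) U.ρ) (by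
    have h := adjσ_rtens (A := A) U.ρ
    rw [← adjModule_ρ] at h
    exact h)
  naturality {U V} f := HMod.hom_ext <| TensorProduct.ext' fun u b =>
    adjσ_map (HMod.lin f) (HMod.lin_ρ f) u b
  tensor U V := HMod.hom_ext <| TensorProduct.ext_threefold fun u v b =>
    adjσ_tensor (A := A) U.ρ V.ρ u v b
  unit := HMod.hom_ext <| TensorProduct.ext' fun c b => adjσ_unit (A := A) c b

variable (k A) in
/-- The counit, as a morphism from the adjoint module to the unit object. -/
noncomputable def adjCounit : adjModule k A ⟶ 𝟙_ (HMod k A) :=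
  HMod.mk' (M := adjModule k A) (counit (R := k) (A := A)) fun a b => by
    rw [adjModule_ρ]
    exact (counit_adj a b).trans (runit_apply a _).symm

/-! ### Universal property of the adjoint module -/

section terminal
variable {X : HMod k A} (t : HalfBr X) (g : X ⟶ 𝟙_ (HMod k A))

/-- A half-braiding on `X` followed by a morphism from `X` to the unit object. -/
noncomputable def contr (U : HMod k A) : U ⊗ X ⟶ U := t.σ U ≫ g ▷ U ≫ (λ_ U).hom

theorem contr_natural {U V : HMod k A} (f : U ⟶ V) : f ▷ X ≫ contr t g V = contr t g U ≫ f := by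
  rw [contr, reassoc_of% (t.naturality f), whisker_exchange_assoc]
  simp [contr]

theorem contr_unit : contr t g (𝟙_ (HMod k A)) = (λ_ X).hom ≫ g := by
  rw [contr, t.unit, unitors_equal]
  simp

theorem contr_tensor (U V : HMod k A) : contr t g (U ⊗ V) =
    (α_ U V X).hom ≫ U ◁ t.σ V ≫ (α_ U X V).inv ≫ contr t g U ▷ V := by
  simp [contr, t.tensor]

/-- The linear map `ψ : X → A` such that `u ⊗ x ↦ ψ(x) u` is the contracted half-braiding. -/
noncomputable def ctr : X.V →ₗ[k] A :=
  HMod.lin (contr t g (reg k A)) ∘ₗ TensorProduct.mk k (reg k A).V X.V (regOne k A)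

/-- The contracted half-braiding is given by `ψ` at every module, by naturality along `a ↦ a u`. -/
theorem contr_tmul (U : HMod k A) (u : U.V) (x : X.V) :
    HMod.lin (contr t g U) (u ⊗ₜ x) = U.ρ (ctr t g x) u := by
  have h := LinearMap.congr_fun (congrArg HMod.lin (contr_natural t g (orb U u)))
    (regOne k A ⊗ₜ[k] x)
  refine Eq.trans ?_ h
  change _ = HMod.lin (contr t g U) (U.ρ 1 u ⊗ₜ x)
  rw [map_one]; rfl

theorem counit_ctr (x : X.V) : counit (R := k) (ctr t g x) = HMod.lin g x := by
  have h := contr_tmul t g (𝟙_ (HMod k A)) (1 : k) x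
  rw [contr_unit] at h
  have h' := h.symm.trans (congrArg (HMod.lin g) (one_smul k x))
  rw [← h']
  exact ((unit_ρ _ _).trans (mul_one _)).symm

/-- `ψ(a x) = ∑ a₂ ψ(x) S⁻¹(a₁)`. Equivalently, `S ∘ ψ` intertwines the given action and the
adjoint one. -/
theorem ctr_ρ (a : A) (x : X.V) :
    ctr t g (X.ρ a x) = sw k (fun p q => q * ctr t g x * sinv k A p) a := by
  -- This is the linearity of the contracted half-braiding on `A ⊗ X`, evaluated at `1 ⊗ x`.
  have h : ∀ a : A, sw k (fun p q => ctr t g (X.ρ q x) * p) a = a * ctr t g x := by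
    intro a
    have h := lin_tensor_ρ (contr t g (reg k A)) a (regOne k A) x
    simp only [contr_tmul] at h
    refine Eq.trans ?_ (h.trans ?_)
    · congr 1; funext p q
      change _ = ctr t g (X.ρ q x) * (p * 1)
      rw [mul_one]
    · change a * (ctr t g x * 1) = _
      rw [mul_one]
  simp only [← h]
  have e : ∀ p q : A, sw k (fun u v => ctr t g (X.ρ v x) * u) q * sinv k A p =
      sw k (fun u v => ctr t g (X.ρ v x) * (u * sinv k A p)) q := fun p q => by
    rw [map_sw (f := fun s => s * sinv k A p) (by fun_prop)]
    simp only [mul_assoc]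
  simp only [e]
  rw [← sw_coassoc (F := fun p u v => ctr t g (X.ρ v x) * (u * sinv k A p))
    (by fun_prop) (by fun_prop) (by fun_prop)]
  have e' : ∀ y z : A, sw k (fun u v => ctr t g (X.ρ z x) * (v * sinv k A u)) y =
      counit (R := k) y • ctr t g (X.ρ z x) := fun y z => by
    rw [sw_mul_sinv (f := fun s => ctr t g (X.ρ z x) * s) (by fun_prop), mul_one]
  simp only [e']
  rw [sw_counit_left (f := fun z => ctr t g (X.ρ z x)) (by fun_prop)]

/-- For `V = A` and `v = 1` this says that `Δ(ψ(x)) = (ψ ⊗ id) (σ (1 ⊗ x))`. It follows from the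
compatibility of a half-braiding with the tensor product of the regular module and `V`. -/
theorem ctr_comul (V : HMod k A) (v : V.V) (x : X.V) :
    TensorProduct.map (ctr t g) LinearMap.id (HMod.lin (t.σ V) (v ⊗ₜ x)) =
      sw k (fun p q => p ⊗ₜ[k] V.ρ q v) (ctr t g x) := by
  have h := contr_tmul t g (reg k A ⊗ V) (regOne k A ⊗ₜ[k] v) x
  rw [tensor_ρ, contr_tensor] at h
  refine Eq.trans ?_ (h.trans ?_)
  · change _ = TensorProduct.map (HMod.lin (contr t g (reg k A))) LinearMap.id
      ((TensorProduct.assoc k A X.V V.V).symm (regOne k A ⊗ₜ (HMod.lin (t.σ V) (v ⊗ₜ x))))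
    exact map_comp_mk _ _ _
  · congr 1; funext p q
    change (p * 1) ⊗ₜ[k] _ = _
    rw [mul_one]

/-- The morphism `S ∘ ψ` to the adjoint module. -/
noncomputable def toAdj : X ⟶ adjModule k A :=
  HMod.mk' (N := adjModule k A) (antipode k ∘ₗ ctr t g : X.V →ₗ[k] A) fun a x => by
    rw [adjModule_ρ]
    change antipode k (ctr t g (X.ρ a x)) = Double.adj (k := k) a (antipode k (ctr t g x))
    rw [ctr_ρ, map_sw (f := fun s : A => antipode k s) (by fun_prop), Double.adj_apply]
    simp only [antipode_mul_antidistrib, antipode_sinv, mul_assoc]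

end terminal

variable (k A) in
/-- The adjoint module is terminal among objects with a half-braiding and a morphism to the
unit object. -/
theorem adj_terminal : HalfBr.Terminal (adjHalfBr k A) (adjCounit k A) := by
  intro X t g
  refine ⟨toAdj t g, ⟨HMod.hom_ext <| LinearMap.ext fun x => ?_, fun U => HMod.hom_ext <|
    TensorProduct.ext' fun u x => ?_⟩, fun f ⟨hf, cf⟩ => HMod.hom_ext <| LinearMap.ext fun x => ?_⟩
  · change counit (R := k) (antipode k (ctr t g x)) = _
    rw [counit_antipode, counit_ctr]
  · change adjσ U.ρ (u ⊗ₜ antipode k (ctr t g x)) = TensorProduct.map (antipode k ∘ₗ ctr t g)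
      LinearMap.id (HMod.lin (t.σ U) (u ⊗ₜ x))
    rw [adjσ_tmul, sw_antipode (by fun_prop) (by fun_prop)]
    have h := congrArg (TensorProduct.map (antipode k) LinearMap.id) (ctr_comul t g U u x)
    rw [map_sw (f := fun t => TensorProduct.map (antipode k) LinearMap.id t) (by fun_prop)] at h
    simp only [TensorProduct.map_tmul, LinearMap.id_apply] at h
    simp only [sinv_antipode]
    exact h.symm.trans (map_map_id _ _ _)
  -- Uniqueness: contract the compatibility at `1 ⊗ x` in `A ⊗ X` with the counit.
  · have h := LinearMap.congr_fun (congrArg HMod.lin (cf (reg k A))) (regOne k A ⊗ₜ[k] x)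
    have h' := congrArg (fun s => TensorProduct.lid k A
      (TensorProduct.map (counit (R := k) (A := A)) LinearMap.id s)) h
    have h₁ := lid_counit_adjσ (reg k A).ρ (regOne k A) (HMod.lin f x)
    have h₂ : TensorProduct.lid k A (TensorProduct.map (counit (R := k) (A := A)) LinearMap.id
        (TensorProduct.map (HMod.lin f) LinearMap.id
          (HMod.lin (t.σ (reg k A)) (regOne k A ⊗ₜ[k] x)))) =
        ctr t g x := by
      rw [← hf]
      exact congrArg (TensorProduct.lid k A) (map_map_id _ _ _)
    have h₃ := h₁.symm.trans (h'.trans h₂)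
    have h₄ : sinv k A (HMod.lin f x) = ctr t g x :=
      (mul_one (sinv k A (HMod.lin f x))).symm.trans h₃
    exact (antipode_sinv (k := k) (A := A) _).symm.trans (congrArg (antipode k) h₄)

end module
end HopfMorita

namespace HopfMorita
open CategoryTheory MonoidalCategory HopfAlgebra
open Functor.LaxMonoidal Functor.OplaxMonoidal Functor.Monoidal

/-! ### Comparison of the braided dimensions -/

section braiding
variable (k : Type u) [Field k] (A : Type u) [Ring A] [HopfAlgebra k A] [FiniteDimensional k A]

/-- The action of the universal `R`-matrix `∑ᵢ (ε ⋈ eᵢ) ⊗ (eⁱ ⋈ 1)`, computed from the expansion of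
`S⁻¹(y₁)` in the basis `eᵢ`. -/
theorem braidEquiv_schr (x y : A) :
    braidEquiv (Double.schr k A) (Double.schr k A) (x ⊗ₜ y) =
      adjσ (Double.adj (k := k) (A := A)) (x ⊗ₜ y) := by
  have h : (RM k (Double k A) : Double k A ⊗[k] Double k A) =
    ∑ i, Double.Q (bas k A i) ⊗ₜ[k] Double.P (dbas k A i) := rfl
  rw [braidEquiv_apply, h, map_sum, LinearMap.sum_apply, map_sum, adjσ_tmul]
  simp only [tens_tmul, schr_Q, schr_P, TensorProduct.comm_tmul, Double.coadj_apply]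
  have e : ∀ i, sw k (fun u v => pr (dbas k A i) (sinv k A u) • v) y ⊗ₜ[k]
      Double.adj (k := k) (bas k A i) x = sw k (fun u v =>
        pr (dbas k A i) (sinv k A u) • (v ⊗ₜ[k] Double.adj (k := k) (bas k A i) x)) y := fun i => by
    rw [map_sw (f := fun t => t ⊗ₜ[k] Double.adj (k := k) (bas k A i) x) (by fun_prop)]
    simp only [TensorProduct.smul_tmul']
  simp only [e]
  rw [← Double.sw_sum]
  congr 1; funext u v
  exact dbas_sum (f := fun a => v ⊗ₜ[k] Double.adj (k := k) a x) (by fun_prop) (sinv k A u)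

/-- The braiding of the Schrödinger module with itself is a component of the half-braiding of its
restriction. -/
theorem map_braiding : (adjHalfBr k A).σ (adjModule k A) =
    μ (res (incl k A)) _ _ ≫ (res (incl k A)).map
      (β_ (schrodingerModule k A) (schrodingerModule k A)).hom ≫ δ (res (incl k A)) _ _ :=
  HMod.hom_ext <| TensorProduct.ext' fun (x y : A) => by
    refine Eq.trans ?_ (braidEquiv_schr k A x y).symm
    exact congrArg (fun ρ : A →ₐ[k] Module.End k A => adjσ ρ (x ⊗ₜ[k] y)) adjModule_ρ

end braiding

/-- An isomorphism compatible with half-braidings identifies their components at the objects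
themselves. -/
theorem HalfBr.σ_self {C D : Type*} [Category* C] [MonoidalCategory C] [Category* D]
    [MonoidalCategory D] (F : C ⥤ D) [F.Monoidal] {M : C} {N : D} (s : HalfBr M) (t : HalfBr N)
    (θ : F.obj M ≅ N) (h : ∀ U, F.obj U ◁ θ.hom ≫ t.σ (F.obj U) =
        μ F U M ≫ F.map (s.σ U) ≫ δ F M U ≫ θ.hom ▷ F.obj U) :
    F.map (s.σ M) ≫ δ F M M ≫ (θ.hom ⊗ₘ θ.hom) = δ F M M ≫ (θ.hom ⊗ₘ θ.hom) ≫ t.σ N := by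
  rw [tensorHom_def', Category.assoc, t.naturality, reassoc_of% (h M), ← tensorHom_def',
    MonoidalCategory.tensorHom_def, δ_μ_assoc]

theorem Rel.of_map {C C' D D' : Type*} [Category* C] [MonoidalCategory C] [Category* D]
    [MonoidalCategory D] [Category* C'] [MonoidalCategory C'] [Category* D']
    [MonoidalCategory D'] {R : C' ⥤ C} {R' : D' ⥤ D} {F : C ⥤ D} [R.Monoidal] [R'.Monoidal]
    [F.Monoidal] {X : C'} {Y : D'} (θ : F.obj (R.obj X) ≅ R'.obj Y) {f : X ⊗ X ⟶ X ⊗ X}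
    {g : Y ⊗ Y ⟶ Y ⊗ Y} (h : F.map (μ R X X ≫ R.map f ≫ δ R X X) ≫ δ F _ _ ≫
      (θ.hom ⊗ₘ θ.hom) = δ F _ _ ≫ (θ.hom ⊗ₘ θ.hom) ≫ μ R' Y Y ≫ R'.map g ≫ δ R' Y Y) :
    Rel (P := R ⋙ F) (tensRel θ θ) (tensRel θ θ) f g := by
  have h' := congrArg (fun x => F.map (δ R X X) ≫ x ≫ μ R' Y Y) h
  simp only [Functor.map_comp, Category.assoc, Functor.Monoidal.map_δ_μ_assoc, δ_μ,
    Category.comp_id] at h'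
  simpa [Rel, tensRel] using h'

/-- Related endomorphisms of the unit objects act by the same scalar. -/
theorem Rel.scalar {k A B A' B' : Type u} [Field k] [Ring A] [Bialgebra k A] [Ring B]
    [Bialgebra k B] [Ring A'] [Bialgebra k A'] [Ring B'] [Bialgebra k B'] (R : A →ₐc[k] A') (R' : B →ₐc[k] B')
    (F : HMod k A ⥤ HMod k B) [F.Additive] [F.Linear k] [F.Monoidal]
    {f : 𝟙_ (HMod k A') ⟶ 𝟙_ (HMod k A')} {g : 𝟙_ (HMod k B') ⟶ 𝟙_ (HMod k B')}
    (h : Rel (unitRel (res R ⋙ F) (res R')) (unitRel (res R ⋙ F) (res R')) f g) :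
    HMod.scalar f = HMod.scalar g := by
  have hf : (res R).map f = HMod.scalar f • 𝟙 _ := HMod.hom_ext <| LinearMap.ext_ring <|
    (mul_one (HMod.scalar f)).symm
  have hg : (res R').map g = HMod.scalar g • 𝟙 _ := HMod.hom_ext <| LinearMap.ext_ring <|
    (mul_one (HMod.scalar g)).symm
  have hF : (res R ⋙ F).map f = HMod.scalar f • 𝟙 ((res R ⋙ F).obj _) := by
    rw [Functor.comp_map, hf, F.map_smul, F.map_id]
    rfl
  rw [Rel, hF, hg, Linear.smul_comp, Linear.comp_smul, Category.id_comp, Category.comp_id] at h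
  have h' := congrArg (fun s => (unitRel (res R ⋙ F) (res R')).inv ≫ s) h
  simp only [Linear.comp_smul, Iso.inv_hom_id] at h'
  have h'' := LinearMap.congr_fun (congrArg HMod.lin h') (1 : k)
  exact (mul_one (HMod.scalar f)).symm.trans (h''.trans (mul_one (HMod.scalar g)))

variable {k A B : Type u} [Field k] [Ring A] [HopfAlgebra k A] [FiniteDimensional k A]
  [Ring B] [HopfAlgebra k B] [FiniteDimensional k B]

/-- The braided dimensions of the Schrödinger modules are invariants of the monoidal category of
modules. -/
theorem MonoidalMoritaEquivalent.bdim_eq (h : MonoidalMoritaEquivalent k A B) {n : ℕ}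
    (b : BraidGroup n) : bdimRight k A b = bdimRight k B b ∧ bdimLeft k A b = bdimLeft k B b := by
  obtain ⟨F, _, _, _, ⟨_⟩⟩ := h
  obtain ⟨θ, hθ⟩ := HalfBr.exists_iso F (adj_terminal k A) (adj_terminal k B)
  have h := HalfBr.σ_self F _ _ θ hθ
  rw [map_braiding, map_braiding] at h
  have hS := Rel.of_map (R := res (incl k A)) (R' := res (incl k B)) θ h
  exact ⟨Rel.scalar _ _ F (hS.rightBraidedDim b), Rel.scalar _ _ F (hS.leftBraidedDim b)⟩

end HopfMorita

theorem mainTheorem2 {k A B : Type u} [Field k] [Ring A] [HopfAlgebra k A] [FiniteDimensional k A]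
    [Ring B] [HopfAlgebra k B] [FiniteDimensional k B]
    (h : HopfMorita.MonoidalMoritaEquivalent k A B) (n : ℕ) (b : HopfMorita.BraidGroup n) :
    HopfMorita.bdimRight k A b = HopfMorita.bdimRight k B b ∧
      HopfMorita.bdimLeft k A b = HopfMorita.bdimLeft k B b := h.bdim_eq b
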